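/- **Setting.** Let $m\ge 1$, let $(\Omega,\mathcal F,\mathbb P)$ be a probability space with a filtration $(\mathcal F_k)_{k\ge0}$, and write $\mathbb E_k=\mathbb E[\,\cdot\mid\mathcal F_k]$. Observations are $$y_{k+1}=S_k(\phi_k^T\theta+e_{k+1}),\quad k\ge 0,\qquad S_k(x)=\begin{cases}L_k,&x<l_k\\ x,&l_k\le x\le u_k\\ U_k,&x>u_k,\end{cases}$$ with $\theta\in\mathbb R^m$; the thresholds are allowed to be infinite ($l_k=L_k=-\infty$ and/or $u_k=U_k=+\infty$). **Assumption 1.** $\phi_k\in\mathbb R^m$ is $\mathcal F_k$-measurable, $\sup_k\|\phi_k\|<\infty$ a.s., and $\theta$ is an interior point of a convex compact set $D\subseteq\mathbb R^m$. Let $(M_k)$ be an adapted, a.s. bounded real sequence with $\sup_{x\in D}|\phi_k^Tx|\le M_k$ a.s. for all $k$. **Assumption 2.** $l_k,u_k,L_k,U_k$ are $\mathcal F_k$-measurable, and there are square-integrable random variables $c,l,u\ge0$ such that a.s. for all $k$: $l_k-c\le L_k\le l_k\le u_k\le U_k\le u_k+c$, $\max(l_k,0)\le l$ and $\max(-u_k,0)\le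 u$. **Assumption 3.** $e_{k+1}$ is square integrable and $\mathcal F_{k+1}$-measurable with $\mathbb E_k\{e_{k+1}\}=0$; for some constant $\eta>0$, a.s. $\inf_k\mathbb E_k\{|e_{k+1}|^2\}>0$ and $\sup_k\mathbb E_k\{|e_{k+1}|^{2+\eta}\}<\infty$. The functions $G_k(x)=\mathbb E_k\{S_k(x+e_{k+1})\}$ are a.s. differentiable in $x$, and there are a random variable $M>\sup_kM_k$ and a random variable $\rho\ge0$ such that a.s. $0<\inf_{|x|\le M,k\ge0}G_k'(x)\le\sup_{|x|\le M,k\ge0}G_k'(x)<\infty$ and $|G_k'(x)-G_k'(x')|\le\rho|x-x'|$ for all $k$ and $|x|,|x'|\le M$. **Two-step quasi-Newton (TSQN) algorithm.** Put $\underline g_k=\inf_{|x|\le M_k}G_k'(x)$, $\overline g_k=\sup_{|x|\le M_k}G_k'(x)$, and for a positive definite matrix $Q$ let $\Pi_Q(x)=\arg\min_{z\in D}(x-z)^TQ(x-z)$. Let $(\mu_k)$ be any adapted positive process with $0<\inf_k\mu_k\le\sup_k\mu_k<\infty$ a.s. Start from any $\bar\theta_0,\hat\theta_0\in D$ and any positive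 definite matrices $\bar P_0,P_0$, and for $k\ge0$ set $$\bar\beta_k=\min\Big\{\underline g_k,\tfrac1{2\overline g_k\phi_k^T\bar P_k\phi_k+1}\Big\},\quad \bar a_k=\tfrac1{1+\bar\beta_k^2\phi_k^T\bar P_k\phi_k},\quad \bar P_{k+1}=\bar P_k-\bar a_k\bar\beta_k^2\bar P_k\phi_k\phi_k^T\bar P_k,$$ $$\bar\theta_{k+1}=\Pi_{\bar P_{k+1}^{-1}}\{\bar\theta_k+\bar a_k\bar\beta_k\bar P_k\phi_k[y_{k+1}-G_k(\phi_k^T\bar\theta_k)]\};$$ $$a_k=\tfrac1{\mu_k+\beta_k^2\phi_k^TP_k\phi_k},\quad P_{k+1}=P_k-a_k\beta_k^2P_k\phi_k\phi_k^TP_k,\quad \hat\theta_{k+1}=\Pi_{P_{k+1}^{-1}}\{\hat\theta_k+a_k\beta_kP_k\phi_k[y_{k+1}-G_k(\phi_k^T\hat\theta_k)]\},$$ where $\beta_k=\dfrac{G_k(\phi_k^T\bar\theta_k)-G_k(\phi_k^T\hat\theta_k)}{\phi_k^T\bar\theta_k-\phi_k^T\hat\theta_k}$ if $\phi_k^T\bar\theta_k\ne\phi_k^T\hat\theta_k$,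 and $\beta_k=G_k'(\phi_k^T\hat\theta_k)$ otherwise. **Theorem.** Let $\lambda_0>\|P_0^{-1}\|$ (operator norm), and let $\lambda_{\max}(k)$, $\lambda_{\min}(k)$ be the largest and the smallest eigenvalue of $\sum_{i=0}^k\phi_i\phi_i^T+\lambda_0I$. Under Assumptions 1–3, for almost every sample path along which $\lambda_{\max}(k)$ does not converge to $1$ (in particular for almost every sample path if $\lambda_0>1$, or if $\lambda_{\max}(k)\to\infty$ a.s.), as $k\to\infty$, $$\|\theta-\hat\theta_{k+1}\|^2=O\!\left(\frac{\log\lambda_{\max}(k)}{\lambda_{\min}(k)}\right),$$ where $f_k=O(g_k)$ means $|f_k|\le C|g_k|$ for all large $k$, with $C$ depending on the sample path. Consequently, for almost every such path, $\log\lambda_{\max}(k)/\lambda_{\min}(k)\to0$ implies $\hat\theta_k\to\theta$. -/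

import Mathlib

open MeasureTheory ProbabilityTheory Filter Topology Matrix Asymptotics

namespace TSQN

noncomputable section

/-! ### The saturated observation model -/

/-- The saturation function with observable range `[l, u]` and saturated values `L`, `U`.
The thresholds are extended reals, so that `l = L = -∞` (no saturation from below) and
`u = U = +∞` (no saturation from above) are allowed; the corresponding branch is then never used. -/
def saturation (l u L U : EReal) (x : ℝ) : ℝ :=
  if (x : EReal) < l then L.toReal else if (x : EReal) ≤ u then x else U.toReal

/-! ### Matrices -/

variable {m : ℕ}

/-- The product `A x` of a matrix and a vector of Euclidean space. -/
def mulE (A : Matrix (Fin m) (Fin m) ℝ) (x : EuclideanSpace ℝ (Fin m)) :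
    EuclideanSpace ℝ (Fin m) :=
  WithLp.toLp 2 (A *ᵥ x.ofLp)

/-- The quadratic form `xᵀ A x`. -/
def quad (A : Matrix (Fin m) (Fin m) ℝ) (x : EuclideanSpace ℝ (Fin m)) : ℝ :=
  x.ofLp ⬝ᵥ (A *ᵥ x.ofLp)

/-- The rank-one matrix `x xᵀ`. -/
def outer (x : EuclideanSpace ℝ (Fin m)) : Matrix (Fin m) (Fin m) ℝ :=
  Matrix.vecMulVec x.ofLp x.ofLp

/-- The largest eigenvalue of a real symmetric matrix. -/
def lamMax (A : Matrix (Fin m) (Fin m) ℝ) : ℝ := sSup (spectrum ℝ A)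

/-- The smallest eigenvalue of a real symmetric matrix. -/
def lamMin (A : Matrix (Fin m) (Fin m) ℝ) : ℝ := sInf (spectrum ℝ A)

/-- The information matrix `∑_{i=0}^k φ_i φ_iᵀ + lam0 I`. -/
def infoMatrix (φ : ℕ → EuclideanSpace ℝ (Fin m)) (lam0 : ℝ) (k : ℕ) :
    Matrix (Fin m) (Fin m) ℝ :=
  ∑ i ∈ Finset.range (k + 1), outer (φ i) + lam0 • (1 : Matrix (Fin m) (Fin m) ℝ)

/-! ### The projection -/

/-- The norm `‖x‖_Q = (xᵀ Q x)^{1/2}`. -/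
def normQ (Q : Matrix (Fin m) (Fin m) ℝ) (x : EuclideanSpace ℝ (Fin m)) : ℝ :=
  Real.sqrt (quad Q x)

/-- The projection `argmin_{y ∈ D} ‖x - y‖_Q`; the minimizer exists and is unique when `D` is
nonempty, compact and convex and `Q` is positive definite. -/
def proj (D : Set (EuclideanSpace ℝ (Fin m))) (Q : Matrix (Fin m) (Fin m) ℝ)
    (x : EuclideanSpace ℝ (Fin m)) : EuclideanSpace ℝ (Fin m) :=
  Classical.epsilon fun y => y ∈ D ∧ ∀ z ∈ D, normQ Q (x - y) ≤ normQ Q (x - z)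

/-! ### The two-step quasi-Newton algorithm, along one sample path

`φ k` is the regressor, `y (k + 1)` the observation, `G k` the conditional expectation function,
`M k` the bound that defines the extreme slopes of `G k`, `μ k` the regularization factor. -/

/-- `inf_{|x| ≤ M} g'(x)`. -/
def slopeInf (g : ℝ → ℝ) (M : ℝ) : ℝ := sInf (deriv g '' {x | |x| ≤ M})

/-- `sup_{|x| ≤ M} g'(x)`. -/
def slopeSup (g : ℝ → ℝ) (M : ℝ) : ℝ := sSup (deriv g '' {x | |x| ≤ M})

/-- The scalar gain `β̄_k` of the first step. -/
def betaBar (g : ℝ → ℝ) (M : ℝ) (x : EuclideanSpace ℝ (Fin m))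
    (P : Matrix (Fin m) (Fin m) ℝ) : ℝ :=
  min (slopeInf g M) (1 / (2 * slopeSup g M * quad P x + 1))

/-- One step of a quasi-Newton recursion with scalar gains `a` and `b`:
`P⁺ = P - a b² P x xᵀ P` and `θ⁺ = Π_{(P⁺)⁻¹} (θ + a b P x (y - g (xᵀ θ)))`. -/
def qnUpdate (D : Set (EuclideanSpace ℝ (Fin m))) (a b : ℝ) (g : ℝ → ℝ)
    (x : EuclideanSpace ℝ (Fin m)) (y : ℝ)
    (s : EuclideanSpace ℝ (Fin m) × Matrix (Fin m) (Fin m) ℝ) :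
    EuclideanSpace ℝ (Fin m) × Matrix (Fin m) (Fin m) ℝ :=
  let P' := s.2 - (a * b ^ 2) • (s.2 * outer x * s.2)
  (proj D P'⁻¹ (s.1 + (a * b * (y - g (inner ℝ x s.1))) • mulE s.2 x), P')

/-- First step: the pair `(θ̄_k, P̄_k)`. -/
def step1 (D : Set (EuclideanSpace ℝ (Fin m))) (φ : ℕ → EuclideanSpace ℝ (Fin m)) (y : ℕ → ℝ)
    (G : ℕ → ℝ → ℝ) (M : ℕ → ℝ)
    (init : EuclideanSpace ℝ (Fin m) × Matrix (Fin m) (Fin m) ℝ) :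
    ℕ → EuclideanSpace ℝ (Fin m) × Matrix (Fin m) (Fin m) ℝ
  | 0 => init
  | k + 1 =>
    let s := step1 D φ y G M init k
    let b := betaBar (G k) (M k) (φ k) s.2
    qnUpdate D (1 / (1 + b ^ 2 * quad s.2 (φ k))) b (G k) (φ k) (y (k + 1)) s

open Classical in
/-- The scalar gain `β_k` of the second step: the slope of the secant of `g` between `xᵀ θ̂` and
`xᵀ θ̄`, or the derivative of `g` if these points coincide. -/
def beta (g : ℝ → ℝ) (x θbar θhat : EuclideanSpace ℝ (Fin m)) : ℝ :=
  if inner ℝ x θhat - inner ℝ x θbar = 0 then deriv g (inner ℝ x θhat)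
  else (g (inner ℝ x θbar) - g (inner ℝ x θhat)) / (inner ℝ x θbar - inner ℝ x θhat)

/-- Second step: the pair `(θ̂_k, P_k)`, where `θbar k` is the estimate of the first step. -/
def step2 (D : Set (EuclideanSpace ℝ (Fin m))) (φ : ℕ → EuclideanSpace ℝ (Fin m)) (y : ℕ → ℝ)
    (G : ℕ → ℝ → ℝ) (μ : ℕ → ℝ) (θbar : ℕ → EuclideanSpace ℝ (Fin m))
    (init : EuclideanSpace ℝ (Fin m) × Matrix (Fin m) (Fin m) ℝ) :
    ℕ → EuclideanSpace ℝ (Fin m) × Matrix (Fin m) (Fin m) ℝ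
  | 0 => init
  | k + 1 =>
    let s := step2 D φ y G μ θbar init k
    let b := beta (G k) (φ k) (θbar k) s.1
    qnUpdate D (1 / (μ k + b ^ 2 * quad s.2 (φ k))) b (G k) (φ k) (y (k + 1)) s

/-- The accelerated estimate `θ̂_k` of the two-step quasi-Newton algorithm, started from
`(θ̄_0, P̄_0) = initBar` and `(θ̂_0, P_0) = init`. -/
def estimate (D : Set (EuclideanSpace ℝ (Fin m))) (φ : ℕ → EuclideanSpace ℝ (Fin m)) (y : ℕ → ℝ)
    (G : ℕ → ℝ → ℝ) (M μ : ℕ → ℝ)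
    (initBar init : EuclideanSpace ℝ (Fin m) × Matrix (Fin m) (Fin m) ℝ) (k : ℕ) :
    EuclideanSpace ℝ (Fin m) :=
  (step2 D φ y G μ (fun j => (step1 D φ y G M initBar j).1) init k).1

/-! ### The stochastic assumptions -/

variable {Ω : Type*} {mΩ : MeasurableSpace Ω}

/-- Assumption on the regressors and the parameter set: the regressors are adapted and almost
surely bounded, and `θ` is an interior point of the convex compact set `D`. -/
structure RegressorAssumption (Pr : Measure Ω) (ℱ : Filtration ℕ mΩ)
    (φ : ℕ → Ω → EuclideanSpace ℝ (Fin m)) (D : Set (EuclideanSpace ℝ (Fin m)))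
    (θ : EuclideanSpace ℝ (Fin m)) : Prop where
  adapted : ∀ k, StronglyMeasurable[ℱ k] (φ k)
  bounded : ∀ᵐ ω ∂Pr, ∃ C : ℝ, ∀ k, ‖φ k ω‖ ≤ C
  convex : Convex ℝ D
  compact : IsCompact D
  interior : θ ∈ interior D

/-- `M` is an adapted, almost surely bounded sequence with `sup_{x ∈ D} |φ_kᵀ x| ≤ M_k`. -/
structure IsRegressorBound (Pr : Measure Ω) (ℱ : Filtration ℕ mΩ)
    (φ : ℕ → Ω → EuclideanSpace ℝ (Fin m)) (D : Set (EuclideanSpace ℝ (Fin m)))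
    (M : ℕ → Ω → ℝ) : Prop where
  adapted : ∀ k, StronglyMeasurable[ℱ k] (M k)
  bounded : ∀ᵐ ω ∂Pr, ∃ C : ℝ, ∀ k, |M k ω| ≤ C
  le : ∀ᵐ ω ∂Pr, ∀ k, ∀ x ∈ D, |inner ℝ (φ k ω) x| ≤ M k ω

/-- Assumption on the thresholds. -/
structure ThresholdAssumption (Pr : Measure Ω) (ℱ : Filtration ℕ mΩ)
    (l u L U : ℕ → Ω → EReal) : Prop where
  adapted_l : ∀ k, Measurable[ℱ k] (l k)
  adapted_u : ∀ k, Measurable[ℱ k] (u k)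
  adapted_L : ∀ k, Measurable[ℱ k] (L k)
  adapted_U : ∀ k, Measurable[ℱ k] (U k)
  bounds : ∃ c lbar ubar : Ω → ℝ,
    (MemLp c 2 Pr ∧ MemLp lbar 2 Pr ∧ MemLp ubar 2 Pr) ∧
    (∀ ω, 0 ≤ c ω ∧ 0 ≤ lbar ω ∧ 0 ≤ ubar ω) ∧
    ∀ᵐ ω ∂Pr, ∀ k,
      (l k ω - (c ω : EReal) ≤ L k ω ∧ L k ω ≤ l k ω ∧ l k ω ≤ u k ω ∧ u k ω ≤ U k ω ∧
        U k ω ≤ u k ω + (c ω : EReal)) ∧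
      max (l k ω) 0 ≤ (lbar ω : EReal) ∧ max (-(u k ω)) 0 ≤ (ubar ω : EReal)

/-- Assumption on the noise `e` and on the conditional expectation functions
`G_k(x) = 𝔼[S_k(x + e_{k+1}) | ℱ_k]`, where `M` is the regressor bound. -/
structure NoiseAssumption (Pr : Measure Ω) (ℱ : Filtration ℕ mΩ)
    (l u L U : ℕ → Ω → EReal) (M : ℕ → Ω → ℝ) (e : ℕ → Ω → ℝ) (G : ℕ → Ω → ℝ → ℝ) : Prop where
  adapted : ∀ k, StronglyMeasurable[ℱ (k + 1)] (e (k + 1))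
  memLp : ∀ k, MemLp (e (k + 1)) 2 Pr
  martingale_diff : ∀ k, Pr[e (k + 1) | ℱ k] =ᵐ[Pr] 0
  variance_lower : ∀ᵐ ω ∂Pr, ∃ r > 0, ∀ k, r ≤ (Pr[fun ω' => |e (k + 1) ω'| ^ 2 | ℱ k]) ω
  moment_upper : ∃ η : ℝ, 0 < η ∧ ∀ᵐ ω ∂Pr,
    (⨆ k, (Pr⁻[fun ω' => ENNReal.ofReal (|e (k + 1) ω'| ^ (2 + η)) | ℱ k]) ω) < ⊤
  condExp_eq : ∀ k x, (fun ω => G k ω x) =ᵐ[Pr]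
    Pr[fun ω => saturation (l k ω) (u k ω) (L k ω) (U k ω) (x + e (k + 1) ω) | ℱ k]
  differentiable : ∀ᵐ ω ∂Pr, ∀ k, Differentiable ℝ (G k ω)
  deriv_bounds : ∃ Mtop : Ω → ℝ, Measurable Mtop ∧ ∀ᵐ ω ∂Pr,
    (⨆ k, M k ω) < Mtop ω ∧
    (∃ g₁ g₂ : ℝ, 0 < g₁ ∧ ∀ k x, |x| ≤ Mtop ω →
      g₁ ≤ deriv (G k ω) x ∧ deriv (G k ω) x ≤ g₂) ∧
    (∃ ρ : ℝ, 0 ≤ ρ ∧ ∀ k x x', |x| ≤ Mtop ω → |x'| ≤ Mtop ω →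
      |deriv (G k ω) x - deriv (G k ω) x'| ≤ ρ * |x - x'|)

/-- `μ` is an adapted positive process, almost surely bounded and bounded away from zero. -/
structure IsRegularization (Pr : Measure Ω) (ℱ : Filtration ℕ mΩ) (μ : ℕ → Ω → ℝ) : Prop where
  adapted : ∀ k, StronglyMeasurable[ℱ k] (μ k)
  bounds : ∀ᵐ ω ∂Pr, ∃ c₁ c₂ : ℝ, 0 < c₁ ∧ ∀ k, c₁ ≤ μ k ω ∧ μ k ω ≤ c₂

end

end TSQN

/-! Measure the error by the energy `V k`, the quadratic form of the inverse covariance `P k⁻¹` at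
`θ - θ̂ k`. Write `r` for the inner product of `φ k` with the error, `w` for the noise `y (k+1) - G
k (φ kᵀ θ)`, `d` for the secant slope of `G k` between the estimated and the true argument, `ℓ` for
the leverage. Since the projection does not increase the `P (k+1)⁻¹`-distance to `θ`, one step adds
at most `((b - d)² r² - (1 - ℓ) d² r²) / μ`, plus a linear noise term whose coefficient is `O(|r|)`,
plus `ℓ w² / μ` (`energy_step`).

In the first step the gain is so small that the drift is at most `-const * r²`; summation bounds the
accumulated squared prediction errors of `θ̄` logarithmically (`first_step_bound`). In the second
step `b` is the secant slope towards `θ̄` and `d` the one towards `θ`. The Lipschitz derivative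
gives `|b - d| ≤ ρ |φᵀ (θ - θ̄)|`, so the positive part of the drift is summable at the rate already
obtained, while the negative part is uniformly strict (`second_step_bound`). In both steps the sum
of the leverages is at most the growth of `log det P⁻¹`, hence `O(1 + log (1 + ∑ ‖φ‖²))`. Finally
`P⁻¹` dominates a multiple of the information matrix, and when `λ_max` does not tend to `1` its
logarithm stays away from `0` and absorbs the additive constant (`exists_one_add_log_le`).

Two almost sure facts about the noise are needed: `∑ f w` is negligible against `∑ f²`
(`ae_noiseNegligible`), so that it is absorbed by the drift, and `∑ α w²` is of the order of `1 + ∑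
α` (`ae_squareDominated`). Both come from `L²`-bounded martingales and Abel summation. As the bounds
in the assumptions are random, the noise is first localized on events measurable at time `k` where
all bounds are at most an integer `N`; almost every path follows one of these localized noises for
all time (`locallyBoundedNoise_observation`). That the noise is centered at the random point `φᵀ θ`,
although `G k` is specified only at deterministic points, follows from monotonicity of the
saturation and continuity of `G k` (`condExp_eq_of_monotone`).

The coefficients `f` and `α` must also be measurable at time `k`, up to null sets. This rests on a
jointly measurable version of `G k`, on extreme slopes computed over a countable set, and on the
continuity of the projection. -/

namespace TSQN

/-! ### Quadratic forms and rank-one updates -/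

section QuadraticForms

variable {m : ℕ}

/-- The bilinear form `xᵀ A y`. -/
noncomputable def bil (A : Matrix (Fin m) (Fin m) ℝ) (x y : EuclideanSpace ℝ (Fin m)) : ℝ :=
  x.ofLp ⬝ᵥ (A *ᵥ y.ofLp)

theorem inner_eq_dotProduct (x y : EuclideanSpace ℝ (Fin m)) :
    inner ℝ x y = x.ofLp ⬝ᵥ y.ofLp := by
  rw [EuclideanSpace.inner_eq_star_dotProduct, star_trivial, dotProduct_comm]

theorem bil_comm {A : Matrix (Fin m) (Fin m) ℝ} (hA : A.IsHermitian)
    (x y : EuclideanSpace ℝ (Fin m)) : bil A x y = bil A y x := by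
  have h : Aᵀ = A := by simpa [Matrix.IsHermitian, conjTranspose_eq_transpose_of_trivial] using hA
  unfold bil
  rw [dotProduct_mulVec, dotProduct_comm, ← mulVec_transpose, h]

theorem quad_add_smul {A : Matrix (Fin m) (Fin m) ℝ} (hA : A.IsHermitian)
    (x y : EuclideanSpace ℝ (Fin m)) (t : ℝ) :
    quad A (x + t • y) = quad A x + 2 * t * bil A x y + t ^ 2 * quad A y := by
  have h := bil_comm hA x y
  unfold bil at h
  simp only [quad, bil, WithLp.ofLp_add, WithLp.ofLp_smul, mulVec_add, mulVec_smul, dotProduct_add,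
    add_dotProduct, smul_dotProduct, dotProduct_smul, smul_eq_mul, h]
  ring

theorem quad_sub_comm (A : Matrix (Fin m) (Fin m) ℝ) (x y : EuclideanSpace ℝ (Fin m)) :
    quad A (x - y) = quad A (y - x) := by
  have h : x - y = -(y - x) := (neg_sub y x).symm
  rw [quad, quad, h, WithLp.ofLp_neg, mulVec_neg, dotProduct_neg, neg_dotProduct, neg_neg]

theorem quad_nonneg {A : Matrix (Fin m) (Fin m) ℝ} (hA : A.PosSemidef)
    (x : EuclideanSpace ℝ (Fin m)) : 0 ≤ quad A x := by
  simpa [quad] using hA.dotProduct_mulVec_nonneg x.ofLp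

theorem quad_pos {A : Matrix (Fin m) (Fin m) ℝ} (hA : A.PosDef)
    {x : EuclideanSpace ℝ (Fin m)} (hx : x ≠ 0) : 0 < quad A x := by
  have : x.ofLp ≠ 0 := by simpa using hx
  simpa [quad] using hA.dotProduct_mulVec_pos this

theorem outer_mulVec (x : EuclideanSpace ℝ (Fin m)) (v : Fin m → ℝ) :
    outer x *ᵥ v = (x.ofLp ⬝ᵥ v) • x.ofLp := by
  ext i
  simp only [outer, vecMulVec_apply, mulVec, dotProduct, Pi.smul_apply, smul_eq_mul,
    Finset.sum_mul]
  exact Finset.sum_congr rfl fun j _ => by ring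

theorem quad_outer (x z : EuclideanSpace ℝ (Fin m)) : quad (outer x) z = (inner ℝ x z) ^ 2 := by
  rw [quad, outer_mulVec, dotProduct_smul, inner_eq_dotProduct, dotProduct_comm z.ofLp, smul_eq_mul,
    sq]

theorem quad_add_left (A B : Matrix (Fin m) (Fin m) ℝ) (x : EuclideanSpace ℝ (Fin m)) :
    quad (A + B) x = quad A x + quad B x := by
  simp [quad, add_mulVec]

theorem quad_smul_left (c : ℝ) (A : Matrix (Fin m) (Fin m) ℝ) (x : EuclideanSpace ℝ (Fin m)) :
    quad (c • A) x = c * quad A x := by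
  simp [quad, smul_mulVec]

theorem quad_one (x : EuclideanSpace ℝ (Fin m)) :
    quad (1 : Matrix (Fin m) (Fin m) ℝ) x = ‖x‖ ^ 2 := by
  rw [quad, one_mulVec, ← inner_eq_dotProduct, real_inner_self_eq_norm_sq]

theorem outer_posSemidef (x : EuclideanSpace ℝ (Fin m)) : (outer x).PosSemidef := by
  simpa [outer] using posSemidef_vecMulVec_self_star x.ofLp

theorem trace_outer (x : EuclideanSpace ℝ (Fin m)) : (outer x).trace = ‖x‖ ^ 2 := by
  rw [outer, trace_vecMulVec, ← inner_eq_dotProduct, real_inner_self_eq_norm_sq]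

/-- Sherman–Morrison for the covariance update of the quasi-Newton recursion. -/
theorem add_smul_outer_mul {P : Matrix (Fin m) (Fin m) ℝ} (hP : P.PosDef)
    (x : EuclideanSpace ℝ (Fin m)) {μ : ℝ} (hμ : 0 < μ) (b : ℝ) :
    (P⁻¹ + (b ^ 2 / μ) • outer x) *
      (P - (1 / (μ + b ^ 2 * quad P x) * b ^ 2) • (P * outer x * P)) = 1 := by
  have hs : 0 ≤ quad P x := quad_nonneg hP.posSemidef x
  have hd : 0 < μ + b ^ 2 * quad P x := by positivity
  have h1 : P⁻¹ * P = 1 := Matrix.nonsing_inv_mul _ ((Matrix.isUnit_iff_isUnit_det _).1 hP.isUnit)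
  have h2 : outer x * (P * outer x * P) = quad P x • (outer x * P) := by
    have : outer x * P * outer x = quad P x • outer x := by
      rw [outer, vecMulVec_mul, vecMulVec_mul_vecMulVec, quad, dotProduct_mulVec, vecMulVec_smul]
    rw [← Matrix.mul_assoc, ← Matrix.mul_assoc, this, Matrix.smul_mul]
  have h3 : P⁻¹ * (P * outer x * P) = outer x * P := by
    rw [Matrix.mul_assoc P, ← Matrix.mul_assoc, h1, Matrix.one_mul]
  rw [Matrix.add_mul, Matrix.mul_sub, Matrix.mul_smul, h1, h3, Matrix.mul_sub, Matrix.smul_mul,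
    Matrix.smul_mul, Matrix.mul_smul, h2]
  -- After expansion the defect from the identity is a multiple of `outer x * P`; this is its
  -- coefficient.
  have : b ^ 2 / μ - 1 / (μ + b ^ 2 * quad P x) * b ^ 2
      - b ^ 2 / μ * (1 / (μ + b ^ 2 * quad P x) * b ^ 2) * quad P x = 0 := by
    field_simp
    ring
  rw [smul_smul, smul_smul]
  calc _ = 1 + (b ^ 2 / μ - 1 / (μ + b ^ 2 * quad P x) * b ^ 2
      - b ^ 2 / μ * (1 / (μ + b ^ 2 * quad P x) * b ^ 2) * quad P x) • (outer x * P) := by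
        rw [sub_smul, sub_smul]; simp only [mul_assoc]; abel
    _ = 1 := by rw [this, zero_smul, add_zero]

theorem posDef_add_smul_outer {R : Matrix (Fin m) (Fin m) ℝ} (hR : R.PosDef)
    (x : EuclideanSpace ℝ (Fin m)) {c : ℝ} (hc : 0 ≤ c) : (R + c • outer x).PosDef :=
  hR.add_posSemidef ((outer_posSemidef x).smul hc)

theorem update_inv {P : Matrix (Fin m) (Fin m) ℝ} (hP : P.PosDef)
    (x : EuclideanSpace ℝ (Fin m)) {μ : ℝ} (hμ : 0 < μ) (b : ℝ) :
    (P - (1 / (μ + b ^ 2 * quad P x) * b ^ 2) • (P * outer x * P))⁻¹ =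
      P⁻¹ + (b ^ 2 / μ) • outer x :=
  Matrix.inv_eq_left_inv (add_smul_outer_mul hP x hμ b)

theorem update_posDef {P : Matrix (Fin m) (Fin m) ℝ} (hP : P.PosDef)
    (x : EuclideanSpace ℝ (Fin m)) {μ : ℝ} (hμ : 0 < μ) (b : ℝ) :
    (P - (1 / (μ + b ^ 2 * quad P x) * b ^ 2) • (P * outer x * P)).PosDef := by
  rw [← Matrix.inv_eq_right_inv (add_smul_outer_mul hP x hμ b)]
  exact (posDef_add_smul_outer hP.inv x (by positivity)).inv

theorem quad_update_le {P : Matrix (Fin m) (Fin m) ℝ} (hP : P.PosDef)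
    (x z : EuclideanSpace ℝ (Fin m)) {μ : ℝ} (hμ : 0 < μ) (b : ℝ) :
    quad (P - (1 / (μ + b ^ 2 * quad P x) * b ^ 2) • (P * outer x * P)) z ≤ quad P z := by
  have hs : 0 ≤ quad P x := quad_nonneg hP.posSemidef x
  have h : (P * outer x * P).PosSemidef := by
    have := (outer_posSemidef x).mul_mul_conjTranspose_same P
    rwa [hP.isHermitian.eq] at this
  rw [sub_eq_add_neg, ← neg_smul, quad_add_left, quad_smul_left]
  have := quad_nonneg h z
  have : 0 ≤ (1 / (μ + b ^ 2 * quad P x) * b ^ 2) * quad (P * outer x * P) z := by positivity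
  linarith

theorem det_add_smul_outer {P : Matrix (Fin m) (Fin m) ℝ} (hP : P.PosDef)
    (x : EuclideanSpace ℝ (Fin m)) (c : ℝ) :
    (P⁻¹ + c • outer x).det = P⁻¹.det * (1 + c * quad P x) := by
  have hu : IsUnit P.det := (Matrix.isUnit_iff_isUnit_det _).1 hP.isUnit
  have hu' : IsUnit P⁻¹.det := (Matrix.isUnit_nonsing_inv_det_iff).2 hu
  have h := det_add_replicateCol_mul_replicateRow (ι := Unit) hu' (c • x.ofLp) x.ofLp
  rw [Matrix.nonsing_inv_nonsing_inv _ hu] at h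
  have e1 : replicateCol Unit (c • x.ofLp) * replicateRow Unit x.ofLp = c • outer x := by
    ext i j
    simp [outer, vecMulVec_apply, Matrix.mul_apply, mul_assoc]
  have e2 : (1 + replicateRow Unit x.ofLp * P * replicateCol Unit (c • x.ofLp)).det
      = 1 + c * quad P x := by
    rw [Matrix.det_unique, Matrix.mul_assoc]
    simp [Matrix.mul_apply, quad, dotProduct, mulVec, Finset.mul_sum, mul_left_comm]
  rw [← e1, h, e2]

/-- The scalar leverage `c s / (1 + c s)` is dominated by the increment of the log-determinant. -/
theorem leverage_le_log_det {P : Matrix (Fin m) (Fin m) ℝ} (hP : P.PosDef)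
    (x : EuclideanSpace ℝ (Fin m)) {μ : ℝ} (hμ : 0 < μ) (b : ℝ) :
    1 / (μ + b ^ 2 * quad P x) * b ^ 2 * quad P x ≤
      Real.log (P⁻¹ + (b ^ 2 / μ) • outer x).det - Real.log P⁻¹.det := by
  have hs : 0 ≤ quad P x := quad_nonneg hP.posSemidef x
  have hpos : 0 < 1 + b ^ 2 / μ * quad P x := by positivity
  rw [det_add_smul_outer hP, Real.log_mul hP.inv.det_pos.ne' hpos.ne', add_sub_cancel_left]
  refine le_trans (le_of_eq ?_) (Real.one_sub_inv_le_log_of_pos hpos)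
  have : 0 < μ + b ^ 2 * quad P x := by positivity
  field_simp
  ring

/-- The updated inverse `R` maps `P x` to `(1 + b² s / μ) x` with `s = xᵀ P x`. This factor is `1 /
(a μ)` for the gain `a = 1 / (μ + b² s)`, so `a` cancels in the cross term and survives only in the
term quadratic in `v`. -/
theorem quad_gain_step {P : Matrix (Fin m) (Fin m) ℝ} (hP : P.PosDef)
    (x z : EuclideanSpace ℝ (Fin m)) {μ : ℝ} (hμ : 0 < μ) (b v : ℝ) :
    quad (P⁻¹ + (b ^ 2 / μ) • outer x)
        (z - (1 / (μ + b ^ 2 * quad P x) * b * v) • mulE P x) =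
      quad P⁻¹ z + (b ^ 2 * (inner ℝ x z) ^ 2 - 2 * b * inner ℝ x z * v +
        1 / (μ + b ^ 2 * quad P x) * b ^ 2 * quad P x * v ^ 2) / μ := by
  set R := P⁻¹ + (b ^ 2 / μ) • outer x with hR
  have hs : 0 ≤ quad P x := quad_nonneg hP.posSemidef x
  have hd : 0 < μ + b ^ 2 * quad P x := by positivity
  have hRH : R.IsHermitian := (posDef_add_smul_outer hP.inv x (by positivity)).isHermitian
  have h1 : P⁻¹ * P = 1 := Matrix.nonsing_inv_mul _ ((Matrix.isUnit_iff_isUnit_det _).1 hP.isUnit)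
  have hRP : R *ᵥ (mulE P x).ofLp = (1 + b ^ 2 / μ * quad P x) • x.ofLp := by
    rw [hR, mulE, add_mulVec, smul_mulVec, outer_mulVec, mulVec_mulVec, h1, one_mulVec,
      add_smul, one_smul, smul_smul, quad]
  have hb1 : bil R z (mulE P x) = (1 + b ^ 2 / μ * quad P x) * inner ℝ x z := by
    rw [bil, hRP, dotProduct_smul, inner_eq_dotProduct, dotProduct_comm, smul_eq_mul]
  have hb2 : quad R (mulE P x) = (1 + b ^ 2 / μ * quad P x) * quad P x := by
    rw [quad, hRP, dotProduct_smul, smul_eq_mul, mulE, dotProduct_comm]; rfl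
  have hb3 : quad R z = quad P⁻¹ z + b ^ 2 / μ * (inner ℝ x z) ^ 2 := by
    rw [hR, quad_add_left, quad_smul_left, quad_outer]
  rw [sub_eq_add_neg, ← neg_smul, quad_add_smul hRH, hb1, hb2, hb3]
  field_simp
  ring

end QuadraticForms

/-! ### The projection onto a compact convex set -/

section Projection

variable {m : ℕ} {D : Set (EuclideanSpace ℝ (Fin m))}

theorem continuous_quad :
    Continuous fun p : Matrix (Fin m) (Fin m) ℝ × EuclideanSpace ℝ (Fin m) => quad p.1 p.2 := by
  unfold quad
  have h2 : Continuous fun p : Matrix (Fin m) (Fin m) ℝ × EuclideanSpace ℝ (Fin m) => p.2.ofLp :=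
    (PiLp.continuous_ofLp 2 _).comp continuous_snd
  exact h2.dotProduct (continuous_fst.matrix_mulVec h2)

theorem proj_spec (hD : IsCompact D) (hne : D.Nonempty) (Q : Matrix (Fin m) (Fin m) ℝ)
    (x : EuclideanSpace ℝ (Fin m)) :
    proj D Q x ∈ D ∧ ∀ z ∈ D, normQ Q (x - proj D Q x) ≤ normQ Q (x - z) := by
  have hc : Continuous fun z => normQ Q (x - z) :=
    Real.continuous_sqrt.comp (continuous_quad.comp (by fun_prop : Continuous fun z => (Q, x - z)))
  obtain ⟨z, hz, hmin⟩ := hD.exists_isMinOn hne hc.continuousOn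
  exact Classical.epsilon_spec (p := fun y => y ∈ D ∧ ∀ z ∈ D, normQ Q (x - y) ≤ normQ Q (x - z))
    ⟨z, hz, fun w hw => hmin hw⟩

/-- Moving from the minimizer towards any point of `D` cannot decrease the distance, so the angle at
`p` is not acute; expanding the square then gives this Pythagorean inequality. -/
theorem quad_sub_le_of_isMin {Q : Matrix (Fin m) (Fin m) ℝ} (hQ : Q.PosDef) (hc : Convex ℝ D)
    {x p z : EuclideanSpace ℝ (Fin m)} (hp : p ∈ D)
    (hmin : ∀ z ∈ D, normQ Q (x - p) ≤ normQ Q (x - z)) (hz : z ∈ D) :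
    quad Q (z - p) + quad Q (x - p) ≤ quad Q (z - x) := by
  have hq : ∀ w, 0 ≤ quad Q w := quad_nonneg hQ.posSemidef
  have key : ∀ t : ℝ, 0 ≤ t → t ≤ 1 →
      0 ≤ -2 * t * bil Q (x - p) (z - p) + t ^ 2 * quad Q (z - p) := by
    intro t h0 h1
    have hm : p + t • (z - p) ∈ D := hc.add_smul_sub_mem hp hz ⟨h0, h1⟩
    have h := (Real.sqrt_le_sqrt_iff (hq _)).1 (hmin _ hm)
    have e : x - (p + t • (z - p)) = (x - p) + (-t) • (z - p) := by rw [neg_smul]; abel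
    rw [e, quad_add_smul hQ.isHermitian] at h
    linarith [neg_sq t]
  have hb : bil Q (x - p) (z - p) ≤ 0 := by
    by_contra! hb
    set B := bil Q (x - p) (z - p)
    set q := quad Q (z - p)
    have hq0 : 0 ≤ q := hq _
    -- If the angle were acute, the step `B / (B + q)` would give a strictly negative value; it lies
    -- in `[0, 1]` and is defined even when `q = 0`.
    have := key (B / (B + q)) (by positivity) ((div_le_one (by positivity)).2 (by linarith))
    have h2 : -2 * (B / (B + q)) * B + (B / (B + q)) ^ 2 * q
      = B ^ 2 / (B + q) ^ 2 * (-2 * B - q) := by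
      field_simp
      ring
    rw [h2] at this
    have h3 : 0 < B ^ 2 / (B + q) ^ 2 := by positivity
    nlinarith
  have e : z - x = (z - p) + (-1 : ℝ) • (x - p) := by rw [neg_smul, one_smul]; abel
  rw [e, quad_add_smul hQ.isHermitian, bil_comm hQ.isHermitian]
  linarith

theorem quad_sub_proj_le {Q : Matrix (Fin m) (Fin m) ℝ} (hQ : Q.PosDef) (hc : Convex ℝ D)
    (hD : IsCompact D) (x : EuclideanSpace ℝ (Fin m)) {z : EuclideanSpace ℝ (Fin m)}
    (hz : z ∈ D) : quad Q (z - proj D Q x) ≤ quad Q (z - x) := by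
  obtain ⟨h1, h2⟩ := proj_spec hD ⟨z, hz⟩ Q x
  have := quad_sub_le_of_isMin hQ hc h1 h2 hz
  linarith [quad_nonneg hQ.posSemidef (x - proj D Q x)]

/-- Uniqueness of the minimizer, from the Pythagorean inequality at one minimizer tested on the
other. It makes the choice inside `proj` canonical, which continuity requires. -/
theorem eq_proj_of_isMin {Q : Matrix (Fin m) (Fin m) ℝ} (hQ : Q.PosDef) (hc : Convex ℝ D)
    (hD : IsCompact D) {x p : EuclideanSpace ℝ (Fin m)} (hp : p ∈ D)
    (hmin : ∀ z ∈ D, normQ Q (x - p) ≤ normQ Q (x - z)) : p = proj D Q x := by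
  obtain ⟨h1, h2⟩ := proj_spec hD ⟨p, hp⟩ Q x
  have ha := quad_sub_le_of_isMin hQ hc hp hmin h1
  have hb := (Real.sqrt_le_sqrt_iff (quad_nonneg hQ.posSemidef _)).1 (h2 p hp)
  by_contra hne
  have := quad_pos hQ (sub_ne_zero.2 (Ne.symm hne))
  rw [quad_sub_comm Q _ x] at ha
  linarith

/-- The projection depends continuously on the point and on the positive definite matrix. -/
theorem continuousOn_proj (hc : Convex ℝ D) (hD : IsCompact D) (hne : D.Nonempty) :
    ContinuousOn (fun p : Matrix (Fin m) (Fin m) ℝ × EuclideanSpace ℝ (Fin m) => proj D p.1 p.2)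
      {p | p.1.PosDef} := by
  rintro ⟨Q, x⟩ hQ
  -- In a compact set it suffices to identify cluster points: minimality passes to the limit along
  -- an ultrafilter, and the minimizer is unique.
  refine hD.tendsto_nhds_of_unique_mapClusterPt
    (Eventually.of_forall fun p => (proj_spec hD hne p.1 p.2).1) ?_
  intro y hy hcl
  refine eq_proj_of_isMin hQ hc hD hy fun z hz => ?_
  set l := 𝓝[{p : Matrix (Fin m) (Fin m) ℝ × EuclideanSpace ℝ (Fin m) | p.1.PosDef}] (Q, x)
  have hcont : Continuous fun p : (Matrix (Fin m) (Fin m) ℝ × EuclideanSpace ℝ (Fin m)) ×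
      EuclideanSpace ℝ (Fin m) => normQ p.1.1 (p.1.2 - p.2) - normQ p.1.1 (p.1.2 - z) := by
    unfold normQ
    exact (Real.continuous_sqrt.comp (continuous_quad.comp
      (by fun_prop : Continuous fun p : (Matrix (Fin m) (Fin m) ℝ × EuclideanSpace ℝ (Fin m)) ×
      EuclideanSpace ℝ (Fin m) => (p.1.1, p.1.2 - p.2)))).sub
      (Real.continuous_sqrt.comp (continuous_quad.comp
      (by fun_prop : Continuous fun p : (Matrix (Fin m) (Fin m) ℝ × EuclideanSpace ℝ (Fin m)) ×
      EuclideanSpace ℝ (Fin m) => (p.1.1, p.1.2 - z))))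
  obtain ⟨U, hUl, hU⟩ := mapClusterPt_iff_ultrafilter.1 hcl
  have h1 : Tendsto (fun p : Matrix (Fin m) (Fin m) ℝ × EuclideanSpace ℝ (Fin m) =>
      (p, proj D p.1 p.2)) U (𝓝 ((Q, x), y)) := by
    refine Tendsto.prodMk_nhds ?_ hU
    exact tendsto_id.mono_left (hUl.trans nhdsWithin_le_nhds)
  have h2 := (hcont.tendsto ((Q, x), y)).comp h1
  have h3 := le_of_tendsto h2 (b := 0) (Eventually.of_forall fun p => by
    simpa using (proj_spec hD hne p.1 p.2).2 z hz)
  simpa using h3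

end Projection

/-! ### Extreme eigenvalues -/

section Eigenvalues

variable {m : ℕ} {A : Matrix (Fin m) (Fin m) ℝ}

theorem bddAbove_spectrum (hA : A.IsHermitian) : BddAbove (spectrum ℝ A) := by
  rw [hA.spectrum_real_eq_range_eigenvalues]
  exact (Set.finite_range _).bddAbove

theorem bddBelow_spectrum (hA : A.IsHermitian) : BddBelow (spectrum ℝ A) := by
  rw [hA.spectrum_real_eq_range_eigenvalues]
  exact (Set.finite_range _).bddBelow

/-- Subtracting `lamMin A` times the identity translates the spectrum into the nonnegative
half-line, so the difference is positive semidefinite. -/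
theorem lamMin_mul_le_quad (hA : A.IsHermitian) (x : EuclideanSpace ℝ (Fin m)) :
    lamMin A * ‖x‖ ^ 2 ≤ quad A x := by
  have hB : (A - algebraMap ℝ (Matrix (Fin m) (Fin m) ℝ) (lamMin A)).IsHermitian := by
    refine hA.sub ?_
    rw [Algebra.algebraMap_eq_smul_one]
    exact (Matrix.isHermitian_one).smul (star_trivial _)
  have hpsd := hB.posSemidef_iff_eigenvalues_nonneg.2 fun i => by
    have h : hB.eigenvalues i ∈ spectrum ℝ (A - algebraMap ℝ _ (lamMin A)) := by
      rw [hB.spectrum_real_eq_range_eigenvalues]; exact ⟨i, rfl⟩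
    rw [← spectrum.sub_singleton_eq] at h
    obtain ⟨y, hy, z, hz, hyz⟩ := Set.mem_sub.1 h
    rw [Set.mem_singleton_iff.1 hz] at hyz
    have : lamMin A ≤ y := csInf_le (bddBelow_spectrum hA) hy
    simp only [Pi.zero_apply]
    linarith
  have := quad_nonneg hpsd x
  rw [Algebra.algebraMap_eq_smul_one, sub_eq_add_neg, ← neg_smul, quad_add_left, quad_smul_left,
    quad_one] at this
  linarith

theorem quad_le_lamMax_mul (hA : A.IsHermitian) (x : EuclideanSpace ℝ (Fin m)) :
    quad A x ≤ lamMax A * ‖x‖ ^ 2 := by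
  have hB : (algebraMap ℝ (Matrix (Fin m) (Fin m) ℝ) (lamMax A) - A).IsHermitian := by
    refine IsHermitian.sub ?_ hA
    rw [Algebra.algebraMap_eq_smul_one]
    exact (Matrix.isHermitian_one).smul (star_trivial _)
  have hpsd := hB.posSemidef_iff_eigenvalues_nonneg.2 fun i => by
    have h : hB.eigenvalues i ∈ spectrum ℝ (algebraMap ℝ _ (lamMax A) - A) := by
      rw [hB.spectrum_real_eq_range_eigenvalues]; exact ⟨i, rfl⟩
    rw [← spectrum.singleton_sub_eq] at h
    obtain ⟨z, hz, y, hy, hyz⟩ := Set.mem_sub.1 h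
    rw [Set.mem_singleton_iff.1 hz] at hyz
    have : y ≤ lamMax A := le_csSup (bddAbove_spectrum hA) hy
    simp only [Pi.zero_apply]
    linarith
  have := quad_nonneg hpsd x
  rw [Algebra.algebraMap_eq_smul_one, sub_eq_add_neg, ← neg_one_smul ℝ A, quad_add_left,
    quad_smul_left, quad_smul_left, quad_one] at this
  linarith

theorem exists_unit_quad_eq (hA : A.IsHermitian) {t : ℝ} (ht : t ∈ spectrum ℝ A) :
    ∃ v : EuclideanSpace ℝ (Fin m), ‖v‖ = 1 ∧ quad A v = t := by
  rw [hA.spectrum_real_eq_range_eigenvalues] at ht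
  obtain ⟨i, rfl⟩ := ht
  have hn : ‖hA.eigenvectorBasis i‖ = 1 := hA.eigenvectorBasis.orthonormal.1 i
  refine ⟨hA.eigenvectorBasis i, hn, ?_⟩
  rw [quad, hA.mulVec_eigenvectorBasis, dotProduct_smul, ← inner_eq_dotProduct,
    real_inner_self_eq_norm_sq, hn]
  simp

variable [NeZero m]

theorem lamMax_mem_spectrum (hA : A.IsHermitian) : lamMax A ∈ spectrum ℝ A := by
  have : (spectrum ℝ A).Finite ∧ (spectrum ℝ A).Nonempty := by
    rw [hA.spectrum_real_eq_range_eigenvalues]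
    exact ⟨Set.finite_range _, Set.range_nonempty _⟩
  exact this.2.csSup_mem this.1

theorem lamMin_mem_spectrum (hA : A.IsHermitian) : lamMin A ∈ spectrum ℝ A := by
  have : (spectrum ℝ A).Finite ∧ (spectrum ℝ A).Nonempty := by
    rw [hA.spectrum_real_eq_range_eigenvalues]
    exact ⟨Set.finite_range _, Set.range_nonempty _⟩
  exact this.2.csInf_mem this.1

theorem lamMin_pos (hA : A.PosDef) : 0 < lamMin A := by
  obtain ⟨v, hv, h⟩ := exists_unit_quad_eq hA.isHermitian (lamMin_mem_spectrum hA.isHermitian)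
  rw [← h]
  exact quad_pos hA (by rintro rfl; simp at hv)

theorem lamMax_mono {B : Matrix (Fin m) (Fin m) ℝ} (hA : A.IsHermitian) (hB : B.IsHermitian)
    (h : ∀ x, quad A x ≤ quad B x) : lamMax A ≤ lamMax B := by
  obtain ⟨v, hv, h'⟩ := exists_unit_quad_eq hA (lamMax_mem_spectrum hA)
  have := quad_le_lamMax_mul hB v
  rw [hv] at this
  linarith [h v]

theorem le_lamMax (hA : A.IsHermitian) {c : ℝ} (h : ∀ x, c * ‖x‖ ^ 2 ≤ quad A x) :
    c ≤ lamMax A := by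
  obtain ⟨v, hv, h'⟩ := exists_unit_quad_eq hA (lamMax_mem_spectrum hA)
  have := h v
  rw [hv, h'] at this
  linarith

omit [NeZero m] in
theorem trace_le_mul_lamMax (hA : A.IsHermitian) : A.trace ≤ m * lamMax A := by
  rw [hA.trace_eq_sum_eigenvalues]
  calc ∑ i, ((hA.eigenvalues i : ℝ)) ≤ ∑ _i : Fin m, lamMax A :=
        Finset.sum_le_sum fun i _ => le_csSup (bddAbove_spectrum hA) (by
          rw [hA.spectrum_real_eq_range_eigenvalues]; exact ⟨i, rfl⟩)
    _ = m * lamMax A := by simp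

-- Each eigenvalue is at most the trace. This crude bound suffices because only the logarithm of the
-- determinant is used.
omit [NeZero m] in
theorem det_le_trace_pow (hA : A.PosDef) : A.det ≤ A.trace ^ m := by
  have h0 : ∀ i, 0 ≤ hA.isHermitian.eigenvalues i := hA.posSemidef.eigenvalues_nonneg
  rw [hA.isHermitian.det_eq_prod_eigenvalues, hA.isHermitian.trace_eq_sum_eigenvalues]
  calc ∏ i, ((hA.isHermitian.eigenvalues i : ℝ))
      ≤ ∏ _i : Fin m, ∑ j, ((hA.isHermitian.eigenvalues j : ℝ)) :=
        Finset.prod_le_prod (fun i _ => h0 i) fun i _ =>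
          Finset.single_le_sum (f := fun j => hA.isHermitian.eigenvalues j)
            (fun j _ => h0 j) (Finset.mem_univ i)
    _ = _ := by simp

end Eigenvalues

/-! ### The information matrix -/

section InfoMatrix

variable {m : ℕ} (φ : ℕ → EuclideanSpace ℝ (Fin m)) {lam0 : ℝ}

theorem quad_sum_left {ι : Type*} (s : Finset ι) (A : ι → Matrix (Fin m) (Fin m) ℝ)
    (x : EuclideanSpace ℝ (Fin m)) : quad (∑ i ∈ s, A i) x = ∑ i ∈ s, quad (A i) x := by
  simp [quad, Matrix.sum_mulVec, dotProduct_sum]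

theorem infoMatrix_posDef (h : 0 < lam0) (k : ℕ) : (infoMatrix φ lam0 k).PosDef := by
  unfold infoMatrix
  refine PosDef.posSemidef_add ?_ (PosDef.one.smul h)
  exact posSemidef_sum _ fun i _ => outer_posSemidef (φ i)

theorem quad_infoMatrix (k : ℕ) (x : EuclideanSpace ℝ (Fin m)) :
    quad (infoMatrix φ lam0 k) x =
      ∑ i ∈ Finset.range (k + 1), (inner ℝ (φ i) x) ^ 2 + lam0 * ‖x‖ ^ 2 := by
  simp only [infoMatrix, quad_add_left, quad_sum_left, quad_smul_left, quad_one, quad_outer]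

theorem trace_infoMatrix (k : ℕ) :
    (infoMatrix φ lam0 k).trace = ∑ i ∈ Finset.range (k + 1), ‖φ i‖ ^ 2 + lam0 * m := by
  simp [infoMatrix, trace_outer, Matrix.trace_sum]

variable [NeZero m]

theorem monotone_lamMax_infoMatrix (h : 0 < lam0) :
    Monotone fun k => lamMax (infoMatrix φ lam0 k) := by
  refine monotone_nat_of_le_succ fun k => ?_
  refine lamMax_mono (infoMatrix_posDef φ h k).isHermitian (infoMatrix_posDef φ h _).isHermitian
    fun x => ?_
  rw [quad_infoMatrix, quad_infoMatrix, Finset.sum_range_succ _ (k + 1)]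
  nlinarith [sq_nonneg (inner ℝ (φ (k + 1)) x : ℝ)]

theorem lam0_le_lamMax_infoMatrix (h : 0 < lam0) (k : ℕ) :
    lam0 ≤ lamMax (infoMatrix φ lam0 k) := by
  refine le_lamMax (infoMatrix_posDef φ h k).isHermitian fun x => ?_
  rw [quad_infoMatrix]
  have : 0 ≤ ∑ i ∈ Finset.range (k + 1), (inner ℝ (φ i) x : ℝ) ^ 2 :=
    Finset.sum_nonneg fun i _ => sq_nonneg _
  linarith

/-- If the largest eigenvalue does not converge to `1`, its logarithm dominates
`1 + log (1 + ∑ ‖φ_i‖²)`. -/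
theorem exists_one_add_log_le (h : 0 < lam0)
    (hlim : ¬ Tendsto (fun k => lamMax (infoMatrix φ lam0 k)) atTop (𝓝 1)) :
    ∃ C : ℝ, 0 ≤ C ∧ ∀ᶠ k in atTop,
      1 + Real.log (1 + ∑ i ∈ Finset.range (k + 1), ‖φ i‖ ^ 2) ≤
        C * |Real.log (lamMax (infoMatrix φ lam0 k))| := by
  set f := fun k => lamMax (infoMatrix φ lam0 k) with hf
  have hmono : Monotone f := monotone_lamMax_infoMatrix φ h
  have hlam : ∀ k, lam0 ≤ f k := lam0_le_lamMax_infoMatrix φ h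
  -- By monotonicity `f` diverges or converges to some `L ≥ lam0 > 0`; as `L ≠ 1`, its logarithm
  -- stays away from `0` in both cases.
  have hδ : ∃ δ > 0, ∀ᶠ k in atTop, δ ≤ |Real.log (f k)| := by
    rcases tendsto_atTop_of_monotone hmono with ht | ⟨L, hL⟩
    · refine ⟨1, one_pos, ?_⟩
      filter_upwards [(Real.tendsto_log_atTop.comp ht).eventually_ge_atTop 1] with k hk
      exact hk.trans (le_abs_self _)
    · have hL0 : 0 < L := h.trans_le (ge_of_tendsto' hL hlam)
      have hL1 : L ≠ 1 := fun h1 => hlim (h1 ▸ hL)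
      have hlog : Real.log L ≠ 0 := by
        simp only [ne_eq, Real.log_eq_zero, not_or]
        exact ⟨hL0.ne', hL1, by linarith⟩
      have hpos : 0 < |Real.log L| := abs_pos.2 hlog
      refine ⟨|Real.log L| / 2, by positivity, ?_⟩
      have := (hL.log hL0.ne').abs
      filter_upwards [this.eventually (lt_mem_nhds (half_lt_self hpos))] with k hk
      exact hk.le
  obtain ⟨δ, hδ0, hδ⟩ := hδ
  -- The constant `1` is paid by `f k / lam0 ≥ 1`, and `∑ ‖φ i‖²` is at most the trace, hence at
  -- most `m * f k`.
  set c := 1 / lam0 + m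
  have hc0 : 0 < c := by positivity
  refine ⟨(1 + |Real.log c|) / δ + 1, by positivity, ?_⟩
  filter_upwards [hδ] with k hk
  have hfk : 0 < f k := h.trans_le (hlam k)
  have hS : 0 ≤ ∑ i ∈ Finset.range (k + 1), ‖φ i‖ ^ 2 := Finset.sum_nonneg fun i _ => sq_nonneg _
  have h1 : 1 + ∑ i ∈ Finset.range (k + 1), ‖φ i‖ ^ 2 ≤ c * f k := by
    have ht := trace_le_mul_lamMax (infoMatrix_posDef φ h k).isHermitian
    rw [trace_infoMatrix] at ht
    have h2 : 1 ≤ 1 / lam0 * f k := by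
      rw [one_div, inv_mul_eq_div, one_le_div h]; exact hlam k
    have h3 : 0 ≤ lam0 * m := by positivity
    have h4 : c * f k = 1 / lam0 * f k + m * f k := by ring
    rw [h4]
    linarith
  have h2 := Real.log_le_log (by positivity) h1
  rw [Real.log_mul hc0.ne' hfk.ne'] at h2
  have h3 : 1 + |Real.log c| ≤ (1 + |Real.log c|) / δ * |Real.log (f k)| := by
    rw [div_mul_eq_mul_div, le_div_iff₀ hδ0]
    exact mul_le_mul_of_nonneg_left hk (by positivity)
  have h5 : ((1 + |Real.log c|) / δ + 1) * |Real.log (f k)|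
    = (1 + |Real.log c|) / δ * |Real.log (f k)| + |Real.log (f k)| := by ring
  rw [h5]
  linarith [le_abs_self (Real.log c), le_abs_self (Real.log (f k))]

end InfoMatrix

/-! ### Secant slopes -/

section Secant

/-- The slope of the secant of `g` between `q` and `p`, with the derivative if `p = q`. -/
noncomputable def sec (g : ℝ → ℝ) (q p : ℝ) : ℝ :=
  if q - p = 0 then deriv g q else (g p - g q) / (p - q)

theorem sec_mul (g : ℝ → ℝ) (q p : ℝ) : sec g q p * (p - q) = g p - g q := by
  unfold sec
  split_ifs with h
  · rw [sub_eq_zero.1 h]; simp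
  · rw [div_mul_cancel₀]
    intro h'
    exact h (by linarith)

theorem beta_eq_sec {m : ℕ} (g : ℝ → ℝ) (x θbar θhat : EuclideanSpace ℝ (Fin m)) :
    beta g x θbar θhat = sec g (inner ℝ x θhat) (inner ℝ x θbar) := rfl

/-- The secant slope is the mean of the derivative over the segment. A primitive on `[0, 1]`
expresses this without integrals, and leaves only the mean value theorem to apply. -/
theorem exists_primitive_sec {g : ℝ → ℝ} (hg : Differentiable ℝ g) (q p : ℝ) :
    ∃ F : ℝ → ℝ, (∀ s, HasDerivAt F (deriv g (q + s * (p - q))) s) ∧ F 1 - F 0 = sec g q p := by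
  by_cases h : q - p = 0
  · refine ⟨fun s => s * deriv g q, fun s => ?_, by simp [sec, h]⟩
    have : p - q = 0 := by linarith
    simpa [this] using (hasDerivAt_id s).mul_const (deriv g q)
  · have h' : p - q ≠ 0 := fun h' => h (by linarith)
    refine ⟨fun s => g (q + s * (p - q)) / (p - q), fun s => ?_, ?_⟩
    · have h1 : HasDerivAt (fun s : ℝ => q + s * (p - q)) (p - q) s := by
        simpa using ((hasDerivAt_id s).mul_const (p - q)).const_add q
      have h2 := ((hg (q + s * (p - q))).hasDerivAt.comp s h1).div_const (p - q)
      rwa [mul_div_assoc, div_self h', mul_one] at h2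
    · simp [sec, h, ← sub_div]

theorem abs_segment_le {K q p s : ℝ} (hq : |q| ≤ K) (hp : |p| ≤ K) (h0 : 0 ≤ s) (h1 : s ≤ 1) :
    |q + s * (p - q)| ≤ K := by
  rw [abs_le] at *
  constructor <;> nlinarith

theorem sec_mem_Icc {g : ℝ → ℝ} (hg : Differentiable ℝ g) {K lo hi : ℝ}
    (hb : ∀ x, |x| ≤ K → lo ≤ deriv g x ∧ deriv g x ≤ hi) {q p : ℝ} (hq : |q| ≤ K)
    (hp : |p| ≤ K) : lo ≤ sec g q p ∧ sec g q p ≤ hi := by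
  obtain ⟨F, hF, h⟩ := exists_primitive_sec hg q p
  obtain ⟨s, ⟨h0, h1⟩, hs⟩ := exists_hasDerivAt_eq_slope F _ one_pos
    (fun s _ => (hF s).continuousAt.continuousWithinAt) (fun s _ => hF s)
  rw [h, sub_zero, div_one] at hs
  rw [← hs]
  exact hb _ (abs_segment_le hq hp h0.le h1.le)

/-- The mean value theorem is applied to the difference of the two primitives, which gives one
common parameter `s`; the two evaluation points are then only `s |p - p'|` apart. -/
theorem abs_sec_sub_sec_le {g : ℝ → ℝ} (hg : Differentiable ℝ g) {K ρ : ℝ} (hρ : 0 ≤ ρ)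
    (hL : ∀ x x', |x| ≤ K → |x'| ≤ K → |deriv g x - deriv g x'| ≤ ρ * |x - x'|) {q p p' : ℝ}
    (hq : |q| ≤ K) (hp : |p| ≤ K) (hp' : |p'| ≤ K) :
    |sec g q p - sec g q p'| ≤ ρ * |p - p'| := by
  obtain ⟨F, hF, h⟩ := exists_primitive_sec hg q p
  obtain ⟨F', hF', h'⟩ := exists_primitive_sec hg q p'
  obtain ⟨s, ⟨h0, h1⟩, hs⟩ := exists_hasDerivAt_eq_slope (fun s => F s - F' s) _ one_pos
    (fun s _ => ((hF s).sub (hF' s)).continuousAt.continuousWithinAt)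
    (fun s _ => (hF s).sub (hF' s))
  have e : sec g q p - sec g q p' =
      deriv g (q + s * (p - q)) - deriv g (q + s * (p' - q)) := by
    rw [hs, ← h, ← h']; ring
  rw [e]
  refine (hL _ _ (abs_segment_le hq hp h0.le h1.le) (abs_segment_le hq hp' h0.le h1.le)).trans ?_
  refine mul_le_mul_of_nonneg_left ?_ hρ
  have : q + s * (p - q) - (q + s * (p' - q)) = s * (p - p') := by ring
  rw [this, abs_mul, abs_of_pos h0]
  exact mul_le_of_le_one_left (abs_nonneg _) h1.le

theorem slopeInf_slopeSup_bounds {g : ℝ → ℝ} {K M g₁ g₂ : ℝ} (hM0 : 0 ≤ M) (hMK : M ≤ K)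
    (hb : ∀ x, |x| ≤ K → g₁ ≤ deriv g x ∧ deriv g x ≤ g₂) :
    g₁ ≤ slopeInf g M ∧ slopeSup g M ≤ g₂ ∧
      ∀ x, |x| ≤ M → slopeInf g M ≤ deriv g x ∧ deriv g x ≤ slopeSup g M := by
  have hne : (deriv g '' {x | |x| ≤ M}).Nonempty := ⟨_, 0, by simpa using hM0, rfl⟩
  have hlo : ∀ z ∈ deriv g '' {x | |x| ≤ M}, g₁ ≤ z := by
    rintro _ ⟨x, hx, rfl⟩; exact (hb x (le_trans hx hMK)).1
  have hhi : ∀ z ∈ deriv g '' {x | |x| ≤ M}, z ≤ g₂ := by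
    rintro _ ⟨x, hx, rfl⟩; exact (hb x (le_trans hx hMK)).2
  exact ⟨le_csInf hne hlo, csSup_le hne hhi, fun x hx =>
    ⟨csInf_le ⟨g₁, hlo⟩ ⟨x, hx, rfl⟩, le_csSup ⟨g₂, hhi⟩ ⟨x, hx, rfl⟩⟩⟩

end Secant

/-! ### The quasi-Newton recursion along one sample path -/

section Recursion

variable {m : ℕ} {D : Set (EuclideanSpace ℝ (Fin m))}

/-- The leverage `a b² xᵀ P x` of one step with regularization `μ` and gain `b`. -/
noncomputable def leverage (μ b : ℝ) (x : EuclideanSpace ℝ (Fin m))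
    (P : Matrix (Fin m) (Fin m) ℝ) : ℝ :=
  1 / (μ + b ^ 2 * quad P x) * b ^ 2 * quad P x

/-- The coefficient of the noise in the energy increment of one step. -/
noncomputable def noiseCoeff (μ b : ℝ) (g : ℝ → ℝ) (x θ t : EuclideanSpace ℝ (Fin m))
    (P : Matrix (Fin m) (Fin m) ℝ) : ℝ :=
  2 * (leverage μ b x P * (g (inner ℝ x θ) - g (inner ℝ x t)) - b * inner ℝ x (θ - t)) / μ

theorem leverage_nonneg {P : Matrix (Fin m) (Fin m) ℝ} (hP : P.PosDef) {μ : ℝ} (hμ : 0 < μ)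
    (b : ℝ) (x : EuclideanSpace ℝ (Fin m)) : 0 ≤ leverage μ b x P := by
  have := quad_nonneg hP.posSemidef x
  unfold leverage
  positivity

theorem one_sub_leverage {P : Matrix (Fin m) (Fin m) ℝ} (hP : P.PosDef) {μ : ℝ} (hμ : 0 < μ)
    (b : ℝ) (x : EuclideanSpace ℝ (Fin m)) :
    1 - leverage μ b x P = μ / (μ + b ^ 2 * quad P x) := by
  have := quad_nonneg hP.posSemidef x
  have : 0 < μ + b ^ 2 * quad P x := by positivity
  unfold leverage
  field_simp
  ring

theorem leverage_le_one {P : Matrix (Fin m) (Fin m) ℝ} (hP : P.PosDef) {μ : ℝ} (hμ : 0 < μ)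
    (b : ℝ) (x : EuclideanSpace ℝ (Fin m)) : leverage μ b x P ≤ 1 := by
  have := quad_nonneg hP.posSemidef x
  have h : 0 ≤ μ / (μ + b ^ 2 * quad P x) := by positivity
  rw [← one_sub_leverage hP hμ] at h
  linarith

/-- Energy inequality of one step of the recursion. -/
theorem energy_step (hc : Convex ℝ D) (hD : IsCompact D) {θ : EuclideanSpace ℝ (Fin m)}
    (hθ : θ ∈ D) {s : EuclideanSpace ℝ (Fin m) × Matrix (Fin m) (Fin m) ℝ} (hP : s.2.PosDef)
    {μ : ℝ} (hμ : 0 < μ) (b : ℝ) (g : ℝ → ℝ) (x : EuclideanSpace ℝ (Fin m)) (y : ℝ) :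
    let s' := qnUpdate D (1 / (μ + b ^ 2 * quad s.2 x)) b g x y s
    quad s'.2⁻¹ (θ - s'.1) ≤ quad s.2⁻¹ (θ - s.1) +
      (b ^ 2 * (inner ℝ x (θ - s.1)) ^ 2
        - 2 * b * inner ℝ x (θ - s.1) * (g (inner ℝ x θ) - g (inner ℝ x s.1))
        + leverage μ b x s.2 * (g (inner ℝ x θ) - g (inner ℝ x s.1)) ^ 2) / μ
      + noiseCoeff μ b g x θ s.1 s.2 * (y - g (inner ℝ x θ))
      + 1 / μ * (leverage μ b x s.2 * (y - g (inner ℝ x θ)) ^ 2) := by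
  intro s'
  have hP' : s'.2⁻¹.PosDef := (update_posDef hP x hμ b).inv
  -- The projection is taken in the metric of the new inverse covariance, the one in which the new
  -- energy is measured.
  have h1 : quad s'.2⁻¹ (θ - s'.1) ≤ _ := quad_sub_proj_le hP' hc hD
    (s.1 + (1 / (μ + b ^ 2 * quad s.2 x) * b * (y - g (inner ℝ x s.1))) • mulE s.2 x) hθ
  refine h1.trans (le_of_eq ?_)
  have h2 : s'.2⁻¹ = s.2⁻¹ + (b ^ 2 / μ) • outer x := update_inv hP x hμ b
  rw [h2, ← sub_sub, quad_gain_step hP x _ hμ]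
  -- The innovation splits into a prediction error and the noise.
  have e : y - g (inner ℝ x s.1) =
    (g (inner ℝ x θ) - g (inner ℝ x s.1)) + (y - g (inner ℝ x θ)) := by ring
  rw [e]
  simp only [noiseCoeff, leverage]
  field_simp
  ring

/-- `st` is a trajectory of the quasi-Newton recursion with regularization `μ` and gains `b`. -/
structure IsTrajectory (D : Set (EuclideanSpace ℝ (Fin m))) (φ : ℕ → EuclideanSpace ℝ (Fin m))
    (y : ℕ → ℝ) (G : ℕ → ℝ → ℝ) (μ b : ℕ → ℝ)
    (st : ℕ → EuclideanSpace ℝ (Fin m) × Matrix (Fin m) (Fin m) ℝ) : Prop where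
  step : ∀ k, st (k + 1) = qnUpdate D (1 / (μ k + b k ^ 2 * quad (st k).2 (φ k))) (b k) (G k) (φ k)
    (y (k + 1)) (st k)
  mu_pos : ∀ k, 0 < μ k
  init_mem : (st 0).1 ∈ D
  init_posDef : (st 0).2.PosDef

namespace IsTrajectory

variable {φ : ℕ → EuclideanSpace ℝ (Fin m)} {y : ℕ → ℝ} {G : ℕ → ℝ → ℝ} {μ b : ℕ → ℝ}
  {st : ℕ → EuclideanSpace ℝ (Fin m) × Matrix (Fin m) (Fin m) ℝ}

theorem posDef (h : IsTrajectory D φ y G μ b st) (k : ℕ) : (st k).2.PosDef := by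
  induction k with
  | zero => exact h.init_posDef
  | succ k ih => rw [h.step]; exact update_posDef ih _ (h.mu_pos k) _

theorem mem (h : IsTrajectory D φ y G μ b st) (hD : IsCompact D) (k : ℕ) : (st k).1 ∈ D := by
  cases k with
  | zero => exact h.init_mem
  | succ k => rw [h.step]; exact (proj_spec hD ⟨_, h.init_mem⟩ _ _).1

theorem inv_succ (h : IsTrajectory D φ y G μ b st) (k : ℕ) :
    (st (k + 1)).2⁻¹ = (st k).2⁻¹ + (b k ^ 2 / μ k) • outer (φ k) := by
  rw [h.step]; exact update_inv (h.posDef k) _ (h.mu_pos k) _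

theorem inv_eq (h : IsTrajectory D φ y G μ b st) (n : ℕ) :
    (st n).2⁻¹ = (st 0).2⁻¹ + ∑ k ∈ Finset.range n, (b k ^ 2 / μ k) • outer (φ k) := by
  induction n with
  | zero => simp
  | succ n ih => rw [h.inv_succ, ih, Finset.sum_range_succ, add_assoc]

theorem quad_le (h : IsTrajectory D φ y G μ b st) (k : ℕ) (z : EuclideanSpace ℝ (Fin m)) :
    quad (st k).2 z ≤ quad (st 0).2 z := by
  induction k with
  | zero => exact le_rfl
  | succ k ih => rw [h.step]; exact (quad_update_le (h.posDef k) _ _ (h.mu_pos k) _).trans ih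

/-- Each update decreases the covariance as a quadratic form, so the initial covariance and the
bound on the regressors control all later forms. -/
theorem exists_quad_le (h : IsTrajectory D φ y G μ b st) {C : ℝ} (hφ : ∀ k, ‖φ k‖ ≤ C) :
    ∃ S : ℝ, 0 ≤ S ∧ ∀ k, quad (st k).2 (φ k) ≤ S := by
  refine ⟨|lamMax (st 0).2| * C ^ 2, by positivity, fun k => (h.quad_le k _).trans ?_⟩
  refine (quad_le_lamMax_mul h.init_posDef.isHermitian _).trans ?_
  refine mul_le_mul (le_abs_self _) ?_ (sq_nonneg _) (abs_nonneg _)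
  exact pow_le_pow_left₀ (norm_nonneg _) (hφ k) 2

theorem sum_leverage_le (h : IsTrajectory D φ y G μ b st) (n : ℕ) :
    ∑ k ∈ Finset.range n, leverage (μ k) (b k) (φ k) (st k).2 ≤
      Real.log (st n).2⁻¹.det - Real.log (st 0).2⁻¹.det := by
  induction n with
  | zero => simp
  | succ n ih =>
    have := leverage_le_log_det (h.posDef n) (φ n) (h.mu_pos n) (b n)
    rw [← h.inv_succ] at this
    rw [Finset.sum_range_succ]
    unfold leverage at *
    linarith

/-- The accumulated leverage grows at most logarithmically. -/
theorem exists_sum_leverage_le (h : IsTrajectory D φ y G μ b st) {C : ℝ}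
    (hC : ∀ k, b k ^ 2 / μ k ≤ C) :
    ∃ K : ℝ, 0 ≤ K ∧ ∀ n, ∑ k ∈ Finset.range n, leverage (μ k) (b k) (φ k) (st k).2 ≤
      K * (1 + Real.log (1 + ∑ k ∈ Finset.range n, ‖φ k‖ ^ 2)) := by
  set T := (st 0).2⁻¹.trace
  have hT : 0 ≤ T := h.init_posDef.inv.posSemidef.trace_nonneg
  set c := 1 + T + |C|
  have hc : 0 < c := by positivity
  refine ⟨m * |Real.log c| + |Real.log (st 0).2⁻¹.det| + m, by positivity, fun n => ?_⟩
  set S := ∑ k ∈ Finset.range n, ‖φ k‖ ^ 2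
  have hS : 0 ≤ S := Finset.sum_nonneg fun i _ => sq_nonneg _
  have htr : (st n).2⁻¹.trace ≤ c * (1 + S) := by
    have h1 : ∑ k ∈ Finset.range n, b k ^ 2 / μ k * ‖φ k‖ ^ 2 ≤ |C| * S := by
      rw [Finset.mul_sum]
      exact Finset.sum_le_sum fun k _ =>
        mul_le_mul_of_nonneg_right ((hC k).trans (le_abs_self C)) (sq_nonneg _)
    rw [h.inv_eq, trace_add, trace_sum]
    simp only [trace_smul, trace_outer, smul_eq_mul]
    have : c * (1 + S) = 1 + T + |C| + (1 + T) * S + |C| * S := by ring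
    have h3 : 0 ≤ (1 + T) * S := by positivity
    rw [this]
    linarith [abs_nonneg C]
  have hpd := (h.posDef n).inv
  have hlog : Real.log (st n).2⁻¹.det ≤ m * (Real.log c + Real.log (1 + S)) := by
    have h0 : 0 ≤ (st n).2⁻¹.trace := hpd.posSemidef.trace_nonneg
    refine (Real.log_le_log hpd.det_pos ((det_le_trace_pow hpd).trans
      (pow_le_pow_left₀ h0 htr m))).trans (le_of_eq ?_)
    rw [Real.log_pow, Real.log_mul hc.ne' (by positivity)]
  have hl : 0 ≤ Real.log (1 + S) := Real.log_nonneg (by linarith)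
  refine (h.sum_leverage_le n).trans ?_
  have h1 : (m : ℝ) * Real.log c ≤ m * |Real.log c| :=
    mul_le_mul_of_nonneg_left (le_abs_self _) (by positivity)
  have h2 := neg_abs_le (Real.log (st 0).2⁻¹.det)
  have h3 : 0 ≤ (m * |Real.log c| + |Real.log (st 0).2⁻¹.det|) * Real.log (1 + S) := by
    positivity
  have hm : (0 : ℝ) ≤ m := by positivity
  nlinarith

/-- The inverse covariance dominates a multiple of the information matrix. -/
theorem exists_infoMatrix_le [NeZero m] (h : IsTrajectory D φ y G μ b st) {c lam0 : ℝ} (hc : 0 < c)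
    (hC : ∀ k, c ≤ b k ^ 2 / μ k) (hlam : 0 < lam0) :
    ∃ κ : ℝ, 0 < κ ∧ ∀ n x, κ * quad (infoMatrix φ lam0 n) x ≤ quad (st (n + 1)).2⁻¹ x := by
  have hpos : 0 < lamMin (st 0).2⁻¹ := lamMin_pos h.init_posDef.inv
  -- The first bound serves each rank-one term; the second lets the initial inverse covariance
  -- dominate the `lam0` term.
  refine ⟨min c (lamMin (st 0).2⁻¹ / lam0), by positivity, fun n x => ?_⟩
  rw [quad_infoMatrix, h.inv_eq (n + 1), quad_add_left, quad_sum_left, mul_add, Finset.mul_sum, add_comm]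
  refine add_le_add ?_ (Finset.sum_le_sum fun k _ => ?_)
  · refine le_trans ?_ (lamMin_mul_le_quad h.init_posDef.inv.isHermitian x)
    rw [← mul_assoc]
    refine mul_le_mul_of_nonneg_right ?_ (sq_nonneg _)
    calc _ ≤ lamMin (st 0).2⁻¹ / lam0 * lam0 :=
          mul_le_mul_of_nonneg_right (min_le_right _ _) hlam.le
      _ = _ := div_mul_cancel₀ _ hlam.ne'
  · rw [quad_smul_left, quad_outer]
    exact mul_le_mul_of_nonneg_right ((min_le_left _ _).trans (hC k)) (sq_nonneg _)

end IsTrajectory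

/-- Accumulation of energy increments: the negative drift absorbs the noise terms. -/
theorem exists_energy_bound {V h r f α w ℓ : ℕ → ℝ} {c Kf Kw Kh Kα : ℝ} (hc : 0 < c)
    (hKw : 0 ≤ Kw) (hℓ : ∀ n, 0 ≤ ℓ n)
    (hV : ∀ k, V (k + 1) ≤ V k + h k - c * r k ^ 2 + f k * w k + Kw * (α k * w k ^ 2))
    (hf : ∀ k, |f k| ≤ Kf * |r k|)
    (hh : ∀ n, ∑ k ∈ Finset.range n, h k ≤ Kh * (1 + ℓ n))
    (hα0 : ∀ k, 0 ≤ α k)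
    (hα : ∀ n, ∑ k ∈ Finset.range n, α k ≤ Kα * (1 + ℓ n))
    (hA : ∀ ε > 0, ∃ C, ∀ n, |∑ k ∈ Finset.range n, f k * w k| ≤
      C + ε * ∑ k ∈ Finset.range n, f k ^ 2)
    (hB : ∃ C, ∀ n, ∑ k ∈ Finset.range n, α k * w k ^ 2 ≤ C * (1 + ∑ k ∈ Finset.range n, α k)) :
    ∃ K : ℝ, 0 ≤ K ∧ ∀ n, V n + c / 2 * ∑ k ∈ Finset.range n, r k ^ 2 ≤ K * (1 + ℓ n) := by
  -- With this `ε`, the linear noise costs at most half of the drift, since `∑ f² ≤ Kf² ∑ r²`; the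
  -- `+ 1` covers `Kf = 0`.
  obtain ⟨C₁, hC₁⟩ := hA (c / (2 * (Kf ^ 2 + 1))) (by positivity)
  obtain ⟨C₂, hC₂⟩ := hB
  refine ⟨|V 0| + |Kh| + |C₁| + Kw * (|C₂| * (1 + |Kα|)), by positivity, fun n => ?_⟩
  have hsum : V n ≤ V 0 + ∑ k ∈ Finset.range n, h k - c * ∑ k ∈ Finset.range n, r k ^ 2
      + ∑ k ∈ Finset.range n, f k * w k + Kw * ∑ k ∈ Finset.range n, α k * w k ^ 2 := by
    induction n with
    | zero => simp
    | succ n ih =>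
      simp only [Finset.sum_range_succ]
      linarith [hV n]
  have hf2 : ∑ k ∈ Finset.range n, f k ^ 2 ≤ Kf ^ 2 * ∑ k ∈ Finset.range n, r k ^ 2 := by
    rw [Finset.mul_sum]
    refine Finset.sum_le_sum fun k _ => ?_
    rw [← sq_abs (f k), ← sq_abs (r k), ← mul_pow]
    exact pow_le_pow_left₀ (abs_nonneg _) (hf k) 2
  set R := ∑ k ∈ Finset.range n, r k ^ 2
  have hR : 0 ≤ R := Finset.sum_nonneg fun i _ => sq_nonneg _
  have h1 : c / (2 * (Kf ^ 2 + 1)) * ∑ k ∈ Finset.range n, f k ^ 2 ≤ c / 2 * R := by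
    calc _ ≤ c / (2 * (Kf ^ 2 + 1)) * ((Kf ^ 2 + 1) * R) :=
          mul_le_mul_of_nonneg_left (by nlinarith) (by positivity)
      _ = c / 2 * R := by field_simp
  have h2 := (le_abs_self _).trans (hC₁ n)
  have hl := hℓ n
  have h3 : ∑ k ∈ Finset.range n, α k * w k ^ 2 ≤ |C₂| * (1 + |Kα|) * (1 + ℓ n) := by
    have hneg : 0 ≤ 1 + ∑ k ∈ Finset.range n, α k :=
      add_nonneg zero_le_one (Finset.sum_nonneg fun k _ => hα0 k)
    calc _ ≤ |C₂| * (1 + ∑ k ∈ Finset.range n, α k) :=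
          (hC₂ n).trans (mul_le_mul_of_nonneg_right (le_abs_self _) hneg)
      _ ≤ |C₂| * ((1 + |Kα|) * (1 + ℓ n)) := by
          refine mul_le_mul_of_nonneg_left ?_ (abs_nonneg _)
          have : Kα * (1 + ℓ n) ≤ |Kα| * (1 + ℓ n) :=
            mul_le_mul_of_nonneg_right (le_abs_self _) (by linarith)
          linarith [hα n]
      _ = _ := by ring
  have h4 : Kw * ∑ k ∈ Finset.range n, α k * w k ^ 2 ≤ Kw * (|C₂| * (1 + |Kα|) * (1 + ℓ n)) :=
    mul_le_mul_of_nonneg_left h3 hKw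
  have h5 : ∑ k ∈ Finset.range n, h k ≤ |Kh| * (1 + ℓ n) :=
    (hh n).trans (mul_le_mul_of_nonneg_right (le_abs_self _) (by linarith))
  have h6 : 0 ≤ |V 0| * ℓ n := by positivity
  have h7 : 0 ≤ |C₁| * ℓ n := by positivity
  have e : (|V 0| + |Kh| + |C₁| + Kw * (|C₂| * (1 + |Kα|))) * (1 + ℓ n)
    = |V 0| + |V 0| * ℓ n + |Kh| * (1 + ℓ n) + |C₁| + |C₁| * ℓ n
      + Kw * (|C₂| * (1 + |Kα|) * (1 + ℓ n)) := by ring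
  rw [e]
  linarith [le_abs_self (V 0), le_abs_self C₁]

end Recursion

/-! ### Energy bounds for the two steps of the algorithm -/

section TwoSteps

variable {m : ℕ} {D : Set (EuclideanSpace ℝ (Fin m))} {φ : ℕ → EuclideanSpace ℝ (Fin m)}
  {y : ℕ → ℝ} {G : ℕ → ℝ → ℝ}

/-- Uniform bounds on the regressors and on the functions `G k` along one sample path. -/
structure PathBounds (D : Set (EuclideanSpace ℝ (Fin m))) (φ : ℕ → EuclideanSpace ℝ (Fin m))
    (G : ℕ → ℝ → ℝ) (M : ℕ → ℝ) (C K g₁ g₂ ρ : ℝ) : Prop where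
  norm_le : ∀ k, ‖φ k‖ ≤ C
  inner_le : ∀ k, ∀ x ∈ D, |inner ℝ (φ k) x| ≤ M k
  le_top : ∀ k, M k ≤ K
  diff : ∀ k, Differentiable ℝ (G k)
  pos : 0 < g₁
  bounds : ∀ k x, |x| ≤ K → g₁ ≤ deriv (G k) x ∧ deriv (G k) x ≤ g₂
  rho_nonneg : 0 ≤ ρ
  lip : ∀ k x x', |x| ≤ K → |x'| ≤ K → |deriv (G k) x - deriv (G k) x'| ≤ ρ * |x - x'|

/-- The sum `∑ f k w_{k+1}` is bounded by `C + ε ∑ f k ^ 2`, for every `ε > 0`. -/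
def NoiseNegligible (f w : ℕ → ℝ) : Prop :=
  ∀ ε > 0, ∃ C, ∀ n, |∑ k ∈ Finset.range n, f k * w k| ≤ C + ε * ∑ k ∈ Finset.range n, f k ^ 2

/-- The sum `∑ α k w_{k+1} ^ 2` is of the order of `1 + ∑ α k`. -/
def SquareDominated (α w : ℕ → ℝ) : Prop :=
  ∃ C, ∀ n, ∑ k ∈ Finset.range n, α k * w k ^ 2 ≤ C * (1 + ∑ k ∈ Finset.range n, α k)

theorem log_one_add_sum_nonneg (φ : ℕ → EuclideanSpace ℝ (Fin m)) (n : ℕ) :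
    0 ≤ Real.log (1 + ∑ k ∈ Finset.range n, ‖φ k‖ ^ 2) :=
  Real.log_nonneg (le_add_of_nonneg_right (Finset.sum_nonneg fun _ _ => sq_nonneg _))

/-- The gain `b` is at most the smallest slope, so `b² r² ≤ b d r²`; it is also so small that the
leverage term is at most `b d r² / 2`. With `-2 b d r²` the drift is at most `-b d r² / 2`, whatever
the estimate. No accuracy of `b` as a slope is needed. -/
theorem first_step_bound {M : ℕ → ℝ} {C K g₁ g₂ ρ : ℝ} (hc : Convex ℝ D) (hD : IsCompact D)
    {θ : EuclideanSpace ℝ (Fin m)} (hθ : θ ∈ D) (hB : PathBounds D φ G M C K g₁ g₂ ρ)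
    {b : ℕ → ℝ} {st : ℕ → EuclideanSpace ℝ (Fin m) × Matrix (Fin m) (Fin m) ℝ}
    (ht : IsTrajectory D φ y G (fun _ => 1) b st)
    (hb : ∀ k, b k = betaBar (G k) (M k) (φ k) (st k).2)
    (h1 : NoiseNegligible (fun k => noiseCoeff 1 (b k) (G k) (φ k) θ (st k).1 (st k).2)
      fun k => y (k + 1) - G k (inner ℝ (φ k) θ))
    (h2 : SquareDominated (fun k => leverage 1 (b k) (φ k) (st k).2)
      fun k => y (k + 1) - G k (inner ℝ (φ k) θ)) :
    ∃ L : ℝ, 0 ≤ L ∧ ∀ n, ∑ k ∈ Finset.range n, (inner ℝ (φ k) (θ - (st k).1)) ^ 2 ≤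
      L * (1 + Real.log (1 + ∑ k ∈ Finset.range n, ‖φ k‖ ^ 2)) := by
  obtain ⟨S, hS0, hS⟩ := ht.exists_quad_le hB.norm_le
  have hM0 : ∀ k, 0 ≤ M k := fun k => (abs_nonneg _).trans (hB.inner_le k θ hθ)
  have hg1 := hB.pos
  have hg2 : 0 < g₂ := by
    have hK := (hM0 0).trans (hB.le_top 0)
    obtain ⟨ha, hb⟩ := hB.bounds 0 0 (by simpa using hK)
    linarith
  -- A positive lower bound for all gains, obtained from the worst slopes and the uniform bound `S`
  -- on `φᵀ P φ`; it makes the drift uniformly strict.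
  set b₀ := min g₁ (1 / (2 * g₂ * S + 1)) with hb₀
  have hb₀pos : 0 < b₀ := by positivity
  -- bounds on the gains
  have hbk : ∀ k, b₀ ≤ b k ∧ b k ≤ slopeInf (G k) (M k) ∧
      b k * (slopeSup (G k) (M k) * quad (st k).2 (φ k)) ≤ 1 / 2 ∧ slopeSup (G k) (M k) ≤ g₂ ∧
      g₁ ≤ slopeInf (G k) (M k) := by
    intro k
    obtain ⟨hs1, hs2, hs3⟩ := slopeInf_slopeSup_bounds (hM0 k) (hB.le_top k) (hB.bounds k)
    have hs4 := hs3 0 (by simpa using hM0 k)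
    have hsup : 0 < slopeSup (G k) (M k) := by linarith
    have hq := quad_nonneg (ht.posDef k).posSemidef (φ k)
    have hu : b k ≤ 1 / (2 * slopeSup (G k) (M k) * quad (st k).2 (φ k) + 1) := by
      rw [hb]; exact min_le_right _ _
    refine ⟨?_, by rw [hb]; exact min_le_left _ _, ?_, hs2, hs1⟩
    · rw [hb, hb₀]
      refine min_le_min hs1 (one_div_le_one_div_of_le (by positivity) ?_)
      have : slopeSup (G k) (M k) * quad (st k).2 (φ k) ≤ g₂ * S :=
        mul_le_mul hs2 (hS k) hq hg2.le
      linarith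
    · refine (mul_le_mul_of_nonneg_right hu (by positivity)).trans ?_
      rw [one_div_mul_eq_div, div_le_div_iff₀ (by positivity) (by norm_num)]
      linarith
  have hsec : ∀ k, ∃ d, g₁ ≤ d ∧ d ≤ g₂ ∧ slopeInf (G k) (M k) ≤ d ∧ d ≤ slopeSup (G k) (M k) ∧
      G k (inner ℝ (φ k) θ) - G k (inner ℝ (φ k) (st k).1) = d * inner ℝ (φ k) (θ - (st k).1) := by
    intro k
    have hp := hB.inner_le k θ hθ
    have hq := hB.inner_le k _ (ht.mem hD k)
    obtain ⟨hs1, hs2, hs3⟩ := slopeInf_slopeSup_bounds (hM0 k) (hB.le_top k) (hB.bounds k)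
    obtain ⟨hd1, hd2⟩ := sec_mem_Icc (hB.diff k) hs3 hq hp
    exact ⟨_, hs1.trans hd1, hd2.trans hs2, hd1, hd2, by rw [inner_sub_right, sec_mul]⟩
  obtain ⟨Kα, hKα0, hKα⟩ := ht.exists_sum_leverage_le (C := g₂ ^ 2) fun k => by
    obtain ⟨d, hd1, hd2, hd3, -⟩ := hsec k
    have := hbk k
    rw [div_one]
    exact pow_le_pow_left₀ (hb₀pos.le.trans this.1) (this.2.1.trans (hd3.trans hd2)) 2
  obtain ⟨L, hL0, hL⟩ : ∃ L : ℝ, 0 ≤ L ∧ ∀ n, quad (st n).2⁻¹ (θ - (st n).1) + b₀ * g₁ / 2 / 2 *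
      ∑ k ∈ Finset.range n, (inner ℝ (φ k) (θ - (st k).1)) ^ 2 ≤
      L * (1 + Real.log (1 + ∑ k ∈ Finset.range n, ‖φ k‖ ^ 2)) := by
    refine exists_energy_bound
      (V := fun k => quad (st k).2⁻¹ (θ - (st k).1)) (h := fun _ => 0)
      (r := fun k => inner ℝ (φ k) (θ - (st k).1))
      (f := fun k => noiseCoeff 1 (b k) (G k) (φ k) θ (st k).1 (st k).2)
      (α := fun k => leverage 1 (b k) (φ k) (st k).2)
      (w := fun k => y (k + 1) - G k (inner ℝ (φ k) θ))
      (ℓ := fun n => Real.log (1 + ∑ k ∈ Finset.range n, ‖φ k‖ ^ 2))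
      (c := b₀ * g₁ / 2) (Kf := 4 * g₂) (Kw := 1) (Kh := 0) (Kα := Kα)
      (by positivity) zero_le_one (log_one_add_sum_nonneg φ) ?_ ?_ (by simp)
      (fun k => leverage_nonneg (ht.posDef k) one_pos _ _) hKα h1 h2
    · intro k
      have hstep := energy_step hc hD hθ (ht.posDef k) (ht.mu_pos k) (b k) (G k) (φ k) (y (k + 1))
      simp only [← ht.step k] at hstep
      refine hstep.trans ?_
      obtain ⟨d, hd1, hd2, hd3, hd4, hd5⟩ := hsec k
      obtain ⟨hb1, hb2, hb3, hb4, hb5⟩ := hbk k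
      have hq := quad_nonneg (ht.posDef k).posSemidef (φ k)
      have hbpos : 0 < b k := hb₀pos.trans_le hb1
      -- The denominator of the leverage is at least `1`, because the first step has regularization
      -- `1`.
      have hlev : leverage 1 (b k) (φ k) (st k).2 ≤ b k ^ 2 * quad (st k).2 (φ k) := by
        unfold leverage
        rw [mul_assoc, one_div_mul_eq_div]
        exact div_le_self (by positivity) (by nlinarith [mul_nonneg (sq_nonneg (b k)) hq])
      rw [hd5]
      set r : ℝ := inner ℝ (φ k) (θ - (st k).1)
      have hr : 0 ≤ r ^ 2 := sq_nonneg r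
      have e1 : leverage 1 (b k) (φ k) (st k).2 * (d * r) ^ 2 ≤ b k * d / 2 * r ^ 2 := by
        have : leverage 1 (b k) (φ k) (st k).2 * d ^ 2 ≤ b k * d / 2 := by
          calc _ ≤ b k ^ 2 * quad (st k).2 (φ k) * d ^ 2 :=
                mul_le_mul_of_nonneg_right hlev (sq_nonneg _)
            _ = b k * d * (b k * (d * quad (st k).2 (φ k))) := by ring
            _ ≤ b k * d * (1 / 2) := by
                refine mul_le_mul_of_nonneg_left (le_trans ?_ hb3) (by
                  have : 0 < d := hg1.trans_le hd1
                  positivity)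
                exact mul_le_mul_of_nonneg_left (mul_le_mul_of_nonneg_right hd4 hq) hbpos.le
            _ = _ := by ring
        nlinarith
      have e2 : b k ^ 2 * r ^ 2 ≤ b k * d * r ^ 2 := by
        refine mul_le_mul_of_nonneg_right ?_ hr
        rw [sq]
        exact mul_le_mul_of_nonneg_left (hb2.trans hd3) hbpos.le
      have e3 : b₀ * g₁ / 2 * r ^ 2 ≤ b k * d / 2 * r ^ 2 := by
        refine mul_le_mul_of_nonneg_right ?_ hr
        have := mul_le_mul hb1 hd1 hg1.le hbpos.le
        linarith
      have e4 : 2 * b k * r * (d * r) = 2 * (b k * d * r ^ 2) := by ring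
      rw [e4]
      simp only [div_one, add_zero, one_mul]
      linarith
    · intro k
      obtain ⟨d, hd1, hd2, hd3, hd4, hd5⟩ := hsec k
      obtain ⟨hb1, hb2, hb3, hb4, hb5⟩ := hbk k
      have hl0 := leverage_nonneg (ht.posDef k) one_pos (b k) (φ k)
      have hl1 := leverage_le_one (ht.posDef k) one_pos (b k) (φ k)
      simp only [noiseCoeff, hd5, div_one]
      set r : ℝ := inner ℝ (φ k) (θ - (st k).1)
      have : leverage 1 (b k) (φ k) (st k).2 * (d * r) - b k * r
        = (leverage 1 (b k) (φ k) (st k).2 * d - b k) * r := by ring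
      rw [this, abs_mul, abs_mul, abs_two, ← mul_assoc]
      refine mul_le_mul_of_nonneg_right ?_ (abs_nonneg _)
      have h3 : |leverage 1 (b k) (φ k) (st k).2 * d - b k| ≤ g₂ := by
        have : leverage 1 (b k) (φ k) (st k).2 * d ≤ g₂ := by nlinarith
        have : 0 ≤ leverage 1 (b k) (φ k) (st k).2 * d := mul_nonneg hl0 (by linarith)
        rw [abs_le]
        constructor <;> linarith
      linarith
  have hc0 : 0 < b₀ * g₁ / 2 / 2 := by positivity
  refine ⟨L / (b₀ * g₁ / 2 / 2), by positivity, fun n => ?_⟩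
  have hV := quad_nonneg (ht.posDef n).inv.posSemidef (θ - (st n).1)
  rw [div_mul_eq_mul_div, le_div_iff₀ hc0, mul_comm]
  have := hL n
  linarith

theorem beta_mem_Icc {M : ℕ → ℝ} {C K g₁ g₂ ρ : ℝ} (hB : PathBounds D φ G M C K g₁ g₂ ρ)
    {θbar θhat : EuclideanSpace ℝ (Fin m)} (h₁ : θbar ∈ D) (h₂ : θhat ∈ D) (k : ℕ) :
    g₁ ≤ beta (G k) (φ k) θbar θhat ∧ beta (G k) (φ k) θbar θhat ≤ g₂ := by
  rw [beta_eq_sec]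
  exact sec_mem_Icc (hB.diff k) (hB.bounds k) ((hB.inner_le k _ h₂).trans (hB.le_top k))
    ((hB.inner_le k _ h₁).trans (hB.le_top k))

/-- Completing the square turns the drift into `(b - d)² r² - (1 - l) d² r²`. The first term is at
most a constant times the squared prediction error of the first step, whose sum is controlled by
`hL`; the second is uniformly negative. -/
theorem second_step_bound {M μ : ℕ → ℝ} {C K g₁ g₂ ρ c₁ c₂ : ℝ} (hc : Convex ℝ D)
    (hD : IsCompact D) {θ : EuclideanSpace ℝ (Fin m)} (hθ : θ ∈ D)
    (hB : PathBounds D φ G M C K g₁ g₂ ρ) (hc₁ : 0 < c₁) (hμ : ∀ k, c₁ ≤ μ k ∧ μ k ≤ c₂)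
    {θbar : ℕ → EuclideanSpace ℝ (Fin m)} (hθbar : ∀ k, θbar k ∈ D) {b : ℕ → ℝ}
    {st : ℕ → EuclideanSpace ℝ (Fin m) × Matrix (Fin m) (Fin m) ℝ}
    (ht : IsTrajectory D φ y G μ b st)
    (hb : ∀ k, b k = beta (G k) (φ k) (θbar k) (st k).1) {L : ℝ}
    (hL : ∀ n, ∑ k ∈ Finset.range n, (inner ℝ (φ k) (θ - θbar k)) ^ 2 ≤
      L * (1 + Real.log (1 + ∑ k ∈ Finset.range n, ‖φ k‖ ^ 2)))
    (h1 : NoiseNegligible (fun k => noiseCoeff (μ k) (b k) (G k) (φ k) θ (st k).1 (st k).2)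
      fun k => y (k + 1) - G k (inner ℝ (φ k) θ))
    (h2 : SquareDominated (fun k => leverage (μ k) (b k) (φ k) (st k).2)
      fun k => y (k + 1) - G k (inner ℝ (φ k) θ)) :
    ∃ L : ℝ, 0 ≤ L ∧ ∀ n, quad (st n).2⁻¹ (θ - (st n).1) ≤
      L * (1 + Real.log (1 + ∑ k ∈ Finset.range n, ‖φ k‖ ^ 2)) := by
  obtain ⟨S, hS0, hS⟩ := ht.exists_quad_le hB.norm_le
  have hM0 : ∀ k, 0 ≤ M k := fun k => (abs_nonneg _).trans (hB.inner_le k θ hθ)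
  have hK0 : 0 ≤ K := (hM0 0).trans (hB.le_top 0)
  have hg1 := hB.pos
  have hin : ∀ k, ∀ x ∈ D, |inner ℝ (φ k) x| ≤ K := fun k x hx =>
    (hB.inner_le k x hx).trans (hB.le_top k)
  have hbk : ∀ k, g₁ ≤ b k ∧ b k ≤ g₂ := fun k => by
    rw [hb]; exact beta_mem_Icc hB (hθbar k) (ht.mem hD k) k
  have hg2 : 0 < g₂ := hg1.trans_le ((hbk 0).1.trans (hbk 0).2)
  have hc₂ : 0 < c₂ := hc₁.trans_le ((hμ 0).1.trans (hμ 0).2)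
  have hρ := hB.rho_nonneg
  have hsec : ∀ k, ∃ d, g₁ ≤ d ∧ d ≤ g₂ ∧ |b k - d| ≤ ρ * |inner ℝ (φ k) (θ - θbar k)| ∧
      G k (inner ℝ (φ k) θ) - G k (inner ℝ (φ k) (st k).1) = d * inner ℝ (φ k) (θ - (st k).1) := by
    intro k
    have hp := hin k θ hθ
    have hp' := hin k _ (hθbar k)
    have hq := hin k _ (ht.mem hD k)
    obtain ⟨hd1, hd2⟩ := sec_mem_Icc (hB.diff k) (hB.bounds k) hq hp
    refine ⟨_, hd1, hd2, ?_, by rw [inner_sub_right, sec_mul]⟩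
    rw [hb, beta_eq_sec, inner_sub_right, abs_sub_comm (inner ℝ (φ k) θ)]
    exact abs_sec_sub_sec_le (hB.diff k) hρ (hB.lip k) hq hp' hp
  obtain ⟨Kα, hKα0, hKα⟩ := ht.exists_sum_leverage_le (C := g₂ ^ 2 / c₁) fun k =>
    div_le_div₀ (sq_nonneg _) (pow_le_pow_left₀ (hg1.le.trans (hbk k).1) (hbk k).2 2) hc₁ (hμ k).1
  -- The least possible value of `1 - leverage = μ / (μ + b² s)`, which increases with `μ` and
  -- decreases with `b² s`.
  set κ := c₁ / (c₁ + g₂ ^ 2 * S) with hκ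
  have hκ0 : 0 < κ := by positivity
  -- Here `ρ²` comes from the comparison of secants, and `2 * K` bounds `|r|` because both points
  -- lie in `D`.
  set H := ρ ^ 2 * (2 * K) ^ 2 / c₁ with hH
  have hH0 : 0 ≤ H := by positivity
  obtain ⟨L', hL0, hL'⟩ : ∃ L : ℝ, 0 ≤ L ∧ ∀ n, quad (st n).2⁻¹ (θ - (st n).1) +
      κ * g₁ ^ 2 / c₂ / 2 * ∑ k ∈ Finset.range n, (inner ℝ (φ k) (θ - (st k).1)) ^ 2 ≤
      L * (1 + Real.log (1 + ∑ k ∈ Finset.range n, ‖φ k‖ ^ 2)) := by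
    refine exists_energy_bound
      (V := fun k => quad (st k).2⁻¹ (θ - (st k).1))
      (h := fun k => H * (inner ℝ (φ k) (θ - θbar k)) ^ 2)
      (r := fun k => inner ℝ (φ k) (θ - (st k).1))
      (f := fun k => noiseCoeff (μ k) (b k) (G k) (φ k) θ (st k).1 (st k).2)
      (α := fun k => leverage (μ k) (b k) (φ k) (st k).2)
      (w := fun k => y (k + 1) - G k (inner ℝ (φ k) θ))
      (ℓ := fun n => Real.log (1 + ∑ k ∈ Finset.range n, ‖φ k‖ ^ 2))
      (c := κ * g₁ ^ 2 / c₂) (Kf := 2 * g₂ / c₁) (Kw := 1 / c₁) (Kh := H * L) (Kα := Kα)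
      (by positivity) (by positivity) (log_one_add_sum_nonneg φ) ?_ ?_ ?_
      (fun k => leverage_nonneg (ht.posDef k) (ht.mu_pos k) _ _) hKα h1 h2
    · intro k
      have hstep := energy_step hc hD hθ (ht.posDef k) (ht.mu_pos k) (b k) (G k) (φ k) (y (k + 1))
      simp only [← ht.step k] at hstep
      refine hstep.trans ?_
      obtain ⟨d, hd1, hd2, hd3, hd5⟩ := hsec k
      obtain ⟨hb1, hb2⟩ := hbk k
      have hμk := ht.mu_pos k
      have hq := quad_nonneg (ht.posDef k).posSemidef (φ k)
      have hl := one_sub_leverage (ht.posDef k) hμk (b k) (φ k)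
      have hl0 := leverage_nonneg (ht.posDef k) hμk (b k) (φ k)
      have hκl : κ ≤ 1 - leverage (μ k) (b k) (φ k) (st k).2 := by
        rw [hl, hκ, div_le_div_iff₀ (by positivity) (by positivity)]
        have h3 : b k ^ 2 * quad (st k).2 (φ k) ≤ g₂ ^ 2 * S :=
          mul_le_mul (pow_le_pow_left₀ (hg1.le.trans hb1) hb2 2) (hS k) hq (by positivity)
        have h4 : c₁ * (b k ^ 2 * quad (st k).2 (φ k)) ≤ μ k * (g₂ ^ 2 * S) :=
          mul_le_mul (hμ k).1 h3 (by positivity) hμk.le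
        linarith
      have hr2 : |(inner ℝ (φ k) (θ - (st k).1) : ℝ)| ≤ 2 * K := by
        rw [inner_sub_right]
        refine (abs_sub _ _).trans ?_
        linarith [hin k θ hθ, hin k _ (ht.mem hD k)]
      rw [hd5]
      set r : ℝ := inner ℝ (φ k) (θ - (st k).1)
      set rb : ℝ := inner ℝ (φ k) (θ - θbar k)
      set l := leverage (μ k) (b k) (φ k) (st k).2
      have hr : 0 ≤ r ^ 2 := sq_nonneg r
      have e0 : b k ^ 2 * r ^ 2 - 2 * b k * r * (d * r) + l * (d * r) ^ 2
        = (b k - d) ^ 2 * r ^ 2 - (1 - l) * d ^ 2 * r ^ 2 := by ring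
      have e1 : (b k - d) ^ 2 * r ^ 2 ≤ ρ ^ 2 * (2 * K) ^ 2 * rb ^ 2 := by
        have h3 : (b k - d) ^ 2 ≤ ρ ^ 2 * rb ^ 2 := by
          rw [← sq_abs (b k - d), ← sq_abs rb, ← mul_pow]
          exact pow_le_pow_left₀ (abs_nonneg _) hd3 2
        have h4 : r ^ 2 ≤ (2 * K) ^ 2 := by
          rw [← sq_abs r]; exact pow_le_pow_left₀ (abs_nonneg _) hr2 2
        calc _ ≤ ρ ^ 2 * rb ^ 2 * (2 * K) ^ 2 := mul_le_mul h3 h4 hr (by positivity)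
          _ = _ := by ring
      have e2 : κ * g₁ ^ 2 * r ^ 2 ≤ (1 - l) * d ^ 2 * r ^ 2 := by
        refine mul_le_mul_of_nonneg_right ?_ hr
        exact mul_le_mul hκl (pow_le_pow_left₀ hg1.le hd1 2) (by positivity) (hκ0.le.trans hκl)
      have e3 : (b k - d) ^ 2 * r ^ 2 / μ k ≤ H * rb ^ 2 := by
        have := div_le_div₀ (by positivity) e1 hc₁ (hμ k).1
        rw [hH]
        linarith [this, (by ring : ρ ^ 2 * (2 * K) ^ 2 * rb ^ 2 / c₁
          = ρ ^ 2 * (2 * K) ^ 2 / c₁ * rb ^ 2)]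
      have e4 : κ * g₁ ^ 2 / c₂ * r ^ 2 ≤ (1 - l) * d ^ 2 * r ^ 2 / μ k := by
        have := div_le_div₀ ((by positivity : 0 ≤ κ * g₁ ^ 2 * r ^ 2).trans e2) e2 hμk (hμ k).2
        linarith [this, (by ring : κ * g₁ ^ 2 * r ^ 2 / c₂ = κ * g₁ ^ 2 / c₂ * r ^ 2)]
      have e5 : 1 / μ k * (l * (y (k + 1) - G k (inner ℝ (φ k) θ)) ^ 2) ≤
          1 / c₁ * (l * (y (k + 1) - G k (inner ℝ (φ k) θ)) ^ 2) :=
        mul_le_mul_of_nonneg_right (one_div_le_one_div_of_le hc₁ (hμ k).1) (by positivity)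
      rw [e0, sub_div]
      linarith
    · intro k
      obtain ⟨d, hd1, hd2, hd3, hd5⟩ := hsec k
      obtain ⟨hb1, hb2⟩ := hbk k
      have hμk := ht.mu_pos k
      have hl0 := leverage_nonneg (ht.posDef k) hμk (b k) (φ k)
      have hl1 := leverage_le_one (ht.posDef k) hμk (b k) (φ k)
      simp only [noiseCoeff, hd5]
      set r : ℝ := inner ℝ (φ k) (θ - (st k).1)
      set l := leverage (μ k) (b k) (φ k) (st k).2
      have : 2 * (l * (d * r) - b k * r) / μ k = 2 * (l * d - b k) / μ k * r := by ring
      rw [this, abs_mul, abs_div, abs_mul, abs_two, abs_of_pos hμk]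
      refine mul_le_mul_of_nonneg_right ?_ (abs_nonneg _)
      have h3 : |l * d - b k| ≤ g₂ := by
        have : l * d ≤ g₂ := by nlinarith
        have : 0 ≤ l * d := mul_nonneg hl0 (by linarith)
        rw [abs_le]
        constructor <;> linarith
      exact div_le_div₀ (by positivity) (by linarith) hc₁ (hμ k).1
    · intro n
      rw [← Finset.mul_sum, mul_assoc]
      exact mul_le_mul_of_nonneg_left (hL n) hH0
  refine ⟨L', hL0, fun n => ?_⟩
  have : 0 ≤ κ * g₁ ^ 2 / c₂ / 2 * ∑ k ∈ Finset.range n, (inner ℝ (φ k) (θ - (st k).1)) ^ 2 :=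
    mul_nonneg (by positivity) (Finset.sum_nonneg fun i _ => sq_nonneg _)
  have := hL' n
  linarith

theorem step1_isTrajectory {M : ℕ → ℝ}
    {init : EuclideanSpace ℝ (Fin m) × Matrix (Fin m) (Fin m) ℝ} (h₁ : init.1 ∈ D)
    (h₂ : init.2.PosDef) :
    IsTrajectory D φ y G (fun _ => 1)
      (fun k => betaBar (G k) (M k) (φ k) (step1 D φ y G M init k).2)
      (step1 D φ y G M init) :=
  ⟨fun _ => rfl, fun _ => one_pos, h₁, h₂⟩

theorem step2_isTrajectory {μ : ℕ → ℝ} (hμ : ∀ k, 0 < μ k)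
    {θbar : ℕ → EuclideanSpace ℝ (Fin m)}
    {init : EuclideanSpace ℝ (Fin m) × Matrix (Fin m) (Fin m) ℝ} (h₁ : init.1 ∈ D)
    (h₂ : init.2.PosDef) :
    IsTrajectory D φ y G μ
      (fun k => beta (G k) (φ k) (θbar k) (step2 D φ y G μ θbar init k).1)
      (step2 D φ y G μ θbar init) :=
  ⟨fun _ => rfl, hμ, h₁, h₂⟩

/-- Convergence rate along one sample path, given the bounds on the noise terms. -/
theorem estimate_isBigO [NeZero m] {M μ : ℕ → ℝ} {C K g₁ g₂ ρ c₁ c₂ lam0 : ℝ} (hc : Convex ℝ D)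
    (hD : IsCompact D) {θ : EuclideanSpace ℝ (Fin m)} (hθ : θ ∈ D)
    (hB : PathBounds D φ G M C K g₁ g₂ ρ) (hc₁ : 0 < c₁) (hμ : ∀ k, c₁ ≤ μ k ∧ μ k ≤ c₂)
    (hlam : 0 < lam0) {initBar init : EuclideanSpace ℝ (Fin m) × Matrix (Fin m) (Fin m) ℝ}
    (hb₁ : initBar.1 ∈ D) (hb₂ : initBar.2.PosDef) (hi₁ : init.1 ∈ D) (hi₂ : init.2.PosDef)
    (h1 : NoiseNegligible (fun k => noiseCoeff 1
        (betaBar (G k) (M k) (φ k) (step1 D φ y G M initBar k).2) (G k) (φ k) θ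
        (step1 D φ y G M initBar k).1 (step1 D φ y G M initBar k).2)
      fun k => y (k + 1) - G k (inner ℝ (φ k) θ))
    (h2 : SquareDominated (fun k => leverage 1
        (betaBar (G k) (M k) (φ k) (step1 D φ y G M initBar k).2) (φ k)
        (step1 D φ y G M initBar k).2)
      fun k => y (k + 1) - G k (inner ℝ (φ k) θ))
    {st : ℕ → EuclideanSpace ℝ (Fin m) × Matrix (Fin m) (Fin m) ℝ}
    (hst : st = step2 D φ y G μ (fun j => (step1 D φ y G M initBar j).1) init)
    (h3 : NoiseNegligible (fun k => noiseCoeff (μ k)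
        (beta (G k) (φ k) (step1 D φ y G M initBar k).1 (st k).1) (G k) (φ k) θ
        (st k).1 (st k).2)
      fun k => y (k + 1) - G k (inner ℝ (φ k) θ))
    (h4 : SquareDominated (fun k => leverage (μ k)
        (beta (G k) (φ k) (step1 D φ y G M initBar k).1 (st k).1) (φ k) (st k).2)
      fun k => y (k + 1) - G k (inner ℝ (φ k) θ))
    (hlim : ¬ Tendsto (fun k => lamMax (infoMatrix φ lam0 k)) atTop (𝓝 1)) :
    (fun k => ‖θ - (st (k + 1)).1‖ ^ 2) =O[atTop]
      fun k => Real.log (lamMax (infoMatrix φ lam0 k)) / lamMin (infoMatrix φ lam0 k) := by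
  have ht1 : IsTrajectory D φ y G _ _ _ := step1_isTrajectory (M := M) hb₁ hb₂
  have hμ0 : ∀ k, 0 < μ k := fun k => hc₁.trans_le (hμ k).1
  have ht2 : IsTrajectory D φ y G μ
      (fun k => beta (G k) (φ k) (step1 D φ y G M initBar k).1 (st k).1) st := by
    rw [hst]; exact step2_isTrajectory hμ0 hi₁ hi₂
  obtain ⟨L₁, -, hL₁⟩ := first_step_bound hc hD hθ hB ht1 (fun _ => rfl) h1 h2
  obtain ⟨L₂, hL₂0, hL₂⟩ := second_step_bound hc hD hθ hB hc₁ hμ (fun k => ht1.mem hD k) ht2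
    (fun _ => rfl) hL₁ h3 h4
  have hc₂ : 0 < c₂ := (hμ0 0).trans_le (hμ 0).2
  have hg1 := hB.pos
  obtain ⟨κ, hκ, hinfo⟩ := ht2.exists_infoMatrix_le (c := g₁ ^ 2 / c₂) (by positivity)
    (fun k => div_le_div₀ (sq_nonneg _)
      (pow_le_pow_left₀ hg1.le (beta_mem_Icc hB (ht1.mem hD k) (ht2.mem hD k) k).1 2)
      (hμ0 k) (hμ k).2) hlam
  obtain ⟨C', hC'0, hC'⟩ := exists_one_add_log_le φ hlam hlim
  refine IsBigO.of_bound (L₂ * C' / κ) ?_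
  filter_upwards [hC'] with k hk
  have hpd := infoMatrix_posDef φ hlam k
  have hmin := lamMin_pos hpd
  rw [norm_div, Real.norm_eq_abs, Real.norm_eq_abs, Real.norm_eq_abs, abs_of_pos hmin,
    abs_of_nonneg (sq_nonneg _), ← mul_div_assoc, le_div_iff₀ hmin, div_mul_eq_mul_div,
    le_div_iff₀ hκ]
  calc _ = κ * (lamMin (infoMatrix φ lam0 k) * ‖θ - (st (k + 1)).1‖ ^ 2) := by ring
    _ ≤ κ * quad (infoMatrix φ lam0 k) (θ - (st (k + 1)).1) :=
        mul_le_mul_of_nonneg_left (lamMin_mul_le_quad hpd.isHermitian _) hκ.le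
    _ ≤ quad (st (k + 1)).2⁻¹ (θ - (st (k + 1)).1) := hinfo _ _
    -- The indices agree: `infoMatrix` at `k` and the energy at `k + 1` both involve the regressors
    -- `0, …, k`.
    _ ≤ _ := hL₂ (k + 1)
    _ ≤ L₂ * (C' * |Real.log (lamMax (infoMatrix φ lam0 k))|) :=
        mul_le_mul_of_nonneg_left hk hL₂0
    _ = _ := by ring

end TwoSteps

/-! ### Weighted series -/

section Series

open scoped ENNReal

/-- The integral of `t ^ (-p)` over `[x, x + a]` is at least its length times the smallest value of
the integrand. The proof replaces the integral by a Bernoulli-type bound for `(x / y) ^ (1 - p)`. -/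
theorem div_rpow_le_sub {x a p : ℝ} (hx : 0 < x) (ha : 0 ≤ a) (hp : 1 < p) :
    a / (x + a) ^ p ≤ 1 / (p - 1) * (x ^ (1 - p) - (x + a) ^ (1 - p)) := by
  set y := x + a with hy
  have hy0 : 0 < y := by positivity
  have h1 : x ^ (1 - p) = y ^ (1 - p) * (x / y) ^ (1 - p) := by
    rw [← Real.mul_rpow hy0.le (by positivity), mul_div_cancel₀ _ hy0.ne']
  have h2 : 1 + (p - 1) * (a / y) ≤ (x / y) ^ (1 - p) := by
    have hxy : 0 < x / y := by positivity
    rw [Real.rpow_def_of_pos hxy]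
    have h3 := Real.log_le_sub_one_of_pos hxy
    have h4 : x / y - 1 = -(a / y) := by rw [hy]; field_simp; ring
    have h5 := Real.add_one_le_exp (Real.log (x / y) * (1 - p))
    rw [h4] at h3
    nlinarith
  have h3 : a / y ^ p = y ^ (1 - p) * (a / y) := by
    rw [Real.rpow_sub hy0, Real.rpow_one]
    field_simp
  have hp1 : 0 < p - 1 := by linarith
  rw [h1, h3, one_div_mul_eq_div, le_div_iff₀ hp1]
  have := mul_le_mul_of_nonneg_left h2 (Real.rpow_nonneg hy0.le (1 - p))
  linarith

/-- For nonnegative `a`, the series `∑ a_k / (1 + ∑_{i ≤ k} a_i) ^ p` is bounded when `p > 1`. -/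
theorem sum_div_one_add_sum_rpow_le {a : ℕ → ℝ} (ha : ∀ k, 0 ≤ a k) {p : ℝ} (hp : 1 < p) (n : ℕ) :
    ∑ k ∈ Finset.range n, a k / (1 + ∑ i ∈ Finset.range (k + 1), a i) ^ p ≤ 1 / (p - 1) := by
  have hp1 : 0 < p - 1 := by linarith
  have hpos : ∀ n, 0 < 1 + ∑ i ∈ Finset.range n, a i := fun n =>
    add_pos_of_pos_of_nonneg one_pos (Finset.sum_nonneg fun k _ => ha k)
  -- The sharper telescoped form is what the induction needs.
  have key : ∑ k ∈ Finset.range n, a k / (1 + ∑ i ∈ Finset.range (k + 1), a i) ^ p ≤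
      1 / (p - 1) * (1 - (1 + ∑ i ∈ Finset.range n, a i) ^ (1 - p)) := by
    induction n with
    | zero => simp
    | succ n ih =>
      rw [Finset.sum_range_succ]
      have h := div_rpow_le_sub (hpos n) (ha n) hp
      rw [add_assoc, ← Finset.sum_range_succ] at h
      have e : 1 / (p - 1) * (1 - (1 + ∑ i ∈ Finset.range (n + 1), a i) ^ (1 - p))
        = 1 / (p - 1) * (1 - (1 + ∑ i ∈ Finset.range n, a i) ^ (1 - p))
          + 1 / (p - 1) * ((1 + ∑ i ∈ Finset.range n, a i) ^ (1 - p)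
          - (1 + ∑ i ∈ Finset.range (n + 1), a i) ^ (1 - p)) := by ring
      rw [e]
      linarith
  refine key.trans (mul_le_of_le_one_right (by positivity) ?_)
  linarith [Real.rpow_nonneg (hpos n).le (1 - p)]

/-- Abel summation bound for monotone weights. -/
theorem abs_sum_mul_le {c x : ℕ → ℝ} {C : ℝ} (hc0 : ∀ n, 0 ≤ c n) (hc : Monotone c)
    (hx : ∀ n, |∑ k ∈ Finset.range n, x k| ≤ C) (n : ℕ) :
    |∑ k ∈ Finset.range n, c (k + 1) * x k| ≤ 2 * C * c n := by
  -- The weight is `c (k + 1)`, because in the applications the normalization at time `k` already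
  -- contains the `k`-th term.
  have key : ∑ k ∈ Finset.range n, c (k + 1) * x k = c n * ∑ k ∈ Finset.range n, x k
      - ∑ k ∈ Finset.range n, (c (k + 1) - c k) * ∑ i ∈ Finset.range k, x i := by
    induction n with
    | zero => simp
    | succ n ih =>
      rw [Finset.sum_range_succ, ih, Finset.sum_range_succ x, Finset.sum_range_succ]
      ring
  have h1 : |c n * ∑ k ∈ Finset.range n, x k| ≤ c n * C := by
    rw [abs_mul, abs_of_nonneg (hc0 n)]
    exact mul_le_mul_of_nonneg_left (hx n) (hc0 n)
  have h2 : |∑ k ∈ Finset.range n, (c (k + 1) - c k) * ∑ i ∈ Finset.range k, x i| ≤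
      C * (c n - c 0) := by
    refine (Finset.abs_sum_le_sum_abs _ _).trans ?_
    rw [← Finset.sum_range_sub c n, Finset.mul_sum]
    refine Finset.sum_le_sum fun k _ => ?_
    have h := sub_nonneg.2 (hc k.le_succ)
    rw [abs_mul, abs_of_nonneg h, mul_comm]
    exact mul_le_mul_of_nonneg_right (hx k) h
  have hC : 0 ≤ C := (abs_nonneg _).trans (hx 0)
  rw [key]
  refine (abs_sub _ _).trans ?_
  nlinarith [mul_nonneg hC (hc0 0)]

/-- Sublinear growth: beyond `T = δ ^ (-4)` the factor `y ^ (-1/4)` is at most `δ`. -/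
theorem exists_rpow_le_add_mul {δ : ℝ} (hδ : 0 < δ) :
    ∃ T : ℝ, 0 ≤ T ∧ ∀ y : ℝ, 0 < y → y ^ (3 / 4 : ℝ) ≤ T + δ * y := by
  set T := δ ^ (-4 : ℝ) with hT
  have hT0 : 0 < T := Real.rpow_pos_of_pos hδ _
  refine ⟨T ^ (3 / 4 : ℝ), by positivity, fun y hy => ?_⟩
  rcases le_total y T with h | h
  · have := Real.rpow_le_rpow hy.le h (by norm_num : (0 : ℝ) ≤ 3 / 4)
    have : 0 ≤ δ * y := by positivity
    linarith
  · have h1 : y ^ (-(1 / 4) : ℝ) ≤ δ := by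
      refine (Real.rpow_le_rpow_of_nonpos hT0 h (by norm_num)).trans (le_of_eq ?_)
      rw [hT, ← Real.rpow_mul hδ.le]
      norm_num
    have h2 : y ^ (3 / 4 : ℝ) = y ^ (-(1 / 4) : ℝ) * y := by
      rw [← Real.rpow_add_one hy.ne']
      norm_num
    have h3 : 0 ≤ T ^ (3 / 4 : ℝ) := by positivity
    rw [h2]
    nlinarith

end Series

/-! ### Martingale difference sequences -/

section Martingale

open scoped ENNReal

variable {Ω : Type*} {m mΩ : MeasurableSpace Ω} {Pr : Measure Ω} [IsProbabilityMeasure Pr]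

theorem integral_mul_condExp (hm : m ≤ mΩ) {f g : Ω → ℝ}
    (hf : StronglyMeasurable[m] f) (hfg : Integrable (f * g) Pr) (hg : Integrable g Pr) :
    ∫ ω, f ω * g ω ∂Pr = ∫ ω, f ω * (Pr[g | m]) ω ∂Pr := by
  rw [← integral_condExp hm (f := fun ω => f ω * g ω)]
  exact integral_congr_ae (condExp_mul_of_stronglyMeasurable_left hf hfg hg)

/-- Partial sums of an `L²`-bounded martingale difference sequence are almost surely bounded. -/
theorem ae_bdd_sum_of_sum_sq_le {ℱ : Filtration ℕ mΩ} {d : ℕ → Ω → ℝ}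
    (hmeas : ∀ k, Measurable[ℱ (k + 1)] (d k)) (hL2 : ∀ k, MemLp (d k) 2 Pr)
    (h0 : ∀ k, Pr[d k | ℱ k] =ᵐ[Pr] 0) {R : ℝ}
    (hR : ∀ n, ∑ k ∈ Finset.range n, ∫ ω, d k ω ^ 2 ∂Pr ≤ R) :
    ∀ᵐ ω ∂Pr, ∃ C, ∀ n, |∑ k ∈ Finset.range n, d k ω| ≤ C := by
  set S : ℕ → Ω → ℝ := fun n ω => ∑ k ∈ Finset.range n, d k ω with hS
  have hSm : ∀ n, StronglyMeasurable[ℱ n] (S n) := fun n => by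
    refine Finset.stronglyMeasurable_fun_sum _ fun k hk => ?_
    exact ((hmeas k).mono (ℱ.mono (Finset.mem_range.1 hk)) le_rfl).stronglyMeasurable
  have hSL : ∀ n, MemLp (S n) 2 Pr := fun n => memLp_finsetSum _ fun k _ => hL2 k
  have hsucc : ∀ n, S (n + 1) = S n + d n := fun n => by
    ext ω; simp [hS, Finset.sum_range_succ]
  have hSint : ∀ n, Integrable (S n) Pr := fun n => (hSL n).integrable one_le_two
  have hmart : Martingale S ℱ Pr := by
    refine martingale_nat hSm hSint fun n => ?_
    rw [hsucc]
    have h1 := condExp_add (hSint n) ((hL2 n).integrable one_le_two) (ℱ n)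
    rw [condExp_of_stronglyMeasurable (ℱ.le n) (hSm n) (hSint n)] at h1
    filter_upwards [h1, h0 n] with ω h1 h2
    rw [h1, Pi.add_apply, h2]
    simp
  -- Orthogonality of martingale increments.
  have hsq : ∀ n, ∫ ω, S n ω ^ 2 ∂Pr = ∑ k ∈ Finset.range n, ∫ ω, d k ω ^ 2 ∂Pr := by
    intro n
    induction n with
    | zero => simp [hS]
    | succ n ih =>
      have hSd : Integrable (S n * d n) Pr := (hSL n).integrable_mul (hL2 n)
      have hcross : ∫ ω, S n ω * d n ω ∂Pr = 0 := by
        rw [integral_mul_condExp (ℱ.le n) (hSm n) hSd ((hL2 n).integrable one_le_two)]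
        rw [integral_congr_ae (g := fun _ => (0 : ℝ))]
        · simp
        · filter_upwards [h0 n] with ω hω
          simp [hω]
      rw [Finset.sum_range_succ, ← ih]
      have e : ∀ ω, S (n + 1) ω ^ 2 = S n ω ^ 2 + 2 * (S n ω * d n ω) + d n ω ^ 2 := fun ω => by
        rw [hsucc]; simp only [Pi.add_apply]; ring
      have hSd' : Integrable (fun ω => 2 * (S n ω * d n ω)) Pr := hSd.const_mul 2
      simp_rw [e]
      have hS1 : Integrable (fun ω => S n ω ^ 2 + 2 * (S n ω * d n ω)) Pr :=
        (hSL n).integrable_sq.add hSd'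
      rw [integral_add hS1 (hL2 n).integrable_sq,
        integral_add (hSL n).integrable_sq hSd', integral_const_mul, hcross]
      ring
  -- The `L²` bound gives an `L¹` bound through `|x| ≤ 1 + x²`; the martingale then converges almost
  -- surely and is therefore bounded.
  have hbdd : ∀ n, eLpNorm (S n) 1 Pr ≤ ((1 + R).toNNReal : ℝ≥0∞) := by
    intro n
    rw [eLpNorm_one_eq_lintegral_enorm, ← ofReal_integral_norm_eq_lintegral_enorm (hSint n)]
    refine ENNReal.ofReal_le_ofReal ?_
    calc ∫ ω, ‖S n ω‖ ∂Pr ≤ ∫ ω, (1 + S n ω ^ 2) ∂Pr := by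
          refine integral_mono (hSint n).norm ((integrable_const 1).add (hSL n).integrable_sq)
            fun ω => ?_
          simp only [Real.norm_eq_abs]
          nlinarith [sq_abs (S n ω), sq_nonneg (|S n ω| - 1)]
      _ ≤ 1 + R := by
          rw [integral_add (integrable_const 1) (hSL n).integrable_sq, hsq]
          simpa using hR n
  filter_upwards [hmart.submartingale.exists_ae_tendsto_of_bdd hbdd] with ω ⟨c, hc⟩
  obtain ⟨C, hC⟩ := hc.abs.bddAbove_range
  exact ⟨C, fun n => hC ⟨n, rfl⟩⟩

omit [IsProbabilityMeasure Pr] in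
/-- A bound on set integrals gives a bound on weighted integrals. -/
theorem lintegral_mul_le_of_setLIntegral_le (hm : m ≤ mΩ)
    {W : Ω → ℝ≥0∞} (hW : Measurable W) {C : ℝ≥0∞}
    (h : ∀ A, MeasurableSet[m] A → ∫⁻ ω in A, W ω ∂Pr ≤ C * Pr A) {g : Ω → ℝ≥0∞}
    (hg : Measurable[m] g) : ∫⁻ ω, g ω * W ω ∂Pr ≤ C * ∫⁻ ω, g ω ∂Pr := by
  -- The hypothesis compares two measures on the smaller `σ`-algebra; integrating an `m`-measurable
  -- weight against both gives the claim without integrability conditions.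
  have hle : (Pr.withDensity W).trim hm ≤ (C • Pr).trim hm := by
    refine Measure.le_iff.2 fun A hA => ?_
    rw [trim_measurableSet_eq hm hA, trim_measurableSet_eq hm hA, withDensity_apply _ (hm A hA)]
    simpa using h A hA
  calc ∫⁻ ω, g ω * W ω ∂Pr = ∫⁻ ω, g ω ∂(Pr.withDensity W) := by
        rw [lintegral_withDensity_eq_lintegral_mul _ hW (hg.mono hm le_rfl)]
        simp [mul_comm]
    _ = ∫⁻ ω, g ω ∂((Pr.withDensity W).trim hm) := (lintegral_trim hm hg).symm
    _ ≤ ∫⁻ ω, g ω ∂((C • Pr).trim hm) := lintegral_mono' hle le_rfl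
    _ = C * ∫⁻ ω, g ω ∂Pr := by rw [lintegral_trim hm hg, lintegral_smul_measure, smul_eq_mul]

theorem condExp_le_of_setLIntegral_le (hm : m ≤ mΩ) {X : Ω → ℝ}
    (hX : Integrable X Pr) (h0 : ∀ ω, 0 ≤ X ω) {C : ℝ} (hC : 0 ≤ C)
    (h : ∀ A, MeasurableSet[m] A → ∫⁻ ω in A, ENNReal.ofReal (X ω) ∂Pr ≤ ENNReal.ofReal C * Pr A) :
    ∀ᵐ ω ∂Pr, (Pr[X | m]) ω ≤ C := by
  refine ae_of_ae_trim hm ?_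
  refine @ae_le_of_forall_setIntegral_le _ m (Pr.trim hm) _ _
    (integrable_condExp.trim hm stronglyMeasurable_condExp) (integrable_const C) fun A hA _ => ?_
  rw [← setIntegral_trim hm stronglyMeasurable_condExp hA, setIntegral_condExp hm hX hA,
    setIntegral_const, integral_eq_lintegral_of_nonneg_ae (Eventually.of_forall h0)
      hX.aestronglyMeasurable.restrict, smul_eq_mul, measureReal_def,
    trim_measurableSet_eq hm hA, mul_comm]
  have := ENNReal.toReal_mono (ENNReal.mul_ne_top ENNReal.ofReal_ne_top (measure_ne_top Pr A))
    (h A hA)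
  rwa [ENNReal.toReal_mul, ENNReal.toReal_ofReal hC] at this

end Martingale

/-! ### Noise with uniformly bounded conditional moments -/

section BoundedNoise

open scoped ENNReal

variable {Ω : Type*} {m mΩ : MeasurableSpace Ω} {Pr : Measure Ω} [IsProbabilityMeasure Pr]
  {ℱ : Filtration ℕ mΩ}

/-- A martingale difference sequence whose conditional moments of order `q` are bounded by `C`. -/
structure BoundedNoise (Pr : Measure Ω) (ℱ : Filtration ℕ mΩ) (w : ℕ → Ω → ℝ) (q C : ℝ) :
    Prop where
  meas : ∀ k, Measurable[ℱ (k + 1)] (w k)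
  center : ∀ k, Pr[w k | ℱ k] =ᵐ[Pr] 0
  moment : ∀ k A, MeasurableSet[ℱ k] A →
    ∫⁻ ω in A, ENNReal.ofReal (|w k ω| ^ q) ∂Pr ≤ ENNReal.ofReal C * Pr A
  nonneg : 0 ≤ C

namespace BoundedNoise

variable {w : ℕ → Ω → ℝ} {q C : ℝ}

omit [IsProbabilityMeasure Pr] in
theorem meas' (h : BoundedNoise Pr ℱ w q C) (k : ℕ) : Measurable (w k) :=
  (h.meas k).mono (ℱ.le _) le_rfl

theorem sq_le_one_add_rpow (hq : 2 ≤ q) (x : ℝ) : x ^ 2 ≤ 1 + |x| ^ q := by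
  rw [← sq_abs]
  rcases le_total |x| 1 with h | h
  · have := Real.rpow_nonneg (abs_nonneg x) q
    have := pow_le_one₀ (n := 2) (abs_nonneg x) h
    linarith
  · have := Real.rpow_le_rpow_of_exponent_le h hq
    rw [Real.rpow_two] at this
    linarith

omit [IsProbabilityMeasure Pr] in
theorem setLIntegral_sq_le (h : BoundedNoise Pr ℱ w q C) (hq : 2 ≤ q) (k : ℕ) {A : Set Ω}
    (hA : MeasurableSet[ℱ k] A) :
    ∫⁻ ω in A, ENNReal.ofReal (w k ω ^ 2) ∂Pr ≤ ENNReal.ofReal (1 + C) * Pr A := by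
  calc ∫⁻ ω in A, ENNReal.ofReal (w k ω ^ 2) ∂Pr
      ≤ ∫⁻ ω in A, (1 + ENNReal.ofReal (|w k ω| ^ q)) ∂Pr := by
        refine lintegral_mono fun ω => ?_
        rw [← ENNReal.ofReal_one, ← ENNReal.ofReal_add zero_le_one (by positivity)]
        exact ENNReal.ofReal_le_ofReal (sq_le_one_add_rpow hq _)
    _ = Pr A + ∫⁻ ω in A, ENNReal.ofReal (|w k ω| ^ q) ∂Pr := by
        rw [lintegral_add_left measurable_const]; simp
    _ ≤ Pr A + ENNReal.ofReal C * Pr A := by gcongr; exact h.moment k A hA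
    _ = _ := by
        rw [ENNReal.ofReal_add zero_le_one h.nonneg, add_mul, ENNReal.ofReal_one, one_mul]

theorem memLp (h : BoundedNoise Pr ℱ w q C) (hq : 2 ≤ q) (k : ℕ) : MemLp (w k) 2 Pr := by
  rw [memLp_two_iff_integrable_sq (h.meas' k).aestronglyMeasurable]
  refine ⟨((h.meas' k).pow_const 2).aestronglyMeasurable, ?_⟩
  rw [hasFiniteIntegral_iff_ofReal (Eventually.of_forall fun ω => sq_nonneg _)]
  have := h.setLIntegral_sq_le hq k MeasurableSet.univ
  rw [Measure.restrict_univ] at this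
  exact this.trans_lt (ENNReal.mul_lt_top ENNReal.ofReal_lt_top (measure_lt_top _ _))

omit [IsProbabilityMeasure Pr] in
theorem lintegral_mul_sq_le (h : BoundedNoise Pr ℱ w q C) (hq : 2 ≤ q) (k : ℕ) {g : Ω → ℝ≥0∞}
    (hg : Measurable[ℱ k] g) :
    ∫⁻ ω, g ω * ENNReal.ofReal (w k ω ^ 2) ∂Pr ≤ ENNReal.ofReal (1 + C) * ∫⁻ ω, g ω ∂Pr :=
  lintegral_mul_le_of_setLIntegral_le (ℱ.le k) ((h.meas' k).pow_const 2).ennreal_ofReal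
    (fun _ hA => h.setLIntegral_sq_le hq k hA) hg

omit [IsProbabilityMeasure Pr] in
theorem lintegral_mul_rpow_le (h : BoundedNoise Pr ℱ w q C) (k : ℕ) {g : Ω → ℝ≥0∞}
    (hg : Measurable[ℱ k] g) :
    ∫⁻ ω, g ω * ENNReal.ofReal (|w k ω| ^ q) ∂Pr ≤ ENNReal.ofReal C * ∫⁻ ω, g ω ∂Pr :=
  lintegral_mul_le_of_setLIntegral_le (ℱ.le k)
    ((measurable_norm.comp (h.meas' k)).pow_const q).ennreal_ofReal
    (fun A hA => h.moment k A hA) hg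

theorem condExp_sq_le (h : BoundedNoise Pr ℱ w q C) (hq : 2 ≤ q) (k : ℕ) :
    ∀ᵐ ω ∂Pr, (Pr[fun ω => w k ω ^ 2 | ℱ k]) ω ≤ 1 + C :=
  condExp_le_of_setLIntegral_le (ℱ.le k) (h.memLp hq k).integrable_sq (fun _ => sq_nonneg _)
    (by linarith [h.nonneg]) fun _ hA => h.setLIntegral_sq_le hq k hA

/-- Martingale transforms with square-summable bounded coefficients have bounded partial sums. -/
theorem ae_bdd_transform (h : BoundedNoise Pr ℱ w q C) (hq : 2 ≤ q) {g : ℕ → Ω → ℝ}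
    (hg : ∀ k, Measurable[ℱ k] (g k)) (hg1 : ∀ k ω, |g k ω| ≤ 1) {R : ℝ}
    (hR : ∀ n ω, ∑ k ∈ Finset.range n, g k ω ^ 2 ≤ R) :
    ∀ᵐ ω ∂Pr, ∃ K, ∀ n, |∑ k ∈ Finset.range n, g k ω * w k ω| ≤ K := by
  have hgm : ∀ k, Measurable (g k) := fun k => (hg k).mono (ℱ.le k) le_rfl
  have hL2 : ∀ k, MemLp (fun ω => g k ω * w k ω) 2 Pr := fun k => by
    refine (h.memLp hq k).mono ((hgm k).mul (h.meas' k)).aestronglyMeasurable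
      (Eventually.of_forall fun ω => ?_)
    rw [norm_mul]
    exact mul_le_of_le_one_left (norm_nonneg _) (hg1 k ω)
  have hR0 : 0 ≤ R := by
    obtain ⟨ω⟩ : Nonempty Ω := by
      by_contra hne
      rw [not_nonempty_iff] at hne
      exact IsProbabilityMeasure.ne_zero Pr (Subsingleton.elim _ _)
    simpa using hR 0 ω
  refine ae_bdd_sum_of_sum_sq_le (ℱ := ℱ) (R := (1 + C) * R) (fun k => ?_) hL2 (fun k => ?_)
    fun n => ?_
  · exact ((hg k).mono (ℱ.mono k.le_succ) le_rfl).mul (h.meas k)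
  · have := condExp_mul_of_stronglyMeasurable_left (hg k).stronglyMeasurable
      ((hL2 k).integrable one_le_two) ((h.memLp hq k).integrable one_le_two)
    filter_upwards [this, h.center k] with ω h1 h2
    have h1' : (Pr[fun ω => g k ω * w k ω | ℱ k]) ω = (g k * Pr[w k | ℱ k]) ω := h1
    rw [h1', Pi.mul_apply, h2]
    simp
  · have hC := h.nonneg
    have e : ∀ k, ENNReal.ofReal (∫ ω, (g k ω * w k ω) ^ 2 ∂Pr) ≤
        ENNReal.ofReal (1 + C) * ∫⁻ ω, ENNReal.ofReal (g k ω ^ 2) ∂Pr := fun k => by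
      rw [ofReal_integral_eq_lintegral_ofReal (hL2 k).integrable_sq
        (Eventually.of_forall fun _ => sq_nonneg _)]
      simp_rw [mul_pow, ENNReal.ofReal_mul (sq_nonneg (g k _))]
      exact h.lintegral_mul_sq_le hq k ((hg k).pow_const 2).ennreal_ofReal
    rw [← ENNReal.ofReal_le_ofReal_iff (by positivity),
      ENNReal.ofReal_sum_of_nonneg fun k _ => integral_nonneg fun _ => sq_nonneg _]
    calc _ ≤ ∑ k ∈ Finset.range n, ENNReal.ofReal (1 + C) * ∫⁻ ω, ENNReal.ofReal (g k ω ^ 2) ∂Pr :=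
          Finset.sum_le_sum fun k _ => e k
      _ = ENNReal.ofReal (1 + C) *
          ∫⁻ ω, ∑ k ∈ Finset.range n, ENNReal.ofReal (g k ω ^ 2) ∂Pr := by
          rw [← Finset.mul_sum, lintegral_finsetSum]
          exact fun k _ => ((hgm k).pow_const 2).ennreal_ofReal
      _ ≤ ENNReal.ofReal (1 + C) * ∫⁻ _ω, ENNReal.ofReal R ∂Pr := by
          gcongr with ω
          rw [← ENNReal.ofReal_sum_of_nonneg fun k _ => sq_nonneg _]
          exact ENNReal.ofReal_le_ofReal (hR n ω)
      _ = _ := by rw [lintegral_const, measure_univ, mul_one, ENNReal.ofReal_mul (by positivity)]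

/-- Let `B (k + 1) = 1 + ∑_{i ≤ k} f_i²`. The coefficients `f / B ^ (3/4)` are square-summable since
`3/2 > 1`, so their transform is bounded; Abel summation gives `∑ f w = O(B ^ (3/4))`, which is
below any multiple of `B` up to a constant. -/
theorem ae_noiseNegligible (h : BoundedNoise Pr ℱ w q C) (hq : 2 ≤ q) {f : ℕ → Ω → ℝ}
    (hf : ∀ k, Measurable[ℱ k] (f k)) :
    ∀ᵐ ω ∂Pr, NoiseNegligible (fun k => f k ω) fun k => w k ω := by
  set B : ℕ → Ω → ℝ := fun n ω => 1 + ∑ i ∈ Finset.range n, f i ω ^ 2 with hB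
  have hB1 : ∀ n ω, 1 ≤ B n ω := fun n ω =>
    le_add_of_nonneg_right (Finset.sum_nonneg fun i _ => sq_nonneg _)
  have hB0 : ∀ n ω, 0 < B n ω := fun n ω => one_pos.trans_le (hB1 n ω)
  have hBm : ∀ ω, Monotone fun n => B n ω := fun ω => monotone_nat_of_le_succ fun n => by
    simp only [hB, Finset.sum_range_succ]
    linarith [sq_nonneg (f n ω)]
  have hmeas : ∀ k, Measurable[ℱ k] (B (k + 1)) := fun k => by
    refine Measurable.const_add (Finset.measurable_fun_sum _ fun i hi => ?_) 1
    exact ((hf i).mono (ℱ.mono (Nat.lt_succ_iff.1 (Finset.mem_range.1 hi))) le_rfl).pow_const 2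
  have hfB : ∀ k ω, f k ω ^ 2 ≤ B (k + 1) ω := fun k ω => by
    simp only [hB, Finset.sum_range_succ]
    have : 0 ≤ ∑ i ∈ Finset.range k, f i ω ^ 2 := Finset.sum_nonneg fun i _ => sq_nonneg _
    linarith
  have hpow : ∀ n ω, (B n ω ^ (3 / 4 : ℝ)) ^ 2 = B n ω ^ (3 / 2 : ℝ) := fun n ω => by
    rw [← Real.rpow_natCast, ← Real.rpow_mul (hB0 n ω).le]
    norm_num
  -- Including `f k` in `B (k + 1)` keeps the coefficient measurable at time `k` and makes it at
  -- most `1` in absolute value.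
  have hbdd := h.ae_bdd_transform hq (g := fun k ω => f k ω / B (k + 1) ω ^ (3 / 4 : ℝ))
    (R := 1 / (3 / 2 - 1)) (fun k => (hf k).div ((hmeas k).pow_const _)) (fun k ω => ?_)
    fun n ω => ?_
  · filter_upwards [hbdd] with ω ⟨K, hK⟩ ε hε
    have hK0 : 0 ≤ K := (abs_nonneg _).trans (hK 0)
    obtain ⟨T, hT0, hT⟩ := exists_rpow_le_add_mul (δ := ε / (2 * K + 1)) (by positivity)
    refine ⟨2 * K * T + ε, fun n => ?_⟩
    have hab := abs_sum_mul_le (c := fun n => B n ω ^ (3 / 4 : ℝ))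
      (fun n => Real.rpow_nonneg (hB0 n ω).le _)
      (fun i j hij => Real.rpow_le_rpow (hB0 i ω).le (hBm ω hij) (by norm_num)) hK n
    have e : ∑ k ∈ Finset.range n, B (k + 1) ω ^ (3 / 4 : ℝ) *
        (f k ω / B (k + 1) ω ^ (3 / 4 : ℝ) * w k ω) = ∑ k ∈ Finset.range n, f k ω * w k ω := by
      refine Finset.sum_congr rfl fun k _ => ?_
      have := (Real.rpow_pos_of_pos (hB0 (k + 1) ω) (3 / 4 : ℝ)).ne'
      field_simp
    rw [e] at hab
    refine hab.trans ?_
    have h1 : 2 * K * B n ω ^ (3 / 4 : ℝ) ≤ 2 * K * (T + ε / (2 * K + 1) * B n ω) :=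
      mul_le_mul_of_nonneg_left (hT _ (hB0 n ω)) (by positivity)
    have h2 : 2 * K * (ε / (2 * K + 1)) ≤ ε := by
      rw [mul_div_assoc', div_le_iff₀ (by positivity)]
      nlinarith
    have h3 : 2 * K * (ε / (2 * K + 1)) * B n ω ≤ ε * B n ω :=
      mul_le_mul_of_nonneg_right h2 (hB0 n ω).le
    have h4 : ε * B n ω = ε + ε * ∑ k ∈ Finset.range n, f k ω ^ 2 := by simp only [hB]; ring
    linarith
  · have h1 : 0 < B (k + 1) ω ^ (3 / 4 : ℝ) := Real.rpow_pos_of_pos (hB0 _ _) _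
    rw [abs_div, abs_of_pos h1, div_le_one h1]
    refine abs_le_of_sq_le_sq ?_ h1.le |>.trans_eq' rfl
    rw [hpow]
    refine (hfB k ω).trans ?_
    exact Real.self_le_rpow_of_one_le (hB1 _ _) (by norm_num)
  · simp_rw [div_pow, hpow]
    exact sum_div_one_add_sum_rpow_le (fun k => sq_nonneg (f k ω)) (by norm_num) n

end BoundedNoise

end BoundedNoise

/-! ### Growth of weighted sums of squared noise -/

section SquareDominated

open scoped ENNReal

variable {Ω : Type*} {m mΩ : MeasurableSpace Ω} {Pr : Measure Ω} [IsProbabilityMeasure Pr]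
  {ℱ : Filtration ℕ mΩ}

/-- Centering does not increase the second moment. -/
theorem integral_sub_condExp_sq_le (hm : m ≤ mΩ) {X : Ω → ℝ} (hX : MemLp X 2 Pr) :
    ∫ ω, (X ω - (Pr[X | m]) ω) ^ 2 ∂Pr ≤ ∫ ω, X ω ^ 2 ∂Pr := by
  have hY : MemLp (Pr[X | m]) 2 Pr := hX.condExp one_le_two
  have hXY : Integrable (Pr[X | m] * X) Pr := hY.integrable_mul hX
  have hcross := integral_mul_condExp hm stronglyMeasurable_condExp hXY (hX.integrable one_le_two)
  have e : ∀ ω, (X ω - (Pr[X | m]) ω) ^ 2 =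
      X ω ^ 2 - 2 * ((Pr[X | m]) ω * X ω) + (Pr[X | m]) ω ^ 2 := fun ω => by ring
  have hXY' : Integrable (fun ω => 2 * ((Pr[X | m]) ω * X ω)) Pr := hXY.const_mul 2
  have h1 : Integrable (fun ω => X ω ^ 2 - 2 * ((Pr[X | m]) ω * X ω)) Pr :=
    hX.integrable_sq.sub hXY'
  simp_rw [e]
  rw [integral_add h1 hY.integrable_sq, integral_sub hX.integrable_sq hXY', integral_const_mul,
    hcross]
  have h2 : ∫ ω, (Pr[X | m]) ω * (Pr[X | m]) ω ∂Pr = ∫ ω, (Pr[X | m]) ω ^ 2 ∂Pr := by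
    simp_rw [sq]
  have h3 : 0 ≤ ∫ ω, (Pr[X | m]) ω ^ 2 ∂Pr := integral_nonneg fun ω => sq_nonneg _
  rw [h2]
  linarith

namespace BoundedNoise

variable {w : ℕ → Ω → ℝ} {q C : ℝ}

/-- Normalize to `z = α w² / B`, where `B` is `1` plus the running sum of `α`. Its moments of order
`p = q / 2 > 1` are summable, so eventually `z ≤ 1` and truncation at `1` changes nothing. As `p ≤
2`, the centered truncations form an `L²`-bounded martingale; Abel summation restores the weights
`B` at the cost `O(B)`, and the conditional means add at most `(1 + C) ∑ α`. -/
theorem ae_squareDominated (h : BoundedNoise Pr ℱ w q C) (hq : 2 < q) (hq4 : q ≤ 4)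
    {α : ℕ → Ω → ℝ} (hα : ∀ k, Measurable[ℱ k] (α k)) (hα0 : ∀ k ω, 0 ≤ α k ω)
    (hα1 : ∀ k ω, α k ω ≤ 1) :
    ∀ᵐ ω ∂Pr, SquareDominated (fun k => α k ω) fun k => w k ω := by
  set p := q / 2 with hp
  have hp1 : 1 < p := by rw [hp]; linarith
  have hp2 : p ≤ 2 := by rw [hp]; linarith
  have hp1' : 0 < p - 1 := by linarith
  have hC := h.nonneg
  set B : ℕ → Ω → ℝ := fun n ω => 1 + ∑ i ∈ Finset.range n, α i ω with hB
  have hB1 : ∀ n ω, 1 ≤ B n ω := fun n ω =>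
    le_add_of_nonneg_right (Finset.sum_nonneg fun i _ => hα0 i ω)
  have hB0 : ∀ n ω, 0 < B n ω := fun n ω => one_pos.trans_le (hB1 n ω)
  have hBm : ∀ ω, Monotone fun n => B n ω := fun ω => monotone_nat_of_le_succ fun n => by
    simp only [hB, Finset.sum_range_succ]
    linarith [hα0 n ω]
  have hBmeas : ∀ k, Measurable[ℱ k] (B (k + 1)) := fun k => by
    refine Measurable.const_add (Finset.measurable_fun_sum _ fun i hi => ?_) 1
    exact (hα i).mono (ℱ.mono (Nat.lt_succ_iff.1 (Finset.mem_range.1 hi))) le_rfl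
  set z : ℕ → Ω → ℝ := fun k ω => α k ω / B (k + 1) ω * w k ω ^ 2 with hz
  have hz0 : ∀ k ω, 0 ≤ z k ω := fun k ω =>
    mul_nonneg (div_nonneg (hα0 k ω) (hB0 _ ω).le) (sq_nonneg _)
  have hzmeas : ∀ k, Measurable[ℱ (k + 1)] (z k) := fun k =>
    (((hα k).div (hBmeas k)).mono (ℱ.mono k.le_succ) le_rfl).mul ((h.meas k).pow_const 2)
  have hzp : ∀ k ω, z k ω ^ p ≤ α k ω / B (k + 1) ω ^ p * |w k ω| ^ q := fun k ω => by
    have e : (w k ω ^ 2) ^ p = |w k ω| ^ q := by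
      rw [← sq_abs, ← Real.rpow_natCast, ← Real.rpow_mul (abs_nonneg _), hp]
      congr 1
      push_cast
      ring
    rw [hz, Real.mul_rpow (div_nonneg (hα0 k ω) (hB0 _ ω).le) (sq_nonneg _), e,
      Real.div_rpow (hα0 k ω) (hB0 _ ω).le]
    refine mul_le_mul_of_nonneg_right ?_ (by positivity)
    refine div_le_div_of_nonneg_right ?_ (Real.rpow_nonneg (hB0 _ ω).le _)
    exact Real.rpow_le_self_of_le_one (hα0 k ω) (hα1 k ω) hp1.le
  -- the `p`-th moments of `z` are summable
  have hmom : ∀ n, ∑ k ∈ Finset.range n, ∫⁻ ω, ENNReal.ofReal (z k ω ^ p) ∂Pr ≤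
      ENNReal.ofReal (C * (1 / (p - 1))) := fun n => by
    have hgm : ∀ k, Measurable[ℱ k] fun ω => ENNReal.ofReal (α k ω / B (k + 1) ω ^ p) := fun k =>
      ((hα k).div ((hBmeas k).pow_const p)).ennreal_ofReal
    calc ∑ k ∈ Finset.range n, ∫⁻ ω, ENNReal.ofReal (z k ω ^ p) ∂Pr
        ≤ ∑ k ∈ Finset.range n, ENNReal.ofReal C *
          ∫⁻ ω, ENNReal.ofReal (α k ω / B (k + 1) ω ^ p) ∂Pr := by
          refine Finset.sum_le_sum fun k _ => le_trans ?_ (h.lintegral_mul_rpow_le k (hgm k))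
          refine lintegral_mono fun ω => ?_
          rw [← ENNReal.ofReal_mul (div_nonneg (hα0 k ω) (Real.rpow_nonneg (hB0 _ ω).le _))]
          exact ENNReal.ofReal_le_ofReal (hzp k ω)
      _ = ENNReal.ofReal C *
          ∫⁻ ω, ∑ k ∈ Finset.range n, ENNReal.ofReal (α k ω / B (k + 1) ω ^ p) ∂Pr := by
          rw [← Finset.mul_sum, lintegral_finsetSum]
          exact fun k _ => (hgm k).mono (ℱ.le k) le_rfl
      _ ≤ ENNReal.ofReal C * ∫⁻ _ω, ENNReal.ofReal (1 / (p - 1)) ∂Pr := by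
          gcongr with ω
          rw [← ENNReal.ofReal_sum_of_nonneg fun k _ =>
            div_nonneg (hα0 k ω) (Real.rpow_nonneg (hB0 _ ω).le _)]
          exact ENNReal.ofReal_le_ofReal
            (sum_div_one_add_sum_rpow_le (fun k => hα0 k ω) hp1 n)
      _ = _ := by rw [lintegral_const, measure_univ, mul_one, ENNReal.ofReal_mul hC]
  have hzm : ∀ k, Measurable (z k) := fun k => (hzmeas k).mono (ℱ.le _) le_rfl
  -- hence `z k ≤ 1` for all large `k`
  have hlarge : ∀ᵐ ω ∂Pr, ∀ᶠ k in atTop, z k ω ≤ 1 := by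
    -- The series of `z ^ p` has finite expectation, so it converges almost surely and its terms
    -- tend to `0`.
    have hts : ∫⁻ ω, ∑' k, ENNReal.ofReal (z k ω ^ p) ∂Pr ≠ ∞ := by
      rw [lintegral_tsum fun k => ((hzm k).pow_const p).ennreal_ofReal.aemeasurable]
      refine ne_top_of_le_ne_top (ENNReal.ofReal_ne_top (r := C * (1 / (p - 1)))) ?_
      exact ENNReal.tsum_le_of_sum_range_le hmom
    filter_upwards [ae_lt_top' (AEMeasurable.tsum fun k =>
      ((hzm k).pow_const p).ennreal_ofReal.aemeasurable) hts] with ω hω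
    have ht := ENNReal.tendsto_atTop_zero_of_tsum_ne_top hω.ne
    filter_upwards [ht.eventually (gt_mem_nhds (by norm_num : (0 : ℝ≥0∞) < 1))] with k hk
    by_contra! hgt
    have := Real.one_le_rpow hgt.le (by linarith : (0 : ℝ) ≤ p)
    exact absurd hk (not_lt.2 (ENNReal.one_le_ofReal.2 this))
  -- truncated and centered variables
  set t : ℕ → Ω → ℝ := fun k ω => min (z k ω) 1 with ht
  have ht0 : ∀ k ω, 0 ≤ t k ω := fun k ω => le_min (hz0 k ω) zero_le_one
  have htm : ∀ k, Measurable[ℱ (k + 1)] (t k) := fun k => (hzmeas k).min measurable_const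
  have htL : ∀ k, MemLp (t k) 2 Pr := fun k =>
    MemLp.of_bound ((htm k).mono (ℱ.le _) le_rfl).aestronglyMeasurable 1
      (Eventually.of_forall fun ω => by
        rw [Real.norm_of_nonneg (ht0 k ω)]; exact min_le_right _ _)
  -- Below the truncation level this uses `p ≤ 2`, that is `q ≤ 4`.
  have htsq : ∀ k ω, t k ω ^ 2 ≤ z k ω ^ p := fun k ω => by
    rcases le_total (z k ω) 1 with h1 | h1
    · simp only [ht, min_eq_left h1]
      rw [← Real.rpow_two]
      exact Real.rpow_le_rpow_of_exponent_ge' (hz0 k ω) h1 (by linarith) hp2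
    · simp only [ht, min_eq_right h1, one_pow]
      exact Real.one_le_rpow h1 (by linarith)
  have hd := ae_bdd_sum_of_sum_sq_le (ℱ := ℱ) (Pr := Pr)
    (d := fun k ω => t k ω - (Pr[t k | ℱ k]) ω) (R := C * (1 / (p - 1)))
    (fun k => (htm k).sub
      (stronglyMeasurable_condExp.measurable.mono (ℱ.mono k.le_succ) le_rfl))
    (fun k => (htL k).sub ((htL k).condExp one_le_two)) (fun k => ?_) fun n => ?_
  -- The weight `α / B` is known at time `k`, so only the conditional second moment of the noise
  -- enters.
  · have hcond : ∀ᵐ ω ∂Pr, ∀ k, (Pr[t k | ℱ k]) ω ≤ (1 + C) * (α k ω / B (k + 1) ω) := by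
      rw [ae_all_iff]
      intro k
      have hgm : Measurable[ℱ k] fun ω => α k ω / B (k + 1) ω := (hα k).div (hBmeas k)
      have hg1 : ∀ ω, α k ω / B (k + 1) ω ≤ 1 := fun ω =>
        (div_le_one (hB0 _ ω)).2 ((hα1 k ω).trans (hB1 _ ω))
      have hg0 : ∀ ω, 0 ≤ α k ω / B (k + 1) ω := fun ω => div_nonneg (hα0 k ω) (hB0 _ ω).le
      have hsq := (h.memLp hq.le k).integrable_sq
      have hzi : Integrable (z k) Pr := by
        refine hsq.mono (hzm k).aestronglyMeasurable (Eventually.of_forall fun ω => ?_)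
        rw [hz, norm_mul, Real.norm_of_nonneg (hg0 ω)]
        exact mul_le_of_le_one_left (norm_nonneg _) (hg1 ω)
      have h1 := condExp_mono (m := ℱ k) ((htL k).integrable one_le_two) hzi
        (Eventually.of_forall fun ω => min_le_left (z k ω) 1)
      have h2 := condExp_mul_of_stronglyMeasurable_left hgm.stronglyMeasurable hzi hsq
      filter_upwards [h1, h2, h.condExp_sq_le hq.le k] with ω h1 h2 h3
      refine h1.trans ?_
      have h2' : (Pr[z k | ℱ k]) ω =
        α k ω / B (k + 1) ω * (Pr[fun ω => w k ω ^ 2 | ℱ k]) ω := h2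
      rw [h2', mul_comm]
      exact mul_le_mul_of_nonneg_right h3 (hg0 ω)
    filter_upwards [hd, hlarge, hcond] with ω ⟨K, hK⟩ hl hc
    obtain ⟨N, hN⟩ := eventually_atTop.1 hl
    have hK0 : 0 ≤ K := (abs_nonneg _).trans (hK 0)
    have hq0 : ∀ k, 0 ≤ α k ω * w k ω ^ 2 := fun k => mul_nonneg (hα0 k ω) (sq_nonneg _)
    -- The finitely many times at which the truncation may act contribute only a path-dependent
    -- constant.
    set Q := ∑ k ∈ Finset.range N, α k ω * w k ω ^ 2
    have hQ : 0 ≤ Q := Finset.sum_nonneg fun k _ => hq0 k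
    refine ⟨Q + 2 * K + (1 + C), fun n => ?_⟩
    have h1 : ∀ k, B (k + 1) ω * z k ω = α k ω * w k ω ^ 2 := fun k => by
      have := (hB0 (k + 1) ω).ne'
      simp only [hz]
      field_simp
    have h2 : ∑ k ∈ Finset.range n, α k ω * w k ω ^ 2 ≤
        Q + ∑ k ∈ Finset.range n, B (k + 1) ω * t k ω := by
      induction n with
      | zero => simpa using hQ
      | succ n ih =>
        rw [Finset.sum_range_succ _ n, Finset.sum_range_succ _ n]
        rcases lt_or_ge n N with hn | hn
        · have h3 : ∑ k ∈ Finset.range n, α k ω * w k ω ^ 2 + α n ω * w n ω ^ 2 ≤ Q := by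
            rw [← Finset.sum_range_succ]
            exact Finset.sum_le_sum_of_subset_of_nonneg
              (Finset.range_subset_range.2 hn) fun k _ _ => hq0 k
          have h4 : 0 ≤ ∑ k ∈ Finset.range n, B (k + 1) ω * t k ω :=
            Finset.sum_nonneg fun k _ => mul_nonneg (hB0 _ ω).le (ht0 k ω)
          have h5 := mul_nonneg (hB0 (n + 1) ω).le (ht0 n ω)
          linarith
        · have h3 : t n ω = z n ω := min_eq_left (hN n hn)
          rw [h3, h1]
          linarith
    have h3 := le_of_abs_le
      (abs_sum_mul_le (c := fun n => B n ω) (fun n => (hB0 n ω).le) (hBm ω) hK n)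
    have h4 : ∑ k ∈ Finset.range n, B (k + 1) ω * (Pr[t k | ℱ k]) ω ≤
        (1 + C) * ∑ k ∈ Finset.range n, α k ω := by
      rw [Finset.mul_sum]
      refine Finset.sum_le_sum fun k _ => ?_
      refine (mul_le_mul_of_nonneg_left (hc k) (hB0 _ ω).le).trans (le_of_eq ?_)
      have := (hB0 (k + 1) ω).ne'
      field_simp
    have h5 : ∑ k ∈ Finset.range n, B (k + 1) ω * t k ω =
        ∑ k ∈ Finset.range n, B (k + 1) ω * (t k ω - (Pr[t k | ℱ k]) ω) +
        ∑ k ∈ Finset.range n, B (k + 1) ω * (Pr[t k | ℱ k]) ω := by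
      rw [← Finset.sum_add_distrib]
      exact Finset.sum_congr rfl fun k _ => by ring
    have h6 : Q ≤ Q * B n ω := le_mul_of_one_le_right hQ (hB1 n ω)
    have h7 : (1 + C) * ∑ k ∈ Finset.range n, α k ω ≤ (1 + C) * B n ω :=
      mul_le_mul_of_nonneg_left (by simp [hB]) (by linarith)
    have h8 : (Q + 2 * K + (1 + C)) * B n ω = Q * B n ω + 2 * K * B n ω + (1 + C) * B n ω := by
      ring
    change _ ≤ (Q + 2 * K + (1 + C)) * B n ω
    linarith
  · have h1 := condExp_sub ((htL k).integrable one_le_two) (integrable_condExp (m := ℱ k)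
      (f := t k)) (ℱ k)
    have h2 : Pr[Pr[t k | ℱ k] | ℱ k] = Pr[t k | ℱ k] :=
      condExp_of_stronglyMeasurable (ℱ.le k) stronglyMeasurable_condExp integrable_condExp
    rw [h2, sub_self] at h1
    exact h1
  · rw [← ENNReal.ofReal_le_ofReal_iff (by positivity),
      ENNReal.ofReal_sum_of_nonneg fun k _ => integral_nonneg fun _ => sq_nonneg _]
    refine le_trans (Finset.sum_le_sum fun k _ => ?_) (hmom n)
    refine (ENNReal.ofReal_le_ofReal (integral_sub_condExp_sq_le (ℱ.le k) (htL k))).trans ?_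
    rw [ofReal_integral_eq_lintegral_ofReal (htL k).integrable_sq
      (Eventually.of_forall fun _ => sq_nonneg _)]
    exact lintegral_mono fun ω => ENNReal.ofReal_le_ofReal (htsq k ω)

end BoundedNoise

end SquareDominated

/-! ### Almost sure measurability with respect to a sub-`σ`-algebra -/

section AEM

variable {Ω : Type*} {m mΩ : MeasurableSpace Ω} {Pr : Measure Ω} {β γ δ : Type*}
  [MeasurableSpace β] [MeasurableSpace γ] [MeasurableSpace δ]

/-- `f` is almost everywhere equal to an `m`-measurable function. -/
def AEM (m : MeasurableSpace Ω) {mΩ : MeasurableSpace Ω} (Pr : Measure Ω) (f : Ω → β) : Prop :=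
  ∃ g, Measurable[m] g ∧ f =ᵐ[Pr] g

namespace AEM

theorem of_measurable {f : Ω → β} (h : Measurable[m] f) : AEM m Pr f := ⟨f, h, EventuallyEq.rfl⟩

theorem const (c : β) : AEM m Pr fun _ : Ω => c := of_measurable measurable_const

theorem congr {f g : Ω → β} (h : AEM m Pr f) (hfg : f =ᵐ[Pr] g) : AEM m Pr g := by
  obtain ⟨f', hf', h'⟩ := h
  exact ⟨f', hf', hfg.symm.trans h'⟩

theorem mono {m' : MeasurableSpace Ω} (hm : m ≤ m') {f : Ω → β} (h : AEM m Pr f) :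
    AEM m' Pr f := by
  obtain ⟨f', hf', h'⟩ := h
  exact ⟨f', hf'.mono hm le_rfl, h'⟩

theorem map {f : Ω → β} (h : AEM m Pr f) {φ : β → γ} (hφ : Measurable φ) :
    AEM m Pr fun ω => φ (f ω) := by
  obtain ⟨f', hf', h'⟩ := h
  exact ⟨fun ω => φ (f' ω), hφ.comp hf', h'.mono fun ω hω => by simp only [hω]⟩

theorem prodMk {f : Ω → β} {g : Ω → γ} (hf : AEM m Pr f) (hg : AEM m Pr g) :
    AEM m Pr fun ω => (f ω, g ω) := by
  obtain ⟨f', hf', h'⟩ := hf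
  obtain ⟨g', hg', h''⟩ := hg
  refine ⟨fun ω => (f' ω, g' ω), hf'.prodMk hg', ?_⟩
  filter_upwards [h', h''] with ω h1 h2
  rw [h1, h2]

theorem map₂ {f : Ω → β} {g : Ω → γ} (hf : AEM m Pr f) (hg : AEM m Pr g) {φ : β → γ → δ}
    (hφ : Measurable fun p : β × γ => φ p.1 p.2) : AEM m Pr fun ω => φ (f ω) (g ω) :=
  (hf.prodMk hg).map hφ

theorem add {f g : Ω → ℝ} (hf : AEM m Pr f) (hg : AEM m Pr g) : AEM m Pr fun ω => f ω + g ω :=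
  hf.map₂ hg (φ := fun x y => x + y) (by fun_prop)

theorem sub {f g : Ω → ℝ} (hf : AEM m Pr f) (hg : AEM m Pr g) : AEM m Pr fun ω => f ω - g ω :=
  hf.map₂ hg (φ := fun x y => x - y) (by fun_prop)

theorem mul {f g : Ω → ℝ} (hf : AEM m Pr f) (hg : AEM m Pr g) : AEM m Pr fun ω => f ω * g ω :=
  hf.map₂ hg (φ := fun x y => x * y) (by fun_prop)

theorem div {f g : Ω → ℝ} (hf : AEM m Pr f) (hg : AEM m Pr g) : AEM m Pr fun ω => f ω / g ω :=
  hf.map₂ hg (φ := fun x y => x / y) (by fun_prop)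

/-- The limsup is measurable everywhere and agrees with the limit wherever the latter exists, so no
convergence of the chosen versions is required off a null set. -/
theorem limit {f : ℕ → Ω → ℝ} {g : Ω → ℝ} (hf : ∀ n, AEM m Pr (f n))
    (hlim : ∀ᵐ ω ∂Pr, Tendsto (fun n => f n ω) atTop (𝓝 (g ω))) : AEM m Pr g := by
  choose f' hf' h' using hf
  refine ⟨fun ω => limsup (fun n => f' n ω) atTop, Measurable.limsup hf', ?_⟩
  filter_upwards [hlim, ae_all_iff.2 h'] with ω h1 h2
  simp_rw [h2] at h1
  exact h1.limsup_eq.symm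

theorem iInf {ι : Type*} [Countable ι] {f : ι → Ω → ℝ} (hf : ∀ i, AEM m Pr (f i)) :
    AEM m Pr fun ω => ⨅ i, f i ω := by
  choose f' hf' h' using hf
  refine ⟨fun ω => ⨅ i, f' i ω, Measurable.iInf hf', ?_⟩
  filter_upwards [ae_all_iff.2 h'] with ω h2
  simp_rw [h2]

theorem iSup {ι : Type*} [Countable ι] {f : ι → Ω → ℝ} (hf : ∀ i, AEM m Pr (f i)) :
    AEM m Pr fun ω => ⨆ i, f i ω := by
  choose f' hf' h' using hf
  refine ⟨fun ω => ⨆ i, f' i ω, Measurable.iSup hf', ?_⟩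
  filter_upwards [ae_all_iff.2 h'] with ω h2
  simp_rw [h2]

end AEM

/-- The random function `g` agrees almost surely with a jointly measurable one. -/
def HasJointVersion (m : MeasurableSpace Ω) {mΩ : MeasurableSpace Ω} (Pr : Measure Ω)
    (g : Ω → ℝ → ℝ) : Prop :=
  ∃ H : Ω × ℝ → ℝ, Measurable[m.prod inferInstance] H ∧ ∀ᵐ ω ∂Pr, ∀ x, H (ω, x) = g ω x

theorem tendsto_floor_mul_div (x : ℝ) :
    Tendsto (fun n : ℕ => (⌊((n : ℝ) + 1) * x⌋ : ℝ) / ((n : ℝ) + 1)) atTop (𝓝 x) := by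
  have h1 : Tendsto (fun n : ℕ => x - 1 / ((n : ℝ) + 1)) atTop (𝓝 x) := by
    simpa using tendsto_const_nhds.sub (tendsto_one_div_add_atTop_nhds_zero_nat (𝕜 := ℝ))
  refine tendsto_of_tendsto_of_tendsto_of_le_of_le h1 tendsto_const_nhds (fun n => ?_) fun n => ?_
  · have hn : (0 : ℝ) < (n : ℝ) + 1 := by positivity
    have := Int.lt_floor_add_one (((n : ℝ) + 1) * x)
    simp only
    rw [sub_le_iff_le_add, ← add_div, le_div_iff₀ hn]
    linarith
  · have hn : (0 : ℝ) < (n : ℝ) + 1 := by positivity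
    have := Int.floor_le (((n : ℝ) + 1) * x)
    simp only
    rw [div_le_iff₀ hn]
    linarith

/-- The values of `g` are known up to a null set that depends on `x`. Only countably many rational
points are sampled, through rounding of `x` to the grid of mesh `1 / (n + 1)`, and continuity
recovers `g` at every `x` off one null set. -/
theorem hasJointVersion_of_continuous {g : Ω → ℝ → ℝ} (hg : ∀ x, AEM m Pr fun ω => g ω x)
    (hc : ∀ᵐ ω ∂Pr, Continuous (g ω)) : HasJointVersion m Pr g := by
  choose G' hG' h' using fun (j : ℤ) (n : ℕ) => hg ((j : ℝ) / ((n : ℝ) + 1))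
  refine ⟨fun p => limsup (fun n : ℕ => G' ⌊((n : ℝ) + 1) * p.2⌋ n p.1) atTop,
    Measurable.limsup fun n => ?_, ?_⟩
  · have h1 : Measurable[m.prod inferInstance] fun p : Ω × ℤ => G' p.2 n p.1 :=
      @measurable_from_prod_countable_left _ _ _ m _ _ _ _ _ fun j => hG' j n
    have h2 : Measurable fun x : ℝ => ⌊((n : ℝ) + 1) * x⌋ := by fun_prop
    have h3 : @Measurable _ _ (m.prod inferInstance) (m.prod inferInstance)
        fun p : Ω × ℝ => (p.1, ⌊((n : ℝ) + 1) * p.2⌋) :=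
      (@measurable_fst _ _ m _).prodMk (h2.comp (@measurable_snd _ _ m _))
    exact h1.comp h3
  · filter_upwards [hc, ae_all_iff.2 fun j => ae_all_iff.2 fun n => h' j n] with ω h1 h2 x
    have h3 := (h1.tendsto x).comp (tendsto_floor_mul_div x)
    refine Tendsto.limsup_eq (h3.congr fun n => ?_)
    exact h2 _ n

namespace HasJointVersion

variable {g : Ω → ℝ → ℝ}

theorem comp (h : HasJointVersion m Pr g) {X : Ω → ℝ} (hX : AEM m Pr X) :
    AEM m Pr fun ω => g ω (X ω) := by
  obtain ⟨H, hH, h⟩ := h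
  obtain ⟨X', hX', h'⟩ := hX
  refine ⟨fun ω => H (ω, X' ω), hH.comp (measurable_id.prodMk hX'), ?_⟩
  filter_upwards [h, h'] with ω h1 h2
  rw [h1, h2]

/-- The derivative is the limit of difference quotients along the sequence `1 / (n + 1)`. -/
theorem deriv_comp (h : HasJointVersion m Pr g) (hd : ∀ᵐ ω ∂Pr, Differentiable ℝ (g ω))
    {X : Ω → ℝ} (hX : AEM m Pr X) : AEM m Pr fun ω => deriv (g ω) (X ω) := by
  refine AEM.limit (f := fun n ω => ((1 / ((n : ℝ) + 1))⁻¹) *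
    (g ω (X ω + 1 / ((n : ℝ) + 1)) - g ω (X ω))) (fun n => ?_) ?_
  · exact (AEM.const _).mul ((h.comp (hX.add (AEM.const _))).sub (h.comp hX))
  · filter_upwards [hd] with ω hω
    have h1 := ((hω (X ω)).hasDerivAt).tendsto_slope_zero
    have h2 : Tendsto (fun n : ℕ => 1 / ((n : ℝ) + 1)) atTop (𝓝[≠] 0) :=
      tendsto_nhdsWithin_iff.2 ⟨tendsto_one_div_add_atTop_nhds_zero_nat,
        Eventually.of_forall fun n => by
          have : (0 : ℝ) < 1 / ((n : ℝ) + 1) := by positivity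
          exact this.ne'⟩
    exact h1.comp h2

end HasJointVersion

end AEM

/-! ### Measurability of the extreme slopes -/

section Slopes

/-- A parametrization of `[-M, M]` by the real line. -/
noncomputable def clip (M s : ℝ) : ℝ := max (-1) (min 1 s) * M

theorem continuous_clip (M : ℝ) : Continuous (clip M) := by
  unfold clip; fun_prop

theorem range_clip {M : ℝ} (hM : 0 ≤ M) : Set.range (clip M) = {x | |x| ≤ M} := by
  ext x
  simp only [Set.mem_range, Set.mem_ofPred_eq]
  constructor
  · rintro ⟨s, rfl⟩
    have h1 : -1 ≤ max (-1) (min 1 s) := le_max_left _ _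
    have h2 : max (-1) (min 1 s) ≤ 1 := max_le (by norm_num) (min_le_left _ _)
    rw [clip, abs_mul, abs_of_nonneg hM]
    exact mul_le_of_le_one_left hM (abs_le.2 ⟨h1, h2⟩)
  · intro hx
    rcases hM.eq_or_lt with h0 | h0
    · exact ⟨0, by rw [← h0] at hx; rw [abs_nonpos_iff.1 hx, clip, ← h0, mul_zero]⟩
    · refine ⟨x / M, ?_⟩
      obtain ⟨h1, h2⟩ := abs_le.1 hx
      have h3 : x / M ≤ 1 := (div_le_one h0).2 h2
      have h4 : -1 ≤ x / M := (le_div_iff₀ h0).2 (by linarith)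
      rw [clip, min_eq_right h3, max_eq_right h4, div_mul_cancel₀ _ h0.ne']

variable {g : ℝ → ℝ} {K M g₁ g₂ ρ : ℝ}

/-- The derivative is Lipschitz only on `|x| ≤ K`; composing with `clip` stays inside and yields
continuity on the whole line. -/
theorem continuous_deriv_clip (hM0 : 0 ≤ M) (hMK : M ≤ K)
    (hL : ∀ x x', |x| ≤ K → |x'| ≤ K → |deriv g x - deriv g x'| ≤ ρ * |x - x'|) :
    Continuous fun s => deriv g (clip M s) := by
  have hmem : ∀ s, |clip M s| ≤ K := fun s => by
    have : clip M s ∈ {x | |x| ≤ M} := range_clip hM0 ▸ ⟨s, rfl⟩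
    exact le_trans this hMK
  refine continuous_iff_continuousAt.2 fun s => ?_
  rw [ContinuousAt, tendsto_iff_norm_sub_tendsto_zero]
  have h1 : Tendsto (fun t => ρ * |clip M t - clip M s|) (𝓝 s) (𝓝 0) := by
    have : Continuous fun t => ρ * |clip M t - clip M s| := by
      have := continuous_clip M
      fun_prop
    simpa using this.tendsto s
  exact squeeze_zero (fun _ => norm_nonneg _) (fun t => hL _ _ (hmem t) (hmem s)) h1

/-- The interval `[-M, M]` is random in the application. Parametrizing it by a fixed line and using
density of the rationals turns the infimum into one over an index set that is countable and
independent of `M`. -/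
theorem slopeInf_eq_iInf (hM0 : 0 ≤ M) (hMK : M ≤ K)
    (hb : ∀ x, |x| ≤ K → g₁ ≤ deriv g x ∧ deriv g x ≤ g₂)
    (hL : ∀ x x', |x| ≤ K → |x'| ≤ K → |deriv g x - deriv g x'| ≤ ρ * |x - x'|) :
    slopeInf g M = ⨅ r : ℚ, deriv g (clip M r) := by
  rw [slopeInf, ← range_clip hM0, ← Set.range_comp]
  refine le_antisymm (le_ciInf fun r => csInf_le ?_ ⟨r, rfl⟩)
    (le_csInf (Set.range_nonempty _) ?_)
  · refine ⟨g₁, ?_⟩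
    rintro _ ⟨s, rfl⟩
    have : clip M s ∈ {x | |x| ≤ M} := range_clip hM0 ▸ ⟨s, rfl⟩
    exact (hb _ (le_trans this hMK)).1
  · have hbdd : BddBelow (Set.range fun r : ℚ => deriv g (clip M r)) := by
      refine ⟨g₁, ?_⟩
      rintro _ ⟨s, rfl⟩
      have : clip M s ∈ {x | |x| ≤ M} := range_clip hM0 ▸ ⟨s, rfl⟩
      exact (hb _ (le_trans this hMK)).1
    rintro _ ⟨s, rfl⟩
    have hcl : IsClosed {s | (⨅ r : ℚ, deriv g (clip M r)) ≤ deriv g (clip M s)} :=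
      isClosed_le continuous_const (continuous_deriv_clip hM0 hMK hL)
    have hsub : Set.range ((↑) : ℚ → ℝ) ⊆ {s | (⨅ r : ℚ, deriv g (clip M r)) ≤ deriv g (clip M s)} := by
      rintro _ ⟨r, rfl⟩
      exact ciInf_le hbdd r
    exact closure_minimal hsub hcl (Rat.denseRange_cast s)

theorem slopeSup_eq_iSup (hM0 : 0 ≤ M) (hMK : M ≤ K)
    (hb : ∀ x, |x| ≤ K → g₁ ≤ deriv g x ∧ deriv g x ≤ g₂)
    (hL : ∀ x x', |x| ≤ K → |x'| ≤ K → |deriv g x - deriv g x'| ≤ ρ * |x - x'|) :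
    slopeSup g M = ⨆ r : ℚ, deriv g (clip M r) := by
  rw [slopeSup, ← range_clip hM0, ← Set.range_comp]
  refine le_antisymm (csSup_le (Set.range_nonempty _) ?_)
    (ciSup_le fun r => le_csSup ?_ ⟨r, rfl⟩)
  · have hbdd : BddAbove (Set.range fun r : ℚ => deriv g (clip M r)) := by
      refine ⟨g₂, ?_⟩
      rintro _ ⟨s, rfl⟩
      have : clip M s ∈ {x | |x| ≤ M} := range_clip hM0 ▸ ⟨s, rfl⟩
      exact (hb _ (le_trans this hMK)).2
    rintro _ ⟨s, rfl⟩
    have hcl : IsClosed {s | deriv g (clip M s) ≤ ⨆ r : ℚ, deriv g (clip M r)} :=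
      isClosed_le (continuous_deriv_clip hM0 hMK hL) continuous_const
    have hsub : Set.range ((↑) : ℚ → ℝ) ⊆ {s | deriv g (clip M s) ≤ ⨆ r : ℚ, deriv g (clip M r)} := by
      rintro _ ⟨r, rfl⟩
      exact le_ciSup hbdd r
    exact closure_minimal hsub hcl (Rat.denseRange_cast s)
  · refine ⟨g₂, ?_⟩
    rintro _ ⟨s, rfl⟩
    have : clip M s ∈ {x | |x| ≤ M} := range_clip hM0 ▸ ⟨s, rfl⟩
    exact (hb _ (le_trans this hMK)).2

end Slopes

/-! ### Measurability of the algorithm -/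

section MatrixMeasurable

variable {m : ℕ}

instance : MeasurableSpace (Matrix (Fin m) (Fin m) ℝ) :=
  inferInstanceAs (MeasurableSpace (Fin m → Fin m → ℝ))

instance : BorelSpace (Matrix (Fin m) (Fin m) ℝ) :=
  inferInstanceAs (BorelSpace (Fin m → Fin m → ℝ))

instance : SecondCountableTopology (Matrix (Fin m) (Fin m) ℝ) :=
  inferInstanceAs (SecondCountableTopology (Fin m → Fin m → ℝ))

theorem measurable_quad :
    Measurable fun p : Matrix (Fin m) (Fin m) ℝ × EuclideanSpace ℝ (Fin m) => quad p.1 p.2 :=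
  continuous_quad.measurable

theorem continuous_mulE :
    Continuous fun p : Matrix (Fin m) (Fin m) ℝ × EuclideanSpace ℝ (Fin m) => mulE p.1 p.2 := by
  unfold mulE
  have h2 : Continuous fun p : Matrix (Fin m) (Fin m) ℝ × EuclideanSpace ℝ (Fin m) => p.2.ofLp :=
    (PiLp.continuous_ofLp 2 _).comp continuous_snd
  exact (PiLp.continuous_toLp 2 _).comp (continuous_fst.matrix_mulVec h2)

theorem continuous_outer : Continuous fun x : EuclideanSpace ℝ (Fin m) => outer x := by
  unfold outer
  have h : Continuous fun x : EuclideanSpace ℝ (Fin m) => x.ofLp := PiLp.continuous_ofLp 2 _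
  exact h.matrix_vecMulVec h

theorem continuous_rank_one_update :
    Continuous fun p : ℝ × EuclideanSpace ℝ (Fin m) × Matrix (Fin m) (Fin m) ℝ =>
      p.2.2 - p.1 • (p.2.2 * outer p.2.1 * p.2.2) := by
  have h : Continuous fun p : ℝ × EuclideanSpace ℝ (Fin m) × Matrix (Fin m) (Fin m) ℝ =>
      outer p.2.1 := continuous_outer.comp (by fun_prop)
  have h2 : Continuous fun p : ℝ × EuclideanSpace ℝ (Fin m) × Matrix (Fin m) (Fin m) ℝ =>
      p.2.2 := by fun_prop
  exact h2.sub (continuous_fst.smul ((h2.matrix_mul h).matrix_mul h2))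

/-- The adjugate formula holds at singular matrices too, where both sides vanish, so the
discontinuity there does no harm. -/
theorem measurable_inv : Measurable fun A : Matrix (Fin m) (Fin m) ℝ => A⁻¹ := by
  have h1 : Measurable fun A : Matrix (Fin m) (Fin m) ℝ => (A.det)⁻¹ :=
    (continuous_id.matrix_det).measurable.inv
  have h2 : Measurable fun A : Matrix (Fin m) (Fin m) ℝ => A.adjugate :=
    (continuous_id.matrix_adjugate).measurable
  have h3 : (fun A : Matrix (Fin m) (Fin m) ℝ => A⁻¹) = fun A => (A.det)⁻¹ • A.adjugate := by
    ext1 A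
    rw [Matrix.inv_def, Ring.inverse_eq_inv']
  rw [h3]
  have h4 : Continuous fun p : ℝ × Matrix (Fin m) (Fin m) ℝ => p.1 • p.2 := by fun_prop
  exact h4.measurable.comp (h1.prodMk h2)

/-- Positive definiteness is a uniform lower bound `1 / (n + 1)` on the quadratic form for some `n`:
a countable union of closed conditions. -/
theorem measurableSet_posDef [NeZero m] :
    MeasurableSet {A : Matrix (Fin m) (Fin m) ℝ | A.PosDef} := by
  have h : {A : Matrix (Fin m) (Fin m) ℝ | A.PosDef} = {A | Aᴴ = A} ∩
      ⋃ n : ℕ, {A | ∀ x : EuclideanSpace ℝ (Fin m), 1 / ((n : ℝ) + 1) * ‖x‖ ^ 2 ≤ quad A x} := by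
    ext A
    constructor
    · intro hA
      refine ⟨hA.isHermitian, Set.mem_iUnion.2 ?_⟩
      obtain ⟨n, hn⟩ := exists_nat_one_div_lt (lamMin_pos hA)
      refine ⟨n, fun x => le_trans ?_ (lamMin_mul_le_quad hA.isHermitian x)⟩
      exact mul_le_mul_of_nonneg_right hn.le (sq_nonneg _)
    · rintro ⟨h1, h2⟩
      obtain ⟨n, hn⟩ := Set.mem_iUnion.1 h2
      refine PosDef.of_dotProduct_mulVec_pos h1 fun x hx => ?_
      have hx' : WithLp.toLp 2 x ≠ 0 := by simpa using hx
      have h3 : 0 < 1 / ((n : ℝ) + 1) * ‖WithLp.toLp 2 x‖ ^ 2 := by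
        have := norm_pos_iff.2 hx'
        positivity
      have h4 := h3.trans_le (hn (WithLp.toLp 2 x))
      simpa [quad] using h4
  rw [h]
  refine (isClosed_eq (continuous_id.matrix_conjTranspose) continuous_id).measurableSet.inter
    (MeasurableSet.iUnion fun n => IsClosed.measurableSet ?_)
  have : {A : Matrix (Fin m) (Fin m) ℝ | ∀ x : EuclideanSpace ℝ (Fin m),
      1 / ((n : ℝ) + 1) * ‖x‖ ^ 2 ≤ quad A x} =
      ⋂ x : EuclideanSpace ℝ (Fin m), {A | 1 / ((n : ℝ) + 1) * ‖x‖ ^ 2 ≤ quad A x} := by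
    ext; simp
  rw [this]
  exact isClosed_iInter fun x => isClosed_le continuous_const
    (continuous_quad.comp (by fun_prop : Continuous fun A => (A, x)))

end MatrixMeasurable

/-! ### Adaptedness of the gains and of the iterates -/

section Algorithm

variable {d : ℕ} [NeZero d] {Ω : Type*} {m mΩ : MeasurableSpace Ω} {Pr : Measure Ω}
  {D : Set (EuclideanSpace ℝ (Fin d))}

omit [NeZero d] in
theorem AEM.inner {x z : Ω → EuclideanSpace ℝ (Fin d)} (hx : AEM m Pr x) (hz : AEM m Pr z) :
    AEM m Pr fun ω => (inner ℝ (x ω) (z ω) : ℝ) :=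
  hx.map₂ hz (φ := fun x z => (Inner.inner ℝ x z : ℝ)) (by fun_prop)

omit [NeZero d] in
theorem AEM.quad {Q : Ω → Matrix (Fin d) (Fin d) ℝ} {x : Ω → EuclideanSpace ℝ (Fin d)}
    (hQ : AEM m Pr Q) (hx : AEM m Pr x) : AEM m Pr fun ω => quad (Q ω) (x ω) :=
  hQ.map₂ hx measurable_quad

omit [NeZero d] in
theorem AEM.leverage {μ b : Ω → ℝ} {x : Ω → EuclideanSpace ℝ (Fin d)}
    {P : Ω → Matrix (Fin d) (Fin d) ℝ} (hμ : AEM m Pr μ) (hb : AEM m Pr b) (hx : AEM m Pr x)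
    (hP : AEM m Pr P) : AEM m Pr fun ω => leverage (μ ω) (b ω) (x ω) (P ω) := by
  have hb2 : AEM m Pr fun ω => b ω ^ 2 := hb.map (φ := fun x => x ^ 2) (by fun_prop)
  exact (((AEM.const 1).div (hμ.add (hb2.mul (hP.quad hx)))).mul hb2).mul (hP.quad hx)

omit [NeZero d] in
theorem AEM.noiseCoeff {μ b : Ω → ℝ} {g : Ω → ℝ → ℝ} {x t : Ω → EuclideanSpace ℝ (Fin d)}
    {P : Ω → Matrix (Fin d) (Fin d) ℝ} (θ : EuclideanSpace ℝ (Fin d)) (hμ : AEM m Pr μ)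
    (hb : AEM m Pr b) (hg : HasJointVersion m Pr g) (hx : AEM m Pr x) (ht : AEM m Pr t)
    (hP : AEM m Pr P) : AEM m Pr fun ω => noiseCoeff (μ ω) (b ω) (g ω) (x ω) θ (t ω) (P ω) := by
  have h1 := hg.comp (hx.inner (AEM.const θ))
  have h2 := hg.comp (hx.inner ht)
  have h3 : AEM m Pr fun ω => (Inner.inner ℝ (x ω) (θ - t ω) : ℝ) :=
    hx.inner ((ht.map (φ := fun z => θ - z) (by fun_prop)))
  exact ((AEM.const 2).mul (((hμ.leverage hb hx hP).mul (h1.sub h2)).sub (hb.mul h3))).div hμ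

omit [NeZero d] in
theorem AEM.beta {g : Ω → ℝ → ℝ} {x s t : Ω → EuclideanSpace ℝ (Fin d)}
    (hg : HasJointVersion m Pr g) (hd : ∀ᵐ ω ∂Pr, Differentiable ℝ (g ω)) (hx : AEM m Pr x)
    (hs : AEM m Pr s) (ht : AEM m Pr t) :
    AEM m Pr fun ω => beta (g ω) (x ω) (s ω) (t ω) := by
  have h1 := hx.inner hs
  have h2 := hx.inner ht
  have h3 := h2.sub h1
  have h4 := (hg.comp h1).sub (hg.comp h2)
  have h5 := hg.deriv_comp hd h2
  -- The case test uses the difference of arguments with the sign opposite to that of the secant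
  -- denominator, hence `-p.1`.
  have hφ : Measurable fun p : ℝ × ℝ × ℝ => if p.1 = 0 then p.2.1 else p.2.2 / (-p.1) :=
    Measurable.ite (measurableSet_eq_fun measurable_fst measurable_const) (by fun_prop)
      (by fun_prop)
  refine ((h3.prodMk (h5.prodMk h4)).map hφ).congr (Eventually.of_forall fun ω => ?_)
  simp only [TSQN.beta, neg_sub]

/-- Continuity of the projection is available only on positive definite matrices, a measurable set;
extending by `0` outside changes the composition on a null set only. -/
theorem AEM.proj (hc : Convex ℝ D) (hD : IsCompact D) (hne : D.Nonempty)
    {Q : Ω → Matrix (Fin d) (Fin d) ℝ} {x : Ω → EuclideanSpace ℝ (Fin d)} (hQ : AEM m Pr Q)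
    (hx : AEM m Pr x) (hpd : ∀ᵐ ω ∂Pr, (Q ω).PosDef) :
    AEM m Pr fun ω => proj D (Q ω) (x ω) := by
  classical
  set S : Set (Matrix (Fin d) (Fin d) ℝ × EuclideanSpace ℝ (Fin d)) := {p | p.1.PosDef}
  have hS : MeasurableSet S := measurable_fst measurableSet_posDef
  have h := ContinuousOn.measurable_piecewise (s := S) (g := fun _ => 0)
    (continuousOn_proj hc hD hne) continuousOn_const hS
  refine ((hQ.prodMk hx).map h).congr ?_
  filter_upwards [hpd] with ω hω
  have hmem : (Q ω, x ω) ∈ S := hω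
  simp only [Set.piecewise, hmem, if_true]

theorem AEM.qnUpdate (hc : Convex ℝ D) (hD : IsCompact D) (hne : D.Nonempty) {a b y : Ω → ℝ}
    {g : Ω → ℝ → ℝ} {x : Ω → EuclideanSpace ℝ (Fin d)}
    {s : Ω → EuclideanSpace ℝ (Fin d) × Matrix (Fin d) (Fin d) ℝ} (ha : AEM m Pr a)
    (hb : AEM m Pr b) (hy : AEM m Pr y) (hx : AEM m Pr x) (hs : AEM m Pr s)
    (hg : AEM m Pr fun ω => g ω (Inner.inner ℝ (x ω) (s ω).1))
    (hpd : ∀ᵐ ω ∂Pr, (qnUpdate D (a ω) (b ω) (g ω) (x ω) (y ω) (s ω)).2.PosDef) :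
    AEM m Pr fun ω => qnUpdate D (a ω) (b ω) (g ω) (x ω) (y ω) (s ω) := by
  have hb2 : AEM m Pr fun ω => b ω ^ 2 := hb.map (φ := fun x => x ^ 2) (by fun_prop)
  have hs1 : AEM m Pr fun ω => (s ω).1 := hs.map measurable_fst
  have hs2 : AEM m Pr fun ω => (s ω).2 := hs.map measurable_snd
  have hP : AEM m Pr fun ω => (TSQN.qnUpdate D (a ω) (b ω) (g ω) (x ω) (y ω) (s ω)).2 :=
    ((ha.mul hb2).prodMk (hx.prodMk hs2)).map continuous_rank_one_update.measurable
  have hv : AEM m Pr fun ω => a ω * b ω * (y ω - g ω (Inner.inner ℝ (x ω) (s ω).1)) :=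
    (ha.mul hb).mul (hy.sub hg)
  have hm : AEM m Pr fun ω => mulE (s ω).2 (x ω) := hs2.map₂ hx continuous_mulE.measurable
  have hz : AEM m Pr fun ω => (s ω).1 +
      (a ω * b ω * (y ω - g ω (Inner.inner ℝ (x ω) (s ω).1))) • mulE (s ω).2 (x ω) :=
    hs1.map₂ (hv.map₂ hm (φ := fun c v => c • v) (by fun_prop)) (φ := fun v w => v + w)
      (by fun_prop)
  exact (AEM.proj hc hD hne (hP.map measurable_inv) hz
    (hpd.mono fun ω hω => hω.inv)).prodMk hP

variable {ℱ : Filtration ℕ mΩ} {φ : ℕ → Ω → EuclideanSpace ℝ (Fin d)} {y : ℕ → Ω → ℝ}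
  {G : ℕ → Ω → ℝ → ℝ} {M μ : ℕ → Ω → ℝ}

/-- The gain at time `k` is a function of the state at time `k`, so its measurability is supplied by
`hb` inside the induction. The observation is the only new information in a step. -/
theorem AEM.trajectory (hc : Convex ℝ D) (hD : IsCompact D)
    (hφ : ∀ k, AEM (ℱ k) Pr (φ k)) (hy : ∀ k, AEM (ℱ (k + 1)) Pr (y (k + 1)))
    (hG : ∀ k, HasJointVersion (ℱ k) Pr (G k)) (hμ : ∀ k, AEM (ℱ k) Pr (μ k))
    {b : ℕ → Ω → ℝ} {st : ℕ → Ω → EuclideanSpace ℝ (Fin d) × Matrix (Fin d) (Fin d) ℝ}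
    (ht : ∀ᵐ ω ∂Pr, IsTrajectory D (fun k => φ k ω) (fun k => y k ω) (fun k => G k ω)
      (fun k => μ k ω) (fun k => b k ω) fun k => st k ω) (hne : D.Nonempty)
    (h0 : AEM (ℱ 0) Pr (st 0))
    (hb : ∀ k, AEM (ℱ k) Pr (st k) → AEM (ℱ k) Pr (b k)) (k : ℕ) : AEM (ℱ k) Pr (st k) := by
  induction k with
  | zero => exact h0
  | succ k ih =>
    have hle := ℱ.mono k.le_succ
    have hbk := hb k ih
    have hb2 : AEM (ℱ k) Pr fun ω => b k ω ^ 2 := hbk.map (φ := fun x => x ^ 2) (by fun_prop)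
    have hq := (ih.map measurable_snd).quad (hφ k)
    have ha := (AEM.const (m := ℱ k) (Pr := Pr) (1 : ℝ)).div ((hμ k).add (hb2.mul hq))
    have hg := (hG k).comp ((hφ k).inner (ih.map measurable_fst))
    refine (AEM.qnUpdate hc hD hne (ha.mono hle) (hbk.mono hle) (hy k) ((hφ k).mono hle)
      (ih.mono hle) (hg.mono hle) ?_).congr ?_
    · filter_upwards [ht] with ω hω
      have := hω.posDef (k + 1)
      rwa [hω.step] at this
    · filter_upwards [ht] with ω hω
      exact (hω.step k).symm

omit [NeZero d] in
theorem AEM.betaBar (hφ : ∀ k, AEM (ℱ k) Pr (φ k))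
    (hG : ∀ k, HasJointVersion (ℱ k) Pr (G k)) (hM : ∀ k, AEM (ℱ k) Pr (M k))
    (hne : D.Nonempty)
    (hB : ∀ᵐ ω ∂Pr, ∃ C K g₁ g₂ ρ, PathBounds D (fun k => φ k ω) (fun k => G k ω)
      (fun k => M k ω) C K g₁ g₂ ρ) {P : Ω → Matrix (Fin d) (Fin d) ℝ} {k : ℕ}
    (hP : AEM (ℱ k) Pr P) :
    AEM (ℱ k) Pr fun ω => betaBar (G k ω) (M k ω) (φ k ω) (P ω) := by
  obtain ⟨x, hx⟩ := hne
  have hdiff : ∀ᵐ ω ∂Pr, Differentiable ℝ (G k ω) := hB.mono fun ω ⟨_, _, _, _, _, h⟩ => h.diff k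
  have hcl : ∀ r : ℚ, AEM (ℱ k) Pr fun ω => deriv (G k ω) (clip (M k ω) r) := fun r =>
    (hG k).deriv_comp hdiff ((AEM.const _).mul (hM k))
  have h1 : AEM (ℱ k) Pr fun ω => slopeInf (G k ω) (M k ω) := by
    refine (AEM.iInf hcl).congr ?_
    filter_upwards [hB] with ω ⟨_, _, _, _, _, h⟩
    exact (slopeInf_eq_iInf ((abs_nonneg _).trans (h.inner_le k x hx)) (h.le_top k) (h.bounds k)
      (h.lip k)).symm
  have h2 : AEM (ℱ k) Pr fun ω => slopeSup (G k ω) (M k ω) := by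
    refine (AEM.iSup hcl).congr ?_
    filter_upwards [hB] with ω ⟨_, _, _, _, _, h⟩
    exact (slopeSup_eq_iSup ((abs_nonneg _).trans (h.inner_le k x hx)) (h.le_top k) (h.bounds k)
      (h.lip k)).symm
  have h3 := (AEM.const (m := ℱ k) (Pr := Pr) (1 : ℝ)).div
    ((((AEM.const 2).mul h2).mul (hP.quad (hφ k))).add (AEM.const 1))
  exact h1.map₂ h3 (φ := fun a b => min a b) (by fun_prop)

end Algorithm

/-! ### The saturation function -/

section Saturation

/-- The thresholds are ordered, at distance at most `N`, and `l ≤ N`, `-N ≤ u`. -/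
structure ThresholdBound (l u L U : EReal) (N : ℝ) : Prop where
  lower : l - (N : EReal) ≤ L
  L_le : L ≤ l
  le : l ≤ u
  le_U : u ≤ U
  upper : U ≤ u + (N : EReal)
  l_le : l ≤ (N : EReal)
  neg_le : ((-N : ℝ) : EReal) ≤ u

namespace ThresholdBound

variable {l u L U : EReal} {N : ℝ}

/-- On the branch where saturation acts, both the threshold and the saturated value are finite, so
`EReal.toReal` never returns its default value there. -/
theorem exists_real_of_lt (h : ThresholdBound l u L U N) {x : ℝ} (hx : (x : EReal) < l) :
    ∃ l' L' : ℝ, l = l' ∧ L = L' ∧ l' - N ≤ L' ∧ L' ≤ l' ∧ l' ≤ N := by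
  have hl1 : l ≠ ⊥ := fun h' => by simp [h'] at hx
  have hl2 : l ≠ ⊤ := fun h' => by have := h.l_le; simp [h'] at this
  lift l to ℝ using ⟨hl2, hl1⟩
  have hL1 : L ≠ ⊤ := fun h' => by have := h.L_le; simp [h'] at this
  have hL2 : L ≠ ⊥ := fun h' => by
    have := h.lower
    rw [h', ← EReal.coe_sub, le_bot_iff] at this
    exact EReal.coe_ne_bot _ this
  lift L to ℝ using ⟨hL1, hL2⟩
  exact ⟨l, L, rfl, rfl, by exact_mod_cast h.lower, by exact_mod_cast h.L_le,
    by exact_mod_cast h.l_le⟩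

theorem exists_real_of_gt (h : ThresholdBound l u L U N) {x : ℝ} (hx : u < (x : EReal)) :
    ∃ u' U' : ℝ, u = u' ∧ U = U' ∧ U' ≤ u' + N ∧ u' ≤ U' ∧ -N ≤ u' := by
  have hl1 : u ≠ ⊤ := fun h' => by simp [h'] at hx
  have hl2 : u ≠ ⊥ := fun h' => by
    have := h.neg_le
    rw [h', le_bot_iff] at this
    exact EReal.coe_ne_bot _ this
  lift u to ℝ using ⟨hl1, hl2⟩
  have hL1 : U ≠ ⊥ := fun h' => by have := h.le_U; simp [h'] at this
  have hL2 : U ≠ ⊤ := fun h' => by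
    have := h.upper
    rw [h', ← EReal.coe_add, top_le_iff] at this
    exact EReal.coe_ne_top _ this
  lift U to ℝ using ⟨hL2, hL1⟩
  exact ⟨u, U, rfl, rfl, by exact_mod_cast h.upper, by exact_mod_cast h.le_U,
    by exact_mod_cast h.neg_le⟩

theorem abs_saturation_le (h : ThresholdBound l u L U N) (hN : 0 ≤ N) (x : ℝ) :
    |saturation l u L U x| ≤ |x| + N := by
  unfold saturation
  split_ifs with h1 h2
  · obtain ⟨l', L', rfl, rfl, h3, h4, h5⟩ := h.exists_real_of_lt h1
    have hx : x < l' := by exact_mod_cast h1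
    rw [EReal.toReal_coe, abs_le]
    constructor <;> linarith [neg_abs_le x, abs_nonneg x]
  · linarith
  · obtain ⟨u', U', rfl, rfl, h3, h4, h5⟩ := h.exists_real_of_gt (not_le.1 h2)
    have hx : u' < x := by exact_mod_cast not_le.1 h2
    rw [EReal.toReal_coe, abs_le]
    constructor <;> linarith [le_abs_self x, abs_nonneg x]

/-- The jumps at the thresholds go upwards since `L ≤ l ≤ u ≤ U`. Monotonicity is what allows the
deterministic argument of `G k` to be replaced by a random one. -/
theorem saturation_mono (h : ThresholdBound l u L U N) : Monotone (saturation l u L U) := by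
  intro x x' hxx
  unfold saturation
  have hxx' : (x : EReal) ≤ x' := by exact_mod_cast hxx
  by_cases h1 : (x : EReal) < l
  · obtain ⟨l', L', rfl, rfl, h3, h4, h5⟩ := h.exists_real_of_lt h1
    rw [if_pos h1]
    split_ifs with h6 h7
    · exact le_rfl
    · have : l' ≤ x' := by exact_mod_cast not_lt.1 h6
      simpa using h4.trans this
    · obtain ⟨u', U', rfl, rfl, h8, h9, h10⟩ := h.exists_real_of_gt (not_le.1 h7)
      have : l' ≤ u' := by exact_mod_cast h.le
      simpa using h4.trans (this.trans h9)
  · have h1' : ¬ (x' : EReal) < l := fun h' => h1 (hxx'.trans_lt h')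
    rw [if_neg h1, if_neg h1']
    by_cases h2 : (x : EReal) ≤ u
    · rw [if_pos h2]
      split_ifs with h7
      · exact hxx
      · obtain ⟨u', U', rfl, rfl, h8, h9, h10⟩ := h.exists_real_of_gt (not_le.1 h7)
        have : x ≤ u' := by exact_mod_cast h2
        simpa using this.trans h9
    · have h2' : ¬ (x' : EReal) ≤ u := fun h' => h2 (hxx'.trans h')
      rw [if_neg h2, if_neg h2']

end ThresholdBound

variable {Ω : Type*} {m : MeasurableSpace Ω}

theorem measurable_saturation {l u L U : Ω → EReal} {x : Ω → ℝ} (hl : Measurable l)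
    (hu : Measurable u) (hL : Measurable L) (hU : Measurable U) (hx : Measurable x) :
    Measurable fun ω => saturation (l ω) (u ω) (L ω) (U ω) (x ω) := by
  unfold saturation
  have hx' : Measurable fun ω => (x ω : EReal) := hx.coe_real_ereal
  exact Measurable.ite (measurableSet_lt hx' hl) hL.ereal_toReal
    (Measurable.ite (measurableSet_le hx' hu) hx hU.ereal_toReal)

theorem measurableSet_thresholdBound {l u L U : Ω → EReal} (hl : Measurable l)
    (hu : Measurable u) (hL : Measurable L) (hU : Measurable U) (N : ℝ) :
    MeasurableSet {ω | ThresholdBound (l ω) (u ω) (L ω) (U ω) N} := by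
  have h1 : Measurable fun t : EReal => t - (N : EReal) :=
    Monotone.measurable fun a b hab => EReal.sub_le_sub hab le_rfl
  have h2 : Measurable fun t : EReal => t + (N : EReal) :=
    Monotone.measurable fun a b hab => add_le_add_left hab _
  have e : {ω | ThresholdBound (l ω) (u ω) (L ω) (U ω) N} =
      {ω | l ω - (N : EReal) ≤ L ω} ∩ ({ω | L ω ≤ l ω} ∩ ({ω | l ω ≤ u ω} ∩ ({ω | u ω ≤ U ω} ∩
      ({ω | U ω ≤ u ω + (N : EReal)} ∩ ({ω | l ω ≤ (N : EReal)} ∩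
      {ω | ((-N : ℝ) : EReal) ≤ u ω}))))) := by
    ext ω
    exact ⟨fun (h : ThresholdBound (l ω) (u ω) (L ω) (U ω) N) =>
      ⟨h.lower, h.L_le, h.le, h.le_U, h.upper, h.l_le, h.neg_le⟩,
      fun ⟨a, b, c, d, e, f, g⟩ => ⟨a, b, c, d, e, f, g⟩⟩
  rw [e]
  exact (measurableSet_le (h1.comp hl) hL).inter ((measurableSet_le hL hl).inter
    ((measurableSet_le hl hu).inter ((measurableSet_le hu hU).inter
    ((measurableSet_le hU (h2.comp hu)).inter ((measurableSet_le hl measurable_const).inter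
    (measurableSet_le measurable_const hu))))))

theorem thresholdBound_of_bounds {l u L U : EReal} {c a b N : ℝ} (hN : c ≤ N ∧ a ≤ N ∧ b ≤ N)
    (h : (l - (c : EReal) ≤ L ∧ L ≤ l ∧ l ≤ u ∧ u ≤ U ∧ U ≤ u + (c : EReal)) ∧
      max l 0 ≤ (a : EReal) ∧ max (-u) 0 ≤ (b : EReal)) : ThresholdBound l u L U N := by
  obtain ⟨⟨h1, h2, h3, h4, h5⟩, h6, h7⟩ := h
  obtain ⟨n1, n2, n3⟩ := hN
  have hc : (c : EReal) ≤ N := by exact_mod_cast n1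
  refine ⟨(EReal.sub_le_sub le_rfl hc).trans h1, h2, h3, h4,
    h5.trans (add_le_add_right hc _), ((le_max_left _ _).trans h6).trans (by exact_mod_cast n2), ?_⟩
  have h8 : -u ≤ (N : EReal) := ((le_max_left _ _).trans h7).trans (by exact_mod_cast n3)
  rw [EReal.coe_neg]
  exact EReal.neg_le_of_neg_le h8

end Saturation

/-! ### Conditional expectation of the saturated observation -/

section Noise

open scoped ENNReal

variable {Ω : Type*} {m mΩ : MeasurableSpace Ω} {Pr : Measure Ω} [IsProbabilityMeasure Pr]

omit [IsProbabilityMeasure Pr] in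
/-- If `G x = 𝔼[S(x + e) | m]` for every real `x`, with `S` monotone and `G` continuous, then
this also holds, on an event `E`, for `m`-measurable random `x`. -/
theorem condExp_eq_of_monotone (hm : m ≤ mΩ) {S : Ω → ℝ → ℝ} {e X : Ω → ℝ} {G : Ω → ℝ → ℝ}
    (hG : ∀ x, (fun ω => G ω x) =ᵐ[Pr] Pr[fun ω => S ω (x + e ω) | m])
    (hcont : ∀ᵐ ω ∂Pr, Continuous (G ω)) (hSint : ∀ x, Integrable (fun ω => S ω (x + e ω)) Pr)
    (hX : Measurable[m] X) {E : Set Ω} (hE : MeasurableSet[m] E)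
    (hmono : ∀ ω ∈ E, Monotone (S ω))
    (hY : Integrable (E.indicator fun ω => S ω (X ω + e ω)) Pr) :
    ∀ᵐ ω ∂Pr, ω ∈ E → (Pr[E.indicator fun ω => S ω (X ω + e ω) | m]) ω = G ω (X ω) := by
  set Y := E.indicator fun ω => S ω (X ω + e ω)
  -- On the `m`-measurable event `r ≤ X` within `E`, monotonicity compares the value at `X` with the
  -- value at the constant `r`, for which the conditional expectation is given.
  have hlow : ∀ r : ℚ, ∀ᵐ ω ∂Pr, ω ∈ E → (r : ℝ) ≤ X ω → G ω r ≤ (Pr[Y | m]) ω := by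
    intro r
    set B : Set Ω := E ∩ {ω | (r : ℝ) ≤ X ω}
    have hB : MeasurableSet[m] B := hE.inter (@measurableSet_le _ _ _ _ _ m _ _ _ _ _
      (@measurable_const _ _ _ m _) hX)
    have h1 := condExp_mono (m := m) ((hSint r).indicator (hm _ hB)) (hY.indicator (hm _ hB))
      (Eventually.of_forall fun ω => by
        by_cases hω : ω ∈ B
        · rw [Set.indicator_of_mem hω, Set.indicator_of_mem hω]
          simp only [Y, Set.indicator_of_mem hω.1]
          exact hmono ω hω.1 (add_le_add_left hω.2 _)
        · rw [Set.indicator_of_notMem hω, Set.indicator_of_notMem hω])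
    filter_upwards [h1, condExp_indicator (hSint r) hB, condExp_indicator hY hB, hG r] with
      ω h1 h2 h3 h4 hωE hωX
    have hω : ω ∈ B := ⟨hωE, hωX⟩
    rw [h2, h3, Set.indicator_of_mem hω, Set.indicator_of_mem hω] at h1
    rwa [h4]
  have hupp : ∀ r : ℚ, ∀ᵐ ω ∂Pr, ω ∈ E → X ω ≤ (r : ℝ) → (Pr[Y | m]) ω ≤ G ω r := by
    intro r
    set B : Set Ω := E ∩ {ω | X ω ≤ (r : ℝ)}
    have hB : MeasurableSet[m] B := hE.inter (@measurableSet_le _ _ _ _ _ m _ _ _ _ _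
      hX (@measurable_const _ _ _ m _))
    have h1 := condExp_mono (m := m) (hY.indicator (hm _ hB)) ((hSint r).indicator (hm _ hB))
      (Eventually.of_forall fun ω => by
        by_cases hω : ω ∈ B
        · rw [Set.indicator_of_mem hω, Set.indicator_of_mem hω]
          simp only [Y, Set.indicator_of_mem hω.1]
          exact hmono ω hω.1 (add_le_add_left hω.2 _)
        · rw [Set.indicator_of_notMem hω, Set.indicator_of_notMem hω])
    filter_upwards [h1, condExp_indicator (hSint r) hB, condExp_indicator hY hB, hG r] with
      ω h1 h2 h3 h4 hωE hωX
    have hω : ω ∈ B := ⟨hωE, hωX⟩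
    rw [h2, h3, Set.indicator_of_mem hω, Set.indicator_of_mem hω] at h1
    rwa [h4]
  -- Off one null set the bounds hold for all rationals; letting them approach `X ω` from either
  -- side, continuity of `G ω` closes the gap.
  filter_upwards [ae_all_iff.2 hlow, ae_all_iff.2 hupp, hcont] with ω h1 h2 hc hω
  refine le_antisymm (le_of_forall_gt fun t ht => ?_) (le_of_forall_lt fun t ht => ?_)
  · have hev : ∀ᶠ x in 𝓝[>] X ω, G ω x < t :=
      (hc.tendsto (X ω)).mono_left nhdsWithin_le_nhds |>.eventually (gt_mem_nhds ht)
    obtain ⟨b, hb, hsub⟩ := mem_nhdsGT_iff_exists_Ioo_subset.1 hev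
    obtain ⟨r, hr1, hr2⟩ := exists_rat_btwn (Set.mem_Ioi.1 hb)
    exact (h2 r hω hr1.le).trans_lt (hsub ⟨hr1, hr2⟩)
  · have hev : ∀ᶠ x in 𝓝[<] X ω, t < G ω x :=
      (hc.tendsto (X ω)).mono_left nhdsWithin_le_nhds |>.eventually (lt_mem_nhds ht)
    obtain ⟨b, hb, hsub⟩ := mem_nhdsLT_iff_exists_Ioo_subset.1 hev
    obtain ⟨r, hr1, hr2⟩ := exists_rat_btwn (Set.mem_Iio.1 hb)
    exact lt_of_lt_of_le (hsub ⟨hr1, hr2⟩) (h1 r hω hr2.le)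

theorem rpow_le_one_add_rpow {p q x : ℝ} (hx : 0 ≤ x) (hp : 0 ≤ p) (hpq : p ≤ q) :
    x ^ p ≤ 1 + x ^ q := by
  rcases le_total x 1 with h | h
  · have := Real.rpow_le_one hx h hp
    have := Real.rpow_nonneg hx q
    linarith
  · have := Real.rpow_le_rpow_of_exponent_le h hpq
    linarith

theorem add_rpow_le {a b q : ℝ} (ha : 0 ≤ a) (hb : 0 ≤ b) (hq : 0 ≤ q) :
    (a + b) ^ q ≤ 2 ^ q * (a ^ q + b ^ q) := by
  have ha' := Real.rpow_nonneg ha q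
  have hb' := Real.rpow_nonneg hb q
  have h2 : (0 : ℝ) ≤ 2 ^ q := by positivity
  rcases le_total a b with h | h
  · calc (a + b) ^ q ≤ (2 * b) ^ q := Real.rpow_le_rpow (by positivity) (by linarith) hq
      _ = 2 ^ q * b ^ q := Real.mul_rpow (by norm_num) hb
      _ ≤ _ := mul_le_mul_of_nonneg_left (by linarith) h2
  · calc (a + b) ^ q ≤ (2 * a) ^ q := Real.rpow_le_rpow (by positivity) (by linarith) hq
      _ = 2 ^ q * a ^ q := Real.mul_rpow (by norm_num) ha
      _ ≤ _ := mul_le_mul_of_nonneg_left (by linarith) h2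

/-- Moment bound for the centered variable `Y - 𝔼[Y | m]`, when `|Y| ≤ |e| + K` on an event `E`
where the conditional moments of `e` are bounded, and `Y = 0` outside `E`. -/
theorem setLIntegral_rpow_sub_condExp_le (hm : m ≤ mΩ) {e Y : Ω → ℝ} (he : Integrable e Pr)
    (hY : Integrable Y Pr) {E : Set Ω} (hE : MeasurableSet[m] E)
    {K N p q : ℝ} (hK : 0 ≤ K) (hN : 0 ≤ N) (hp : 1 ≤ p) (hpq : p ≤ q)
    (hYE : ∀ ω ∈ E, |Y ω| ≤ |e ω| + K) (hY0 : ∀ ω ∉ E, Y ω = 0)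
    (hmom : ∀ A, MeasurableSet[m] A → A ⊆ E →
      ∫⁻ ω in A, ENNReal.ofReal (|e ω| ^ q) ∂Pr ≤ ENNReal.ofReal N * Pr A)
    {A : Set Ω} (hA : MeasurableSet[m] A) :
    ∫⁻ ω in A, ENNReal.ofReal (|Y ω - (Pr[Y | m]) ω| ^ p) ∂Pr ≤
      ENNReal.ofReal (2 ^ p * (1 + N + (1 + N + 2 * K) ^ p)) * Pr A := by
  have hq : 0 ≤ q := by linarith
  -- Lower moments are controlled through `x ^ s ≤ 1 + x ^ q`; orders `1` and `p` are needed below.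
  have hmom' : ∀ s, 0 ≤ s → s ≤ q → ∀ A, MeasurableSet[m] A → A ⊆ E →
      ∫⁻ ω in A, ENNReal.ofReal (|e ω| ^ s) ∂Pr ≤ ENNReal.ofReal (1 + N) * Pr A := by
    intro s hs hsq A hA hAE
    calc _ ≤ ∫⁻ ω in A, (1 + ENNReal.ofReal (|e ω| ^ q)) ∂Pr := by
          refine lintegral_mono fun ω => ?_
          rw [← ENNReal.ofReal_one, ← ENNReal.ofReal_add zero_le_one (by positivity)]
          exact ENNReal.ofReal_le_ofReal (rpow_le_one_add_rpow (abs_nonneg _) hs hsq)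
      _ = Pr A + ∫⁻ ω in A, ENNReal.ofReal (|e ω| ^ q) ∂Pr := by
          rw [lintegral_add_left measurable_const]; simp
      _ ≤ Pr A + ENNReal.ofReal N * Pr A := by gcongr; exact hmom A hA hAE
      _ = _ := by rw [ENNReal.ofReal_add zero_le_one hN, add_mul, ENNReal.ofReal_one, one_mul]
  -- the conditional expectation of `Y` is bounded
  set Z : Ω → ℝ := E.indicator fun ω => |e ω| + K
  have hZi : Integrable Z Pr := (he.abs.add (integrable_const K)).indicator (hm _ hE)
  have hZ0 : ∀ ω, 0 ≤ Z ω := fun ω => Set.indicator_nonneg (fun ω _ => by positivity) ω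
  have hYZ : ∀ ω, |Y ω| ≤ Z ω := fun ω => by
    by_cases hω : ω ∈ E
    · simp only [Z, Set.indicator_of_mem hω]; exact hYE ω hω
    · simp only [Z, Set.indicator_of_notMem hω, hY0 ω hω, abs_zero, le_refl]
  have hZ : ∀ᵐ ω ∂Pr, (Pr[Z | m]) ω ≤ 1 + N + K := by
    refine condExp_le_of_setLIntegral_le hm hZi hZ0 (by positivity) fun A hA => ?_
    have e1 : ∀ ω, ENNReal.ofReal (Z ω) =
        E.indicator (fun ω => ENNReal.ofReal (|e ω| + K)) ω := fun ω => by
      by_cases hω : ω ∈ E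
      · simp only [Z, Set.indicator_of_mem hω]
      · simp only [Z, Set.indicator_of_notMem hω, ENNReal.ofReal_zero]
    simp_rw [e1]
    rw [lintegral_indicator (hm _ hE), Measure.restrict_restrict (hm _ hE)]
    calc ∫⁻ ω in E ∩ A, ENNReal.ofReal (|e ω| + K) ∂Pr
        = ∫⁻ ω in E ∩ A, (ENNReal.ofReal K + ENNReal.ofReal (|e ω| ^ (1 : ℝ))) ∂Pr := by
          refine lintegral_congr fun ω => ?_
          rw [Real.rpow_one, add_comm, ENNReal.ofReal_add hK (abs_nonneg _)]
      _ = ENNReal.ofReal K * Pr (E ∩ A) +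
          ∫⁻ ω in E ∩ A, ENNReal.ofReal (|e ω| ^ (1 : ℝ)) ∂Pr := by
          rw [lintegral_add_left measurable_const]; simp
      _ ≤ ENNReal.ofReal K * Pr (E ∩ A) + ENNReal.ofReal (1 + N) * Pr (E ∩ A) := by
          gcongr
          exact hmom' 1 zero_le_one (hp.trans hpq) _ (hE.inter hA) Set.inter_subset_left
      _ = ENNReal.ofReal (1 + N + K) * Pr (E ∩ A) := by
          rw [ENNReal.ofReal_add (by positivity : 0 ≤ 1 + N) hK, add_mul, add_comm]
      _ ≤ _ := by gcongr; exact Set.inter_subset_right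
  have hle := condExp_mono (m := m) hY hZi (Eventually.of_forall fun ω => le_of_abs_le (hYZ ω))
  have hge := condExp_mono (m := m) hZi.neg hY
    (Eventually.of_forall fun ω => (abs_le.1 (hYZ ω)).1)
  have hneg := condExp_neg (μ := Pr) Z m
  -- Since `E` is `m`-measurable and `Y` vanishes off `E`, so does its conditional expectation.
  have hind : Pr[Y | m] =ᵐ[Pr] E.indicator (Pr[Y | m]) := by
    have h1 := condExp_indicator hY hE
    have h2 : E.indicator Y = Y := by
      ext ω
      by_cases hω : ω ∈ E
      · rw [Set.indicator_of_mem hω]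
      · rw [Set.indicator_of_notMem hω, hY0 ω hω]
    rwa [h2] at h1
  -- The sum of `K`, from the bound on `Y`, and `1 + N + K`, from the bound on its conditional
  -- expectation.
  set K' := 1 + N + 2 * K with hK'
  have hK'0 : 0 ≤ K' := by positivity
  have hpt : ∀ᵐ ω ∂Pr, ENNReal.ofReal (|Y ω - (Pr[Y | m]) ω| ^ p) ≤
      E.indicator (fun ω => ENNReal.ofReal (2 ^ p * (|e ω| ^ p + K' ^ p))) ω := by
    filter_upwards [hle, hge, hneg, hZ, hind] with ω h1 h2 h3 h4 h5
    by_cases hω : ω ∈ E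
    · rw [Set.indicator_of_mem hω]
      refine ENNReal.ofReal_le_ofReal ((Real.rpow_le_rpow (abs_nonneg _) ?_ (by linarith)).trans
        (add_rpow_le (abs_nonneg _) hK'0 (by linarith)))
      rw [h3, Pi.neg_apply] at h2
      have h6 : |(Pr[Y | m]) ω| ≤ 1 + N + K := abs_le.2 ⟨by linarith, by linarith⟩
      refine (abs_sub _ _).trans ?_
      linarith [hYE ω hω]
    · rw [h5, Set.indicator_of_notMem hω, hY0 ω hω, sub_zero, abs_zero,
        Real.zero_rpow (by linarith)]
      simp
  calc _ ≤ ∫⁻ ω in A, E.indicator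
        (fun ω => ENNReal.ofReal (2 ^ p * (|e ω| ^ p + K' ^ p))) ω ∂Pr :=
        lintegral_mono_ae (ae_restrict_of_ae hpt)
    _ = ∫⁻ ω in E ∩ A, ENNReal.ofReal (2 ^ p * (|e ω| ^ p + K' ^ p)) ∂Pr := by
        rw [lintegral_indicator (hm _ hE), Measure.restrict_restrict (hm _ hE)]
    _ = ∫⁻ ω in E ∩ A, ENNReal.ofReal (2 ^ p) *
          (ENNReal.ofReal (K' ^ p) + ENNReal.ofReal (|e ω| ^ p)) ∂Pr := by
        refine lintegral_congr fun ω => ?_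
        rw [ENNReal.ofReal_mul (by positivity), add_comm,
          ENNReal.ofReal_add (by positivity) (by positivity)]
    _ = ENNReal.ofReal (2 ^ p) * (ENNReal.ofReal (K' ^ p) * Pr (E ∩ A) +
          ∫⁻ ω in E ∩ A, ENNReal.ofReal (|e ω| ^ p) ∂Pr) := by
        rw [lintegral_const_mul' _ _ ENNReal.ofReal_ne_top, lintegral_add_left measurable_const]
        simp
    _ ≤ ENNReal.ofReal (2 ^ p) * (ENNReal.ofReal (K' ^ p) * Pr (E ∩ A) +
          ENNReal.ofReal (1 + N) * Pr (E ∩ A)) := by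
        gcongr
        exact hmom' p (by linarith) hpq _ (hE.inter hA) Set.inter_subset_left
    _ = ENNReal.ofReal (2 ^ p * (1 + N + K' ^ p)) * Pr (E ∩ A) := by
        rw [ENNReal.ofReal_mul (by positivity), ENNReal.ofReal_add (by positivity : 0 ≤ 1 + N)
          (by positivity)]
        ring
    _ ≤ _ := by gcongr; exact Set.inter_subset_right

end Noise

/-! ### The observation noise -/

section ObservationNoise

open scoped ENNReal

variable {Ω : Type*} {mΩ : MeasurableSpace Ω} {Pr : Measure Ω} [IsProbabilityMeasure Pr]
  {ℱ : Filtration ℕ mΩ}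

/-- Along almost every path, `w` agrees with one of countably many noises with bounded conditional
moments. -/
structure LocallyBoundedNoise (Pr : Measure Ω) (ℱ : Filtration ℕ mΩ) (w : ℕ → Ω → ℝ) : Prop where
  exists_noise : ∃ (q : ℝ) (v : ℕ → ℕ → Ω → ℝ) (C : ℕ → ℝ), 2 < q ∧ q ≤ 4 ∧
    (∀ N, BoundedNoise Pr ℱ (v N) q (C N)) ∧ ∀ᵐ ω ∂Pr, ∃ N, ∀ k, w k ω = v N k ω

namespace LocallyBoundedNoise

variable {w : ℕ → Ω → ℝ}

theorem ae_noiseNegligible (h : LocallyBoundedNoise Pr ℱ w) {f : ℕ → Ω → ℝ}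
    (hf : ∀ k, AEM (ℱ k) Pr (f k)) :
    ∀ᵐ ω ∂Pr, NoiseNegligible (fun k => f k ω) fun k => w k ω := by
  obtain ⟨q, v, C, hq, -, hv, hw⟩ := h.exists_noise
  choose f' hf' hff' using hf
  filter_upwards [ae_all_iff.2 fun N => (hv N).ae_noiseNegligible hq.le hf', hw,
    ae_all_iff.2 hff'] with ω h1 ⟨N, hN⟩ h3
  simp_rw [hN, h3]
  exact h1 N

theorem ae_squareDominated (h : LocallyBoundedNoise Pr ℱ w) {α : ℕ → Ω → ℝ}
    (hα : ∀ k, AEM (ℱ k) Pr (α k)) (h0 : ∀ᵐ ω ∂Pr, ∀ k, 0 ≤ α k ω ∧ α k ω ≤ 1) :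
    ∀ᵐ ω ∂Pr, SquareDominated (fun k => α k ω) fun k => w k ω := by
  obtain ⟨q, v, C, hq, hq4, hv, hw⟩ := h.exists_noise
  choose α' hα' hαα' using hα
  -- The measurable version agrees with `α` only almost surely; clipping forces it into `[0, 1]`
  -- everywhere.
  have hm : ∀ k, Measurable[ℱ k] fun ω => max 0 (min 1 (α' k ω)) := fun k =>
    measurable_const.max (measurable_const.min (hα' k))
  filter_upwards [ae_all_iff.2 fun N => (hv N).ae_squareDominated hq hq4 hm
    (fun k ω => le_max_left _ _) (fun k ω => max_le zero_le_one (min_le_left _ _)), hw,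
    ae_all_iff.2 hαα', h0] with ω h1 ⟨N, hN⟩ h3 h4
  have h5 : ∀ k, α k ω = max 0 (min 1 (α' k ω)) := fun k => by
    rw [← h3, min_eq_right (h4 k).2, max_eq_right (h4 k).1]
  simp_rw [hN, h5]
  exact h1 N

end LocallyBoundedNoise

/-- The observation noise `y_{k+1} - G_k(φ_kᵀ θ)` has locally bounded conditional moments. -/
theorem locallyBoundedNoise_observation {d : ℕ} {φ : ℕ → Ω → EuclideanSpace ℝ (Fin d)}
    {D : Set (EuclideanSpace ℝ (Fin d))} {θ : EuclideanSpace ℝ (Fin d)}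
    (hφ : RegressorAssumption Pr ℱ φ D θ) {l u L U : ℕ → Ω → EReal}
    (hS : ThresholdAssumption Pr ℱ l u L U) {M : ℕ → Ω → ℝ} {e : ℕ → Ω → ℝ}
    {G : ℕ → Ω → ℝ → ℝ} (he : NoiseAssumption Pr ℱ l u L U M e G) {y : ℕ → Ω → ℝ}
    (hy : ∀ k ω, y (k + 1) ω = saturation (l k ω) (u k ω) (L k ω) (U k ω)
      (inner ℝ (φ k ω) θ + e (k + 1) ω)) :
    LocallyBoundedNoise Pr ℱ fun k ω => y (k + 1) ω - G k ω (inner ℝ (φ k ω) θ) := by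
  obtain ⟨c, a, b, ⟨hc, ha, hb⟩, hnn, hbd⟩ := hS.bounds
  obtain ⟨η, hη, hmom⟩ := he.moment_upper
  have hem : ∀ k, Measurable (e (k + 1)) := fun k => (he.adapted k).measurable.mono (ℱ.le _) le_rfl
  have hei : ∀ k, Integrable (e (k + 1)) Pr := fun k => (he.memLp k).integrable one_le_two
  set X : ℕ → Ω → ℝ := fun k ω => inner ℝ (φ k ω) θ
  have hXm : ∀ k, Measurable[ℱ k] (X k) := fun k => (by fun_prop : Measurable fun z : EuclideanSpace ℝ (Fin d) => (inner ℝ z θ : ℝ)).comp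
    (hφ.adapted k).measurable
  set S : ℕ → Ω → ℝ → ℝ := fun k ω => saturation (l k ω) (u k ω) (L k ω) (U k ω)
  have hSm : ∀ k (z : Ω → ℝ), Measurable[ℱ (k + 1)] z →
      Measurable[ℱ (k + 1)] fun ω => S k ω (z ω) := fun k z hz =>
    measurable_saturation ((hS.adapted_l k).mono (ℱ.mono k.le_succ) le_rfl)
      ((hS.adapted_u k).mono (ℱ.mono k.le_succ) le_rfl)
      ((hS.adapted_L k).mono (ℱ.mono k.le_succ) le_rfl)
      ((hS.adapted_U k).mono (ℱ.mono k.le_succ) le_rfl) hz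
  -- events on which all the conditional bounds hold
  set E : ℕ → ℕ → Set Ω := fun N k => {ω | ‖φ k ω‖ ≤ N} ∩
    ({ω | ThresholdBound (l k ω) (u k ω) (L k ω) (U k ω) N} ∩
    {ω | (Pr⁻[fun ω' => ENNReal.ofReal (|e (k + 1) ω'| ^ (2 + η)) | ℱ k]) ω ≤
      ENNReal.ofReal N})
  have hE : ∀ N k, MeasurableSet[ℱ k] (E N k) := fun N k => by
    refine MeasurableSet.inter ?_ (MeasurableSet.inter ?_ ?_)
    · exact @measurableSet_le _ _ _ _ _ (ℱ k) _ _ _ _ _ (measurable_norm.comp (hφ.adapted k).measurable)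
        (@measurable_const _ _ _ (ℱ k) _)
    · exact measurableSet_thresholdBound (hS.adapted_l k) (hS.adapted_u k) (hS.adapted_L k)
        (hS.adapted_U k) N
    · exact @measurableSet_le _ _ _ _ _ (ℱ k) _ _ _ _ _ (measurable_condLExp _ _ _)
        (@measurable_const _ _ _ (ℱ k) _)
  have hEall : ∀ᵐ ω ∂Pr, ∃ N : ℕ, ∀ k, ω ∈ E N k := by
    filter_upwards [hφ.bounded, hbd, hmom] with ω ⟨C, hC⟩ h2 h3
    set s := ⨆ k, (Pr⁻[fun ω' => ENNReal.ofReal (|e (k + 1) ω'| ^ (2 + η)) | ℱ k]) ω with hs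
    -- One integer above all the random constants of the path serves for every time `k`.
    obtain ⟨N, hN⟩ := exists_nat_ge (max (max C s.toReal) (max (c ω) (max (a ω) (b ω))))
    simp only [max_le_iff] at hN
    obtain ⟨⟨n1, n2⟩, n3, n4, n5⟩ := hN
    refine ⟨N, fun k => ⟨(hC k).trans n1, thresholdBound_of_bounds ⟨n3, n4, n5⟩ (h2 k), ?_⟩⟩
    refine le_trans (le_iSup (fun k =>
      (Pr⁻[fun ω' => ENNReal.ofReal (|e (k + 1) ω'| ^ (2 + η)) | ℱ k]) ω) k) ?_
    rw [← hs, ← ENNReal.ofReal_toReal h3.ne]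
    exact ENNReal.ofReal_le_ofReal n2
  -- the saturated noise is integrable at deterministic points
  have hSint : ∀ k x, Integrable (fun ω => S k ω (x + e (k + 1) ω)) Pr := by
    intro k x
    have hi : Integrable (fun ω => |x + e (k + 1) ω| + (c ω + a ω + b ω)) Pr :=
      ((integrable_const x).add (hei k)).abs.add (((hc.integrable one_le_two).add
        (ha.integrable one_le_two)).add (hb.integrable one_le_two))
    refine hi.mono ((hSm k _ ((he.adapted k).measurable.const_add x)).mono (ℱ.le _)
      le_rfl).aestronglyMeasurable ?_
    filter_upwards [hbd] with ω h2
    obtain ⟨n1, n2, n3⟩ := hnn ω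
    -- Off the localizing events the bound is random but integrable, which is enough here.
    have hT := thresholdBound_of_bounds (N := c ω + a ω + b ω)
      ⟨by linarith, by linarith, by linarith⟩ (h2 k)
    have h3 := hT.abs_saturation_le (by positivity) (x + e (k + 1) ω)
    rw [Real.norm_eq_abs, Real.norm_eq_abs]
    exact h3.trans (le_abs_self _)
  -- truncated observations
  set Y : ℕ → ℕ → Ω → ℝ := fun N k => (E N k).indicator fun ω => S k ω (X k ω + e (k + 1) ω)
  set K : ℕ → ℝ := fun N => N * ‖θ‖ + N
  have hK : ∀ N, 0 ≤ K N := fun N => by positivity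
  have hYm : ∀ N k, Measurable[ℱ (k + 1)] (Y N k) := fun N k =>
    (hSm k _ (((hXm k).mono (ℱ.mono k.le_succ) le_rfl).add (he.adapted k).measurable)).indicator
      (ℱ.mono k.le_succ _ (hE N k))
  have hYE : ∀ N k, ∀ ω ∈ E N k, |Y N k ω| ≤ |e (k + 1) ω| + K N := by
    intro N k ω hω
    simp only [Y, Set.indicator_of_mem hω]
    have h1 := hω.2.1.abs_saturation_le (Nat.cast_nonneg N) (X k ω + e (k + 1) ω)
    have h2 : |X k ω| ≤ N * ‖θ‖ := (abs_real_inner_le_norm _ _).trans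
      (mul_le_mul_of_nonneg_right hω.1 (norm_nonneg _))
    have h3 := abs_add_le (X k ω) (e (k + 1) ω)
    refine h1.trans ?_
    simp only [K]
    linarith
  have hY0 : ∀ N k, ∀ ω ∉ E N k, Y N k ω = 0 := fun N k ω hω => Set.indicator_of_notMem hω _
  have hYi : ∀ N k, Integrable (Y N k) Pr := fun N k => by
    refine ((hei k).abs.add (integrable_const (K N))).mono
      ((hYm N k).mono (ℱ.le _) le_rfl).aestronglyMeasurable (Eventually.of_forall fun ω => ?_)
    rw [Real.norm_eq_abs, Real.norm_eq_abs]
    refine le_trans ?_ (le_abs_self _)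
    by_cases hω : ω ∈ E N k
    · exact hYE N k ω hω
    · rw [hY0 N k ω hω, abs_zero]
      have := hK N
      simp only [Pi.add_apply]
      positivity
  -- The order stays above `2` and is capped at `4`, as the truncation argument for squared noise
  -- requires.
  set p := 2 + min η 2 with hp
  have hp2 : 2 < p := by rw [hp]; linarith [lt_min hη two_pos]
  refine ⟨p, fun N k ω => Y N k ω - (Pr[Y N k | ℱ k]) ω,
    fun N => 2 ^ p * (1 + N + (1 + N + 2 * K N) ^ p), hp2,
    by rw [hp]; linarith [min_le_right η 2], fun N => ⟨fun k => ?_, fun k => ?_, fun k A hA => ?_,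
      ?_⟩, ?_⟩
  · exact (hYm N k).sub
      (stronglyMeasurable_condExp.measurable.mono (ℱ.mono k.le_succ) le_rfl)
  · have h1 := condExp_sub (hYi N k) (integrable_condExp (m := ℱ k) (f := Y N k)) (ℱ k)
    have h2 : Pr[Pr[Y N k | ℱ k] | ℱ k] = Pr[Y N k | ℱ k] :=
      condExp_of_stronglyMeasurable (ℱ.le k) stronglyMeasurable_condExp integrable_condExp
    rw [h2, sub_self] at h1
    exact h1
  · refine setLIntegral_rpow_sub_condExp_le (ℱ.le k) (hei k) (hYi N k) (hE N k) (hK N)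
      (Nat.cast_nonneg N) (by linarith) (q := 2 + η) (by rw [hp]; linarith [min_le_left η 2])
      (hYE N k) (hY0 N k) (fun B hB hBE => ?_) hA
    -- On subsets of the event measurable at time `k`, the noise moment may be replaced by its
    -- conditional version, which is at most `N` there.
    rw [← setLIntegral_condLExp (ℱ.le k) Pr _ hB, ← setLIntegral_const]
    exact setLIntegral_mono' (ℱ.le k _ hB) fun ω hω => (hBE hω).2.2
  · have := hK N
    positivity
  -- On the localizing event the centering of the truncated observation is `G k` at `φᵀ θ`, so the
  -- localized noise coincides with the true one.
  · have hcond : ∀ᵐ ω ∂Pr, ∀ N k, ω ∈ E N k → (Pr[Y N k | ℱ k]) ω = G k ω (X k ω) := by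
      rw [ae_all_iff]
      intro N
      rw [ae_all_iff]
      intro k
      exact condExp_eq_of_monotone (ℱ.le k) (he.condExp_eq k)
        (he.differentiable.mono fun ω h => (h k).continuous) (hSint k) (hXm k) (hE N k)
        (fun ω hω => hω.2.1.saturation_mono) (hYi N k)
    filter_upwards [hcond, hEall] with ω h1 ⟨N, hN⟩
    refine ⟨N, fun k => ?_⟩
    rw [h1 N k (hN k), hy]
    simp only [Y, Set.indicator_of_mem (hN k)]
    rfl

end ObservationNoise

/-! ### From the pathwise bounds to the almost sure theorem -/

theorem ae_exists_pathBounds {d : ℕ} {Ω : Type*} {mΩ : MeasurableSpace Ω} {Pr : Measure Ω}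
    {ℱ : Filtration ℕ mΩ} {φ : ℕ → Ω → EuclideanSpace ℝ (Fin d)}
    {D : Set (EuclideanSpace ℝ (Fin d))} {θ : EuclideanSpace ℝ (Fin d)} {M : ℕ → Ω → ℝ}
    (hφ : RegressorAssumption Pr ℱ φ D θ) (hM : IsRegressorBound Pr ℱ φ D M)
    {l u L U : ℕ → Ω → EReal} {e : ℕ → Ω → ℝ} {G : ℕ → Ω → ℝ → ℝ}
    (he : NoiseAssumption Pr ℱ l u L U M e G) :
    ∀ᵐ ω ∂Pr, ∃ C K g₁ g₂ ρ, PathBounds D (fun k => φ k ω) (fun k => G k ω) (fun k => M k ω)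
      C K g₁ g₂ ρ := by
  obtain ⟨K, -, hK⟩ := he.deriv_bounds
  filter_upwards [hφ.bounded, hM.bounded, hM.le, he.differentiable, hK] with ω ⟨C, h1⟩ ⟨B, h2⟩ h3 h4
    ⟨h5, ⟨g₁, g₂, h6, h7⟩, ρ, h8, h9⟩
  -- Without boundedness the real supremum would take its default value `0` and would not dominate
  -- the `M k`.
  have hbdd : BddAbove (Set.range fun k => M k ω) :=
    ⟨B, by rintro _ ⟨k, rfl⟩; exact le_of_abs_le (h2 k)⟩
  exact ⟨C, K ω, g₁, g₂, ρ, h1, h3, fun k => (le_ciSup hbdd k).trans h5.le, h4, h6, h7, h8, h9⟩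

end TSQN

theorem theorem1 {m : ℕ} (hm : 1 ≤ m) {Ω : Type*} {mΩ : MeasurableSpace Ω}
    (Pr : Measure Ω) [IsProbabilityMeasure Pr] (ℱ : Filtration ℕ mΩ)
    -- regressors, parameter set, true parameter, regressor bound
    (φ : ℕ → Ω → EuclideanSpace ℝ (Fin m)) (D : Set (EuclideanSpace ℝ (Fin m)))
    (θ : EuclideanSpace ℝ (Fin m)) (M : ℕ → Ω → ℝ)
    (hφ : TSQN.RegressorAssumption Pr ℱ φ D θ) (hM : TSQN.IsRegressorBound Pr ℱ φ D M)
    -- thresholds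
    (l u L U : ℕ → Ω → EReal) (hS : TSQN.ThresholdAssumption Pr ℱ l u L U)
    -- noise and conditional expectation functions
    (e : ℕ → Ω → ℝ) (G : ℕ → Ω → ℝ → ℝ) (he : TSQN.NoiseAssumption Pr ℱ l u L U M e G)
    -- observations
    (y : ℕ → Ω → ℝ)
    (hy : ∀ k ω, y (k + 1) ω = TSQN.saturation (l k ω) (u k ω) (L k ω) (U k ω)
      (inner ℝ (φ k ω) θ + e (k + 1) ω))
    -- regularization factors and initial values of the algorithm
    (μ : ℕ → Ω → ℝ) (hμ : TSQN.IsRegularization Pr ℱ μ)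
    (θbar₀ θhat₀ : EuclideanSpace ℝ (Fin m)) (Pbar₀ P₀ : Matrix (Fin m) (Fin m) ℝ)
    (hθbar₀ : θbar₀ ∈ D) (hθhat₀ : θhat₀ ∈ D) (hPbar₀ : Pbar₀.PosDef) (hP₀ : P₀.PosDef)
    (lam0 : ℝ) (hlam0 : ‖Matrix.toEuclideanCLM (n := Fin m) (𝕜 := ℝ) P₀⁻¹‖ < lam0)
    -- the accelerated estimate and the extreme eigenvalues of the information matrix
    (θhat : ℕ → Ω → EuclideanSpace ℝ (Fin m))
    (hθhat : ∀ k ω, θhat k ω = TSQN.estimate D (fun i => φ i ω) (fun i => y i ω)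
      (fun i => G i ω) (fun i => M i ω) (fun i => μ i ω) (θbar₀, Pbar₀) (θhat₀, P₀) k)
    (lmax lmin : ℕ → Ω → ℝ)
    (hlmax : ∀ k ω, lmax k ω = TSQN.lamMax (TSQN.infoMatrix (fun i => φ i ω) lam0 k))
    (hlmin : ∀ k ω, lmin k ω = TSQN.lamMin (TSQN.infoMatrix (fun i => φ i ω) lam0 k)) :
    ∀ᵐ ω ∂Pr, ¬ Tendsto (fun k => lmax k ω) atTop (𝓝 1) →
      ((fun k => ‖θ - θhat (k + 1) ω‖ ^ 2) =O[atTop]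
        fun k => Real.log (lmax k ω) / lmin k ω) ∧
      (Tendsto (fun k => Real.log (lmax k ω) / lmin k ω) atTop (𝓝 0) →
        Tendsto (fun k => θhat k ω) atTop (𝓝 θ)) := by
  have : NeZero m := ⟨by omega⟩
  have hθ : θ ∈ D := interior_subset hφ.interior
  have hne : D.Nonempty := ⟨θ, hθ⟩
  have hlam : 0 < lam0 := (norm_nonneg _).trans_lt hlam0
  have hB := TSQN.ae_exists_pathBounds hφ hM he
  have hw := TSQN.locallyBoundedNoise_observation hφ hS he hy
  have hμ0 : ∀ᵐ ω ∂Pr, ∀ k, 0 < μ k ω := by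
    filter_upwards [hμ.bounds] with ω ⟨c₁, c₂, h0, h⟩ k
    exact h0.trans_le (h k).1
  -- measurability of the data
  have hφm : ∀ k, TSQN.AEM (ℱ k) Pr (φ k) := fun k => .of_measurable (hφ.adapted k).measurable
  have hMm : ∀ k, TSQN.AEM (ℱ k) Pr (M k) := fun k => .of_measurable (hM.adapted k).measurable
  have hμm : ∀ k, TSQN.AEM (ℱ k) Pr (μ k) := fun k => .of_measurable (hμ.adapted k).measurable
  have hym : ∀ k, TSQN.AEM (ℱ (k + 1)) Pr (y (k + 1)) := fun k => by
    have hle := ℱ.mono k.le_succ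
    have h1 := TSQN.measurable_saturation ((hS.adapted_l k).mono hle le_rfl)
      ((hS.adapted_u k).mono hle le_rfl) ((hS.adapted_L k).mono hle le_rfl)
      ((hS.adapted_U k).mono hle le_rfl)
      ((((by fun_prop : Measurable fun z : EuclideanSpace ℝ (Fin m) => (inner ℝ z θ : ℝ)).comp
        (hφ.adapted k).measurable).mono hle le_rfl).add (he.adapted k).measurable)
    exact .congr (.of_measurable h1) (Eventually.of_forall fun ω => (hy k ω).symm)
  have hG : ∀ k, TSQN.HasJointVersion (ℱ k) Pr (G k) := fun k =>
    TSQN.hasJointVersion_of_continuous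
      (fun x => ⟨_, stronglyMeasurable_condExp.measurable, he.condExp_eq k x⟩)
      (he.differentiable.mono fun ω h => (h k).continuous)
  have hdiff : ∀ k, ∀ᵐ ω ∂Pr, Differentiable ℝ (G k ω) := fun k =>
    he.differentiable.mono fun ω h => h k
  -- the first step
  set st1 : ℕ → Ω → EuclideanSpace ℝ (Fin m) × Matrix (Fin m) (Fin m) ℝ := fun k ω =>
    TSQN.step1 D (fun i => φ i ω) (fun i => y i ω) (fun i => G i ω) (fun i => M i ω)
      (θbar₀, Pbar₀) k with hst1
  have ht1 : ∀ ω, TSQN.IsTrajectory D (fun k => φ k ω) (fun k => y k ω) (fun k => G k ω)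
      (fun _ => 1) (fun k => TSQN.betaBar (G k ω) (M k ω) (φ k ω) (st1 k ω).2)
      fun k => st1 k ω := fun ω => TSQN.step1_isTrajectory hθbar₀ hPbar₀
  have hb1 : ∀ k, TSQN.AEM (ℱ k) Pr (st1 k) →
      TSQN.AEM (ℱ k) Pr fun ω => TSQN.betaBar (G k ω) (M k ω) (φ k ω) (st1 k ω).2 := fun k h =>
    TSQN.AEM.betaBar hφm hG hMm hne hB (h.map measurable_snd)
  have hm1 : ∀ k, TSQN.AEM (ℱ k) Pr (st1 k) := fun k =>
    TSQN.AEM.trajectory hφ.convex hφ.compact hφm hym hG (μ := fun _ _ => 1)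
      (fun _ => .const 1) (Eventually.of_forall ht1) hne (.const _) hb1 k
  -- the second step
  set st2 : ℕ → Ω → EuclideanSpace ℝ (Fin m) × Matrix (Fin m) (Fin m) ℝ := fun k ω =>
    TSQN.step2 D (fun i => φ i ω) (fun i => y i ω) (fun i => G i ω) (fun i => μ i ω)
      (fun j => (st1 j ω).1) (θhat₀, P₀) k with hst2
  have ht2 : ∀ᵐ ω ∂Pr, TSQN.IsTrajectory D (fun k => φ k ω) (fun k => y k ω) (fun k => G k ω)
      (fun k => μ k ω) (fun k => TSQN.beta (G k ω) (φ k ω) (st1 k ω).1 (st2 k ω).1)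
      fun k => st2 k ω := hμ0.mono fun ω h => TSQN.step2_isTrajectory h hθhat₀ hP₀
  have hb2 : ∀ k, TSQN.AEM (ℱ k) Pr (st2 k) →
      TSQN.AEM (ℱ k) Pr fun ω => TSQN.beta (G k ω) (φ k ω) (st1 k ω).1 (st2 k ω).1 := fun k h =>
    TSQN.AEM.beta (hG k) (hdiff k) (hφm k) ((hm1 k).map measurable_fst) (h.map measurable_fst)
  have hm2 : ∀ k, TSQN.AEM (ℱ k) Pr (st2 k) := fun k =>
    TSQN.AEM.trajectory hφ.convex hφ.compact hφm hym hG hμm ht2 hne (.const _) hb2 k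
  -- the noise terms
  have hn1 := hw.ae_noiseNegligible fun k => TSQN.AEM.noiseCoeff θ (.const 1) (hb1 k (hm1 k))
    (hG k) (hφm k) ((hm1 k).map measurable_fst) ((hm1 k).map measurable_snd)
  have hn2 := hw.ae_noiseNegligible fun k => TSQN.AEM.noiseCoeff θ (hμm k) (hb2 k (hm2 k))
    (hG k) (hφm k) ((hm2 k).map measurable_fst) ((hm2 k).map measurable_snd)
  have hs1 := hw.ae_squareDominated (fun k => TSQN.AEM.leverage (.const 1) (hb1 k (hm1 k))
    (hφm k) ((hm1 k).map measurable_snd)) (Eventually.of_forall fun ω k =>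
      ⟨TSQN.leverage_nonneg ((ht1 ω).posDef k) one_pos _ _,
        TSQN.leverage_le_one ((ht1 ω).posDef k) one_pos _ _⟩)
  have hs2 := hw.ae_squareDominated (fun k => TSQN.AEM.leverage (hμm k) (hb2 k (hm2 k))
    (hφm k) ((hm2 k).map measurable_snd)) (ht2.mono fun ω h k =>
      ⟨TSQN.leverage_nonneg (h.posDef k) (h.mu_pos k) _ _,
        TSQN.leverage_le_one (h.posDef k) (h.mu_pos k) _ _⟩)
  filter_upwards [hB, hμ.bounds, hn1, hn2, hs1, hs2] with ω ⟨C, K, g₁, g₂, ρ, hPB⟩ ⟨c₁, c₂, hc₁, hc⟩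
    h1 h2 h3 h4 hlim
  simp_rw [hlmax] at hlim
  have hO := TSQN.estimate_isBigO hφ.convex hφ.compact hθ hPB hc₁ hc hlam
    (initBar := (θbar₀, Pbar₀)) (init := (θhat₀, P₀)) hθbar₀ hPbar₀ hθhat₀ hP₀ h1 h3 rfl h2 h4 hlim
  have hest : ∀ k, θhat k ω = (st2 k ω).1 := fun k => hθhat k ω
  have hO' : (fun k => ‖θ - θhat (k + 1) ω‖ ^ 2) =O[atTop]
      fun k => Real.log (lmax k ω) / lmin k ω := by
    simp_rw [hlmax, hlmin, hest]
    exact hO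
  refine ⟨hO', fun hto => ?_⟩
  have h5 := hO'.trans_tendsto hto
  have h6 : Tendsto (fun k => ‖θ - θhat (k + 1) ω‖) atTop (𝓝 0) := by
    have := h5.sqrt
    simpa [Real.sqrt_sq] using this
  -- The rate concerns the estimate at `k + 1`; the shift does not affect the limit.
  rw [← tendsto_add_atTop_iff_nat 1, tendsto_iff_norm_sub_tendsto_zero]
  simpa only [norm_sub_rev] using h6
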